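/- Let $a\in[-1,1)\setminus\{0\}$. For $x=(x_1,x_2)\in\mathbb R^2$ let $\mathbf A_0(x)=(-x_2,0)$ and let $\sigma(x)=1$ if $x_2>0$, $\sigma(x)=a$ if $x_2\le 0$. Let $\beta_a=\inf \mathrm{sp}(\mathcal L_a)$ be the bottom of the spectrum of the self-adjoint operator $\mathcal L_a=-(\nabla-i\sigma\mathbf A_0)^2$ in $L^2(\mathbb R^2)$, with domain the set of $u\in L^2(\mathbb R^2)$ for which $(\nabla-i\sigma\mathbf A_0)u$ and $(\nabla-i\sigma\mathbf A_0)^2u$, taken in the sense of distributions, are in $L^2(\mathbb R^2)$. For $R>0$ let $S_R=(-R/2,R/2)\times\mathbb R$ and $$\mathcal D_R=\Big\{u\in L^2(S_R;\mathbb C)\,:\,(\nabla-i\sigma\mathbf A_0)u\in L^2(S_R),\ u=0 \text{ on } x_1=\pm R/2 \text{ (in the sense of traces)}\Big\},$$ and for $b>0$ let $$\mathfrak g_a(b,R)=\inf_{u\in\mathcal D_R}\int_{S_R}\Big(b\,|(\nabla-i\sigma\mathbf A_0)u|^2-|u|^2+\tfrac12|u|^4\Big)\,dx .$$ Then the following holds.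 \begin{enumerate} \item For all $b\ge 1/|a|$ and $R>0$, $\mathfrak g_a(b,R)$ is finite and $\mathfrak g_a(b,R)\le 0$. \item If $a\in(0,1)$, then $\mathfrak g_a(b,R)=0$ for all $b\ge 1/|a|$ and $R>0$. \item If $a\in[-1,0)$, then for every $b\ge 1/|a|$ there is a real number $\mathfrak e_a(b)\le 0$ such that $\lim_{R\to+\infty}\mathfrak g_a(b,R)/R=\mathfrak e_a(b)$. Furthermore, $\mathfrak e_a(b)=0$ if and only if $b\ge 1/\beta_a$. \item If $a\in[-1,0)$, then the function $[1/|a|,+\infty)\ni b\mapsto \mathfrak e_a(b)$ is non-decreasing and continuous. \item There is a universal constant $C>0$ (independent of $a$, $b$ and $R$) such that, for all $a\in[-1,0)$, $b\ge 1/|a|$ and $R\ge 4$, $$\mathfrak e_a(b)\le \frac{\mathfrak g_a(b,R)}{R}\le \mathfrak e_a(b)+C\,\frac{b^2}{R^{1/3}} .$$ \end{enumerate} -/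

import Mathlib

open MeasureTheory Set Filter Topology

noncomputable section

namespace StepGL

/-- The step function `σ` on the plane: `1` in the upper half-plane, `a` in the lower one. -/
def step (a : ℝ) (x : ℝ × ℝ) : ℝ := if 0 < x.2 then 1 else a

/-- First component of the magnetic potential `σ A₀`, where `A₀(x) = (-x₂, 0)`;
the second component is zero. -/
def pot (a : ℝ) (x : ℝ × ℝ) : ℝ := step a x * (-x.2)

/-- Real-valued smooth compactly supported test functions on the plane. -/
def IsTest (φ : ℝ × ℝ → ℝ) : Prop :=
  ContDiff ℝ (⊤ : ℕ∞) φ ∧ HasCompactSupport φ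

/-- Classical partial derivatives of a test function. -/
def d1 (φ : ℝ × ℝ → ℝ) (x : ℝ × ℝ) : ℝ := fderiv ℝ φ x (1, 0)

def d2 (φ : ℝ × ℝ → ℝ) (x : ℝ × ℝ) : ℝ := fderiv ℝ φ x (0, 1)

/-- `(v₁, v₂) = (∇ - i σ A₀) u` in the sense of distributions on the open set `Ω`, that is,
`v₁ = ∂₁ u - i (pot a) u` and `v₂ = ∂₂ u`. -/
def IsWeakMagGrad (a : ℝ) (Ω : Set (ℝ × ℝ)) (u v₁ v₂ : ℝ × ℝ → ℂ) : Prop :=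
  ∀ φ : ℝ × ℝ → ℝ, IsTest φ → tsupport φ ⊆ Ω →
    (∫ x in Ω, φ x • v₁ x =
      ∫ x in Ω, (-(d1 φ x • u x) - φ x • (Complex.I * (pot a x : ℂ) * u x))) ∧
    (∫ x in Ω, φ x • v₂ x = ∫ x in Ω, -(d2 φ x • u x))

/-- `f = -((∂₁ - i (pot a)) v₁ + ∂₂ v₂)` in the sense of distributions on the plane. -/
def IsWeakMagNegDiv (a : ℝ) (v₁ v₂ f : ℝ × ℝ → ℂ) : Prop :=
  ∀ φ : ℝ × ℝ → ℝ, IsTest φ →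
    ∫ x, φ x • f x =
      ∫ x, (d1 φ x • v₁ x + φ x • (Complex.I * (pot a x : ℂ) * v₁ x) + d2 φ x • v₂ x)

/-- The Hilbert space `L²(ℝ²; ℂ)`. -/
abbrev L2 : Type := Lp ℂ 2 (volume : Measure (ℝ × ℝ))

/-- The graph of the self-adjoint magnetic Hamiltonian `𝓛_a = -(∇ - i σ A₀)²` in `L²(ℝ²)`:
its domain consists of the `u ∈ L²` with `(∇ - i σ A₀) u ∈ L²` and `(∇ - i σ A₀)² u ∈ L²`
(distributional sense), and `HamiltonianGraph a u f` says that `u` is in the domain and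
`𝓛_a u = f`. -/
def HamiltonianGraph (a : ℝ) (u f : L2) : Prop :=
  ∃ v₁ v₂ : ℝ × ℝ → ℂ, MemLp v₁ 2 volume ∧ MemLp v₂ 2 volume ∧
    IsWeakMagGrad a univ u v₁ v₂ ∧ IsWeakMagNegDiv a v₁ v₂ f

/-- The spectrum of `𝓛_a`: the complex `z` for which `𝓛_a - z` has no bounded two-sided inverse
`T : L² → dom 𝓛_a` (note that `HamiltonianGraph a u (f + z • u)` means `(𝓛_a - z) u = f`). -/
def hamiltonianSpectrum (a : ℝ) : Set ℂ :=
  {z | ¬ ∃ T : L2 →L[ℂ] L2, ∀ f u : L2, HamiltonianGraph a u (f + z • u) ↔ u = T f}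

/-- `β_a = inf sp(𝓛_a)`; the spectrum of the self-adjoint operator `𝓛_a` is real. -/
def beta (a : ℝ) : ℝ := sInf {t : ℝ | (t : ℂ) ∈ hamiltonianSpectrum a}

/-- The strip `S_R = (-R/2, R/2) × ℝ`. -/
def strip (R : ℝ) : Set (ℝ × ℝ) := Ioo (-R / 2) (R / 2) ×ˢ univ

/-- `τm` and `τp` are the traces of `u` on the lines `x₁ = -R/2` and `x₁ = R/2`, where `w = ∂₁ u`
in the strip: the Green formula in the direction `x₁` holds with the boundary values `τm`, `τp`
against every test function on the plane. -/
def IsLateralTrace (R : ℝ) (u w : ℝ × ℝ → ℂ) (τm τp : ℝ → ℂ) : Prop :=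
  LocallyIntegrable τm ∧ LocallyIntegrable τp ∧
  ∀ φ : ℝ × ℝ → ℝ, IsTest φ →
    ∫ x in strip R, (d1 φ x • u x + φ x • w x) =
      (∫ y, φ (R / 2, y) • τp y) - ∫ y, φ (-R / 2, y) • τm y

/-- `u ∈ 𝓓_R` with `(∇ - i σ A₀) u = (v₁, v₂)`: `u` and its magnetic gradient are in `L²(S_R)`
and `u` vanishes on the lateral boundary `x₁ = ± R/2`. The pair `(v₁, v₂)` is determined by `u`
almost everywhere in the strip, and `∂₁ u = v₁ + i (pot a) u`. -/
structure InDomain (a R : ℝ) (u v₁ v₂ : ℝ × ℝ → ℂ) : Prop where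
  memLp : MemLp u 2 (volume.restrict (strip R))
  memLp_grad₁ : MemLp v₁ 2 (volume.restrict (strip R))
  memLp_grad₂ : MemLp v₂ 2 (volume.restrict (strip R))
  grad : IsWeakMagGrad a (strip R) u v₁ v₂
  trace_zero : IsLateralTrace R u (fun x => v₁ x + Complex.I * (pot a x : ℂ) * u x) 0 0

/-- The Ginzburg--Landau energy of `u` with magnetic gradient `(v₁, v₂)` in the strip. (Should
`|u|⁴` not be integrable, the integral reads `0`, the energy of `u = 0`, instead of `+∞`; this has
no effect on the infimum.) -/
def energy (b R : ℝ) (u v₁ v₂ : ℝ × ℝ → ℂ) : ℝ :=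
  ∫ x in strip R,
    (b * (‖v₁ x‖ ^ 2 + ‖v₂ x‖ ^ 2) - ‖u x‖ ^ 2 + (1 / 2) * ‖u x‖ ^ 4)

/-- The set of values of the energy on `𝓓_R`. -/
def energyValues (a b R : ℝ) : Set ℝ :=
  {E | ∃ u v₁ v₂ : ℝ × ℝ → ℂ, InDomain a R u v₁ v₂ ∧ E = energy b R u v₁ v₂}

/-- The ground state energy `𝔤_a(b, R)`, the infimum of the energy over `𝓓_R`. -/
def groundEnergy (a b R : ℝ) : ℝ := sInf (energyValues a b R)

end StepGL

end

/-! Write D₁ = ∂₁ - iσA₀ and D₂ = ∂₂ for the magnetic derivatives, q(u) = ‖D₁u‖² + ‖D₂u‖² for the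
form. Extension by zero turns the strip problem into one for magnetic Sobolev functions on the plane
that vanish off the strip (`mem_energyValues_iff`), where translation, cut-off and density of test
functions (`MagH1.exists_test`) are available.

The basic lower bound comes from the commutator [D₁, D₂] = -iσ, which gives |∫ σ|u|²| ≤ q(u)
(`MagH1.abs_integral_step_le`). If a > 0, then σ ≥ a, so q(u) ≥ a‖u‖² and no configuration has
negative energy once b ≥ 1/a. If a < 0, the signs of σ compete only near the line x₂ = 0: a function
that vanishes near it can be cut into an upper and a lower half, and q(u) ≥ |a|‖u‖² again
(`MagH1.le_of_eq_zero`). A partition of unity in x₂ at scale L then discards the part of u far from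
the line, at a cost of order b L⁻² ∫|u|² over a box of area of order RL, and the quartic term
controls this integral by Young's inequality. Hence the energy is at least of order -b²R
(`Adm.lower_bound`).

For a < 0 the limit is e = inf over R of g(R)/R. Gluing gives subadditivity. Conversely, a
configuration on a strip of length M is averaged over translates of a cut-off of length R
(`Adm.average`); combined with localization at scale L = √R this yields (M + R) g(R) ≤ (R - 2) g(M)
+ C b² M √R (`groundEnergy_long`). Letting M → ∞ along multiples gives g(R) ≤ (R - 2) e + C b² √R,
hence convergence, with an error of order b² R^(-1/2), better than the stated one.

The energy is affine and non-decreasing in b, so e is concave and non-decreasing; this gives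
continuity, with upper semicontinuity at the left endpoint.

For the threshold, let J be the embedding of the form domain into L². The resolvent of the
Hamiltonian at -1 is J J*, so β = 1/‖J‖² - 1 is the infimum of q(u)/‖u‖² (`beta_eq_formBottom`),
positive for a < 0 (`exists_coercive`). If bβ ≥ 1, the quadratic energy is non-negative. If bβ < 1,
some compactly supported u has b q(u) < ‖u‖², and a small multiple of it has negative energy on a
finite strip, so e < 0. -/

noncomputable section

namespace StepGL

/-! ### The magnetic potential and test functions -/

/-- The jump of σ is harmless because the potential vanishes on x₂ = 0; positive and negative parts
make its continuity and Lipschitz bound visible. -/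
theorem pot_eq (a : ℝ) (x : ℝ × ℝ) : pot a x = -max x.2 0 + a * max (-x.2) 0 := by
  unfold pot step
  split_ifs with h
  · rw [max_eq_left h.le, max_eq_right (by linarith)]; ring
  · rw [max_eq_right (by linarith), max_eq_left (by linarith)]; ring

theorem continuous_pot (a : ℝ) : Continuous (pot a) := by
  have : pot a = fun x => -max x.2 0 + a * max (-x.2) 0 := funext (pot_eq a)
  rw [this]; fun_prop

theorem IsTest.continuous {φ : ℝ × ℝ → ℝ} (h : IsTest φ) : Continuous φ := h.1.continuous

theorem IsTest.differentiable {φ : ℝ × ℝ → ℝ} (h : IsTest φ) : Differentiable ℝ φ :=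
  h.1.differentiable (by simp)

theorem IsTest.continuous_fderiv {φ : ℝ × ℝ → ℝ} (h : IsTest φ) (e : ℝ × ℝ) :
    Continuous fun x => fderiv ℝ φ x e :=
  (h.1.continuous_fderiv (by simp)).clm_apply continuous_const

theorem IsTest.continuous_d1 {φ : ℝ × ℝ → ℝ} (h : IsTest φ) : Continuous (d1 φ) :=
  h.continuous_fderiv _

theorem IsTest.continuous_d2 {φ : ℝ × ℝ → ℝ} (h : IsTest φ) : Continuous (d2 φ) :=
  h.continuous_fderiv _

theorem IsTest.hasCompactSupport_d1 {φ : ℝ × ℝ → ℝ} (h : IsTest φ) : HasCompactSupport (d1 φ) :=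
  h.2.fderiv_apply ℝ _

theorem IsTest.hasCompactSupport_d2 {φ : ℝ × ℝ → ℝ} (h : IsTest φ) : HasCompactSupport (d2 φ) :=
  h.2.fderiv_apply ℝ _

theorem IsTest.mul_left {φ g : ℝ × ℝ → ℝ} (h : IsTest φ) (hg : ContDiff ℝ (⊤ : ℕ∞) g) :
    IsTest fun x => g x * φ x :=
  ⟨hg.mul h.1, h.2.mul_left⟩

/-- A continuous compactly supported real function times a locally integrable one. -/
theorem integrable_smul_of_compact {μ : Measure (ℝ × ℝ)} {g : ℝ × ℝ → ℝ} {f : ℝ × ℝ → ℂ}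
    (hf : LocallyIntegrable f μ) (hg : Continuous g) (hc : HasCompactSupport g) :
    Integrable (fun x => g x • f x) μ :=
  hf.integrable_smul_left_of_hasCompactSupport hg hc

theorem locallyIntegrable_pot_mul {μ : Measure (ℝ × ℝ)} (a : ℝ)
    {f : ℝ × ℝ → ℂ} (hf : LocallyIntegrable f μ) :
    LocallyIntegrable (fun x => Complex.I * (pot a x : ℂ) * f x) μ :=
  LocallyIntegrable.continuous_mul (by have := continuous_pot a; fun_prop) hf

/-! ### Magnetic Sobolev functions on the plane -/

/-- `u` and its magnetic gradient `(v₁, v₂)` are square integrable on the plane. -/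
structure MagH1 (a : ℝ) (u v₁ v₂ : ℝ × ℝ → ℂ) : Prop where
  memLp : MemLp u 2 volume
  memLp₁ : MemLp v₁ 2 volume
  memLp₂ : MemLp v₂ 2 volume
  weak₁ : ∀ φ : ℝ × ℝ → ℝ, IsTest φ →
    ∫ x, (d1 φ x • u x + φ x • (v₁ x + Complex.I * (pot a x : ℂ) * u x)) = 0
  weak₂ : ∀ φ : ℝ × ℝ → ℝ, IsTest φ → ∫ x, (d2 φ x • u x + φ x • v₂ x) = 0


theorem memLp_bounded_smul {μ : Measure (ℝ × ℝ)} {k : ℝ × ℝ → ℝ} {f : ℝ × ℝ → ℂ} {C : ℝ}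
    (hf : MemLp f 2 μ) (hk : AEStronglyMeasurable k μ) (hC : ∀ x, |k x| ≤ C) :
    MemLp (fun x => k x • f x) 2 μ :=
  MemLp.of_le_mul (c := C) hf (hk.smul hf.1) (.of_forall fun x => by
    rw [norm_smul, Real.norm_eq_abs]
    exact mul_le_mul_of_nonneg_right (hC x) (norm_nonneg _))

theorem d1_mul {φ χ : ℝ × ℝ → ℝ} (hφ : Differentiable ℝ φ) (hχ : Differentiable ℝ χ) (x : ℝ × ℝ) :
    d1 (fun y => χ y * φ y) x = d1 χ x * φ x + χ x * d1 φ x := by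
  unfold d1
  rw [fderiv_fun_mul (hχ x) (hφ x)]
  simp; ring

theorem d2_mul {φ χ : ℝ × ℝ → ℝ} (hφ : Differentiable ℝ φ) (hχ : Differentiable ℝ χ) (x : ℝ × ℝ) :
    d2 (fun y => χ y * φ y) x = d2 χ x * φ x + χ x * d2 φ x := by
  unfold d2
  rw [fderiv_fun_mul (hχ x) (hφ x)]
  simp; ring

theorem hasFDerivAt_comp_fst {k : ℝ → ℝ} (hk : Differentiable ℝ k) (x : ℝ × ℝ) :
    HasFDerivAt (fun y : ℝ × ℝ => k y.1) (deriv k x.1 • ContinuousLinearMap.fst ℝ ℝ ℝ) x :=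
  (hk x.1).hasDerivAt.comp_hasFDerivAt x hasFDerivAt_fst

theorem hasFDerivAt_comp_snd {k : ℝ → ℝ} (hk : Differentiable ℝ k) (x : ℝ × ℝ) :
    HasFDerivAt (fun y : ℝ × ℝ => k y.2) (deriv k x.2 • ContinuousLinearMap.snd ℝ ℝ ℝ) x :=
  (hk x.2).hasDerivAt.comp_hasFDerivAt x hasFDerivAt_snd

theorem d1_comp_fst {k : ℝ → ℝ} (hk : Differentiable ℝ k) (x : ℝ × ℝ) :
    d1 (fun y => k y.1) x = deriv k x.1 := by
  simp [d1, (hasFDerivAt_comp_fst hk x).fderiv]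

theorem d2_comp_fst {k : ℝ → ℝ} (hk : Differentiable ℝ k) (x : ℝ × ℝ) :
    d2 (fun y => k y.1) x = 0 := by
  simp [d2, (hasFDerivAt_comp_fst hk x).fderiv]

theorem d1_comp_snd {k : ℝ → ℝ} (hk : Differentiable ℝ k) (x : ℝ × ℝ) :
    d1 (fun y => k y.2) x = 0 := by
  simp [d1, (hasFDerivAt_comp_snd hk x).fderiv]

theorem d2_comp_snd {k : ℝ → ℝ} (hk : Differentiable ℝ k) (x : ℝ × ℝ) :
    d2 (fun y => k y.2) x = deriv k x.2 := by
  simp [d2, (hasFDerivAt_comp_snd hk x).fderiv]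

namespace MagH1

variable {a : ℝ} {u v₁ v₂ u' v₁' v₂' : ℝ × ℝ → ℂ}

theorem locallyIntegrable (h : MagH1 a u v₁ v₂) : LocallyIntegrable u volume :=
  h.memLp.locallyIntegrable (by norm_num)

theorem locallyIntegrable₁ (h : MagH1 a u v₁ v₂) :
    LocallyIntegrable (fun x => v₁ x + Complex.I * (pot a x : ℂ) * u x) volume :=
  (h.memLp₁.locallyIntegrable (by norm_num)).add (locallyIntegrable_pot_mul a h.locallyIntegrable)

theorem locallyIntegrable₂ (h : MagH1 a u v₁ v₂) : LocallyIntegrable v₂ volume :=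
  h.memLp₂.locallyIntegrable (by norm_num)

theorem integrable_weak₁ (h : MagH1 a u v₁ v₂) {φ : ℝ × ℝ → ℝ} (hφ : IsTest φ) :
    Integrable (fun x => d1 φ x • u x + φ x • (v₁ x + Complex.I * (pot a x : ℂ) * u x)) :=
  (integrable_smul_of_compact h.locallyIntegrable hφ.continuous_d1 hφ.hasCompactSupport_d1).add
    (integrable_smul_of_compact h.locallyIntegrable₁ hφ.continuous hφ.2)

theorem integrable_weak₂ (h : MagH1 a u v₁ v₂) {φ : ℝ × ℝ → ℝ} (hφ : IsTest φ) :
    Integrable (fun x => d2 φ x • u x + φ x • v₂ x) :=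
  (integrable_smul_of_compact h.locallyIntegrable hφ.continuous_d2 hφ.hasCompactSupport_d2).add
    (integrable_smul_of_compact h.locallyIntegrable₂ hφ.continuous hφ.2)

theorem zero (a : ℝ) : MagH1 a 0 0 0 where
  memLp := MemLp.zero
  memLp₁ := MemLp.zero
  memLp₂ := MemLp.zero
  weak₁ _ _ := by simp
  weak₂ _ _ := by simp

theorem add (h : MagH1 a u v₁ v₂) (h' : MagH1 a u' v₁' v₂') :
    MagH1 a (fun x => u x + u' x) (fun x => v₁ x + v₁' x) (fun x => v₂ x + v₂' x) where
  memLp := h.memLp.add h'.memLp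
  memLp₁ := h.memLp₁.add h'.memLp₁
  memLp₂ := h.memLp₂.add h'.memLp₂
  weak₁ φ hφ := by
    have := integral_add (h.integrable_weak₁ hφ) (h'.integrable_weak₁ hφ)
    rw [h.weak₁ φ hφ, h'.weak₁ φ hφ, add_zero] at this
    rw [← this]
    congr 1; ext x; simp only [Complex.real_smul]; ring
  weak₂ φ hφ := by
    have := integral_add (h.integrable_weak₂ hφ) (h'.integrable_weak₂ hφ)
    rw [h.weak₂ φ hφ, h'.weak₂ φ hφ, add_zero] at this
    rw [← this]
    congr 1; ext x; simp only [Complex.real_smul]; ring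

theorem const_mul (h : MagH1 a u v₁ v₂) (c : ℂ) :
    MagH1 a (fun x => c * u x) (fun x => c * v₁ x) (fun x => c * v₂ x) where
  memLp := h.memLp.const_mul c
  memLp₁ := h.memLp₁.const_mul c
  memLp₂ := h.memLp₂.const_mul c
  weak₁ φ hφ := by
    have := integral_const_mul (μ := volume) c
      (fun x => d1 φ x • u x + φ x • (v₁ x + Complex.I * (pot a x : ℂ) * u x))
    rw [h.weak₁ φ hφ, mul_zero] at this
    rw [← this]
    congr 1; ext x; simp only [Complex.real_smul]; ring
  weak₂ φ hφ := by
    have := integral_const_mul (μ := volume) c (fun x => d2 φ x • u x + φ x • v₂ x)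
    rw [h.weak₂ φ hφ, mul_zero] at this
    rw [← this]
    congr 1; ext x; simp only [Complex.real_smul]; ring

/-- Multiplication by a smooth function which is bounded along with its first derivatives. -/
theorem smul (h : MagH1 a u v₁ v₂) {χ : ℝ × ℝ → ℝ} (hχ : ContDiff ℝ (⊤ : ℕ∞) χ) {C : ℝ}
    (h0 : ∀ x, |χ x| ≤ C) (h1 : ∀ x, |d1 χ x| ≤ C) (h2 : ∀ x, |d2 χ x| ≤ C) :
    MagH1 a (fun x => χ x • u x) (fun x => χ x • v₁ x + d1 χ x • u x)
      (fun x => χ x • v₂ x + d2 χ x • u x) := by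
  have hd : Differentiable ℝ χ := hχ.differentiable (by simp)
  have hc (e : ℝ × ℝ) : Continuous fun x => fderiv ℝ χ x e :=
    (hχ.continuous_fderiv (by simp)).clm_apply continuous_const
  have hm0 := hχ.continuous.aestronglyMeasurable (μ := volume)
  have hm1 : AEStronglyMeasurable (d1 χ) volume := (hc _).aestronglyMeasurable
  have hm2 : AEStronglyMeasurable (d2 χ) volume := (hc _).aestronglyMeasurable
  refine ⟨memLp_bounded_smul h.memLp hm0 h0,
    (memLp_bounded_smul h.memLp₁ hm0 h0).add (memLp_bounded_smul h.memLp hm1 h1),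
    (memLp_bounded_smul h.memLp₂ hm0 h0).add (memLp_bounded_smul h.memLp hm2 h2), ?_, ?_⟩
  · intro φ hφ
    rw [← h.weak₁ _ (hφ.mul_left hχ)]
    congr 1; ext x
    simp only [d1_mul hφ.differentiable hd, Complex.real_smul]
    push_cast; ring
  · intro φ hφ
    rw [← h.weak₂ _ (hφ.mul_left hχ)]
    congr 1; ext x
    simp only [d2_mul hφ.differentiable hd, Complex.real_smul]
    push_cast; ring

theorem smul_fst (h : MagH1 a u v₁ v₂) {k : ℝ → ℝ} (hk : ContDiff ℝ (⊤ : ℕ∞) k) {C : ℝ}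
    (h0 : ∀ x, |k x| ≤ C) (h1 : ∀ x, |deriv k x| ≤ C) :
    MagH1 a (fun x => k x.1 • u x) (fun x => k x.1 • v₁ x + deriv k x.1 • u x)
      (fun x => k x.1 • v₂ x) := by
  have hd : Differentiable ℝ k := hk.differentiable (by simp)
  have := h.smul (χ := fun x => k x.1) (hk.comp contDiff_fst) (C := C) (fun x => h0 _)
    (fun x => by rw [d1_comp_fst hd]; exact h1 _)
    (fun x => by rw [d2_comp_fst hd, abs_zero]; exact (abs_nonneg _).trans (h0 0))
  simpa only [d1_comp_fst hd, d2_comp_fst hd, zero_smul, add_zero] using this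

theorem smul_snd (h : MagH1 a u v₁ v₂) {k : ℝ → ℝ} (hk : ContDiff ℝ (⊤ : ℕ∞) k) {C : ℝ}
    (h0 : ∀ x, |k x| ≤ C) (h1 : ∀ x, |deriv k x| ≤ C) :
    MagH1 a (fun x => k x.2 • u x) (fun x => k x.2 • v₁ x)
      (fun x => k x.2 • v₂ x + deriv k x.2 • u x) := by
  have hd : Differentiable ℝ k := hk.differentiable (by simp)
  have := h.smul (χ := fun x => k x.2) (hk.comp contDiff_snd) (C := C) (fun x => h0 _)
    (fun x => by rw [d1_comp_snd hd, abs_zero]; exact (abs_nonneg _).trans (h0 0))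
    (fun x => by rw [d2_comp_snd hd]; exact h1 _)
  simpa only [d1_comp_snd hd, d2_comp_snd hd, zero_smul, add_zero] using this

/-- Translation in the direction `x₁`. -/
theorem translate (h : MagH1 a u v₁ v₂) (s : ℝ) :
    MagH1 a (fun x => u (x + (s, 0))) (fun x => v₁ (x + (s, 0))) (fun x => v₂ (x + (s, 0))) := by
  have hp := measurePreserving_add_right (volume : Measure (ℝ × ℝ)) (s, 0)
  have ht (φ : ℝ × ℝ → ℝ) (hφ : IsTest φ) : IsTest fun x => φ (x - (s, 0)) :=
    ⟨hφ.1.comp (contDiff_id.sub contDiff_const),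
      hφ.2.comp_homeomorph (Homeomorph.subRight ((s, 0) : ℝ × ℝ))⟩
  refine ⟨h.memLp.comp_measurePreserving hp, h.memLp₁.comp_measurePreserving hp,
    h.memLp₂.comp_measurePreserving hp, ?_, ?_⟩
  · intro φ hφ
    refine Eq.trans ?_ ((integral_add_right_eq_self _ ((s, 0) : ℝ × ℝ)).trans (h.weak₁ _ (ht φ hφ)))
    congr 1; ext x
    have hpot : pot a (x + (s, 0)) = pot a x := by simp [pot, step]
    simp [d1, fderiv_comp_sub, hpot]
  · intro φ hφ
    refine Eq.trans ?_ ((integral_add_right_eq_self _ ((s, 0) : ℝ × ℝ)).trans (h.weak₂ _ (ht φ hφ)))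
    congr 1; ext x
    simp [d2, fderiv_comp_sub]

end MagH1

end StepGL

end

noncomputable section

namespace StepGL

/-! ### The strip problem in terms of functions on the plane -/

variable {a b R : ℝ} {u v₁ v₂ : ℝ × ℝ → ℂ}

theorem measurableSet_strip (R : ℝ) : MeasurableSet (strip R) :=
  measurableSet_Ioo.prod MeasurableSet.univ

/-- Smooth cut-off functions of one variable, compactly supported in `(-R/2, R/2)`, which
increase to `1` there. -/
def innerCutoff (R : ℝ) (n : ℕ) (s : ℝ) : ℝ :=
  Real.smoothTransition (n * (s + R / 2) - 1) * Real.smoothTransition (n * (R / 2 - s) - 1)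

theorem contDiff_smoothTransition : ContDiff ℝ (⊤ : ℕ∞) Real.smoothTransition :=
  Real.smoothTransition.contDiff

theorem contDiff_innerCutoff (R : ℝ) (n : ℕ) : ContDiff ℝ (⊤ : ℕ∞) (innerCutoff R n) := by
  unfold innerCutoff
  exact (contDiff_smoothTransition.comp (by fun_prop)).mul
    (contDiff_smoothTransition.comp (by fun_prop))

theorem abs_innerCutoff_le (R : ℝ) (n : ℕ) (s : ℝ) : |innerCutoff R n s| ≤ 1 := by
  unfold innerCutoff
  rw [abs_of_nonneg (mul_nonneg (Real.smoothTransition.nonneg _) (Real.smoothTransition.nonneg _))]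
  exact mul_le_one₀ (Real.smoothTransition.le_one _) (Real.smoothTransition.nonneg _)
    (Real.smoothTransition.le_one _)

theorem tendsto_innerCutoff {s : ℝ} (hs : s ∈ Ioo (-R / 2) (R / 2)) :
    Tendsto (fun n : ℕ => innerCutoff R n s) atTop (𝓝 1) := by
  have key (c : ℝ) (hc : 0 < c) : ∀ᶠ n : ℕ in atTop, 2 ≤ n * c :=
    (tendsto_natCast_atTop_atTop.atTop_mul_const hc).eventually_ge_atTop 2
  refine tendsto_const_nhds.congr' ?_
  filter_upwards [key (s + R / 2) (by linarith [hs.1]), key (R / 2 - s) (by linarith [hs.2])]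
    with n h1 h2
  simp [innerCutoff, Real.smoothTransition.one_of_one_le (show 1 ≤ n * (s + R / 2) - 1 by linarith),
    Real.smoothTransition.one_of_one_le (show 1 ≤ n * (R / 2 - s) - 1 by linarith)]

theorem tsupport_innerCutoff_mul_subset (R : ℝ) (n : ℕ) (φ : ℝ × ℝ → ℝ) :
    tsupport (fun x => innerCutoff R n x.1 * φ x) ⊆ strip R := by
  have hcl : IsClosed ({x : ℝ × ℝ | 1 ≤ n * (x.1 + R / 2)} ∩ {x : ℝ × ℝ | 1 ≤ n * (R / 2 - x.1)}) :=
    (isClosed_le (by fun_prop) (by fun_prop)).inter (isClosed_le (by fun_prop) (by fun_prop))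
  refine (closure_minimal ?_ hcl).trans ?_
  · intro x hx
    by_contra hx'
    apply hx
    simp only [mem_inter_iff, mem_ofPred_eq, not_and_or, not_le] at hx'
    rcases hx' with h | h
    · simp [innerCutoff, Real.smoothTransition.zero_of_nonpos
        (show (n : ℝ) * (x.1 + R / 2) - 1 ≤ 0 by linarith)]
    · simp [innerCutoff, Real.smoothTransition.zero_of_nonpos
        (show (n : ℝ) * (R / 2 - x.1) - 1 ≤ 0 by linarith)]
  · rintro x ⟨h1, h2⟩
    rw [mem_ofPred_eq] at h1 h2
    have hn : (0 : ℝ) ≤ n := Nat.cast_nonneg n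
    refine ⟨⟨?_, ?_⟩, mem_univ _⟩
    · by_contra! h
      nlinarith
    · by_contra! h
      nlinarith

/-- Extension by zero maps `𝓓_R` into the magnetic Sobolev space of the plane. -/
theorem InDomain.magH1 (h : InDomain a R u v₁ v₂) :
    MagH1 a ((strip R).indicator u) ((strip R).indicator v₁) ((strip R).indicator v₂) := by
  have hS := measurableSet_strip R
  have hu := h.memLp.locallyIntegrable (by norm_num)
  have hv := h.memLp_grad₂.locallyIntegrable (by norm_num)
  refine ⟨(memLp_indicator_iff_restrict hS).2 h.memLp,
    (memLp_indicator_iff_restrict hS).2 h.memLp_grad₁,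
    (memLp_indicator_iff_restrict hS).2 h.memLp_grad₂, ?_, ?_⟩
  · intro φ hφ
    -- With zero traces, Green's formula against all test functions is the weak identity for the
    -- extension by zero.
    have := h.trace_zero.2.2 φ hφ
    simp only [Pi.zero_apply, smul_zero, integral_zero, sub_zero] at this
    rw [← this, ← integral_indicator hS]
    congr 1; ext x
    by_cases hx : x ∈ strip R <;> simp [hx]
  · intro φ hφ
    -- Only tests supported in the strip are allowed in `h.grad`. A cut-off depending on x₁ alone
    -- commutes with ∂₂, so it creates no boundary term and can be sent to 1 by dominated
    -- convergence.
    have key (n : ℕ) : ∫ x in strip R, innerCutoff R n x.1 • (d2 φ x • u x + φ x • v₂ x) = 0 := by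
      have hk := contDiff_innerCutoff R n
      have hkd : Differentiable ℝ (innerCutoff R n) := hk.differentiable (by simp)
      have ht : IsTest (fun x => innerCutoff R n x.1 * φ x) :=
        hφ.mul_left (g := fun x => innerCutoff R n x.1) (hk.comp contDiff_fst)
      have hw := (h.grad _ ht (tsupport_innerCutoff_mul_subset R n φ)).2
      rw [integral_neg, eq_neg_iff_add_eq_zero, ← integral_add
        (integrable_smul_of_compact hv ht.continuous ht.2)
        (integrable_smul_of_compact hu ht.continuous_d2 ht.hasCompactSupport_d2)] at hw
      rw [← hw]
      congr 1; ext x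
      rw [d2_mul (χ := fun x => innerCutoff R n x.1) hφ.differentiable
        (hkd.comp differentiable_fst), d2_comp_fst hkd]
      simp only [Complex.real_smul]; push_cast; ring
    have hint : Integrable (fun x => d2 φ x • u x + φ x • v₂ x) (volume.restrict (strip R)) :=
      (integrable_smul_of_compact hu hφ.continuous_d2 hφ.hasCompactSupport_d2).add
        (integrable_smul_of_compact hv hφ.continuous hφ.2)
    have hlim := tendsto_integral_of_dominated_convergence
      (F := fun (n : ℕ) x => innerCutoff R n x.1 • (d2 φ x • u x + φ x • v₂ x))
      (μ := volume.restrict (strip R)) (f := fun x => d2 φ x • u x + φ x • v₂ x)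
      (fun x => ‖d2 φ x • u x + φ x • v₂ x‖)
      (fun n => AEStronglyMeasurable.smul (((contDiff_innerCutoff R n).continuous.comp
        continuous_fst).aestronglyMeasurable) hint.1) hint.norm
      (fun n => .of_forall fun x => by
        rw [norm_smul, Real.norm_eq_abs]
        exact mul_le_of_le_one_left (norm_nonneg _) (abs_innerCutoff_le R n _))
      (by
        filter_upwards [ae_restrict_mem hS] with x hx
        simpa using (tendsto_innerCutoff hx.1).smul_const (d2 φ x • u x + φ x • v₂ x))
    simp only [key] at hlim
    rw [← tendsto_nhds_unique hlim tendsto_const_nhds, ← integral_indicator hS]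
    congr 1; ext x
    by_cases hx : x ∈ strip R <;> simp [hx]

theorem setIntegral_strip_eq {E : Type*} [NormedAddCommGroup E] [NormedSpace ℝ E]
    {f : ℝ × ℝ → E} (hf : ∀ x, x ∉ strip R → f x = 0) : ∫ x in strip R, f x = ∫ x, f x :=
  setIntegral_eq_integral_of_forall_compl_eq_zero hf

/-- A function in the magnetic Sobolev space of the plane that vanishes off the strip is in
`𝓓_R`. -/
theorem MagH1.inDomain (h : MagH1 a u v₁ v₂)
    (hs : ∀ x, x ∉ strip R → u x = 0 ∧ v₁ x = 0 ∧ v₂ x = 0) : InDomain a R u v₁ v₂ := by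
  refine ⟨h.memLp.restrict _, h.memLp₁.restrict _, h.memLp₂.restrict _, ?_, ?_, ?_, ?_⟩
  · intro φ hφ _
    constructor
    · rw [setIntegral_strip_eq fun x hx => by simp [hs x hx],
        setIntegral_strip_eq fun x hx => by simp [hs x hx], ← sub_eq_zero, ← integral_sub]
      · rw [← h.weak₁ φ hφ]
        congr 1; ext x; simp only [Complex.real_smul]; ring
      · exact integrable_smul_of_compact (h.memLp₁.locallyIntegrable (by norm_num))
          hφ.continuous hφ.2
      · exact (integrable_smul_of_compact h.locallyIntegrable hφ.continuous_d1
          hφ.hasCompactSupport_d1).neg.sub (integrable_smul_of_compact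
          (locallyIntegrable_pot_mul a h.locallyIntegrable) hφ.continuous hφ.2)
    · rw [setIntegral_strip_eq fun x hx => by simp [hs x hx],
        setIntegral_strip_eq fun x hx => by simp [hs x hx], ← sub_eq_zero, ← integral_sub]
      · rw [← h.weak₂ φ hφ]
        congr 1; ext x; simp only [Complex.real_smul]; ring
      · exact integrable_smul_of_compact h.locallyIntegrable₂ hφ.continuous hφ.2
      · exact (integrable_smul_of_compact h.locallyIntegrable hφ.continuous_d2
          hφ.hasCompactSupport_d2).neg
  · exact locallyIntegrable_zero
  · exact locallyIntegrable_zero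
  · intro φ hφ
    rw [setIntegral_strip_eq fun x hx => by simp [hs x hx], h.weak₁ φ hφ]
    simp

/-- The Ginzburg--Landau energy on the plane. -/
def glE (b : ℝ) (u v₁ v₂ : ℝ × ℝ → ℂ) : ℝ :=
  b * ((∫ x, ‖v₁ x‖ ^ 2) + ∫ x, ‖v₂ x‖ ^ 2) - (∫ x, ‖u x‖ ^ 2) + (1 / 2) * ∫ x, ‖u x‖ ^ 4

/-- Admissible configurations on the strip, extended by zero, with finite quartic energy. -/
structure Adm (a R : ℝ) (u v₁ v₂ : ℝ × ℝ → ℂ) : Prop where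
  mag : MagH1 a u v₁ v₂
  eq_zero : ∀ x, x ∉ strip R → u x = 0 ∧ v₁ x = 0 ∧ v₂ x = 0
  quartic : Integrable fun x => ‖u x‖ ^ 4

theorem Adm.zero (a R : ℝ) : Adm a R 0 0 0 :=
  ⟨MagH1.zero a, fun _ _ => by simp, by simp⟩

theorem integrable_sq {f : ℝ × ℝ → ℂ} (h : MemLp f 2 volume) : Integrable fun x => ‖f x‖ ^ 2 :=
  (memLp_two_iff_integrable_sq_norm h.1).1 h

theorem MagH1.integrable_quadratic (h : MagH1 a u v₁ v₂) (b : ℝ) :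
    Integrable fun x => b * (‖v₁ x‖ ^ 2 + ‖v₂ x‖ ^ 2) - ‖u x‖ ^ 2 :=
  (((integrable_sq h.memLp₁).add (integrable_sq h.memLp₂)).const_mul b).sub (integrable_sq h.memLp)

theorem MagH1.integral_energy (h : MagH1 a u v₁ v₂) (hq : Integrable fun x => ‖u x‖ ^ 4) :
    ∫ x, (b * (‖v₁ x‖ ^ 2 + ‖v₂ x‖ ^ 2) - ‖u x‖ ^ 2 + (1 / 2) * ‖u x‖ ^ 4) = glE b u v₁ v₂ := by
  have h12 : Integrable fun x => b * (‖v₁ x‖ ^ 2 + ‖v₂ x‖ ^ 2) :=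
    ((integrable_sq h.memLp₁).add (integrable_sq h.memLp₂)).const_mul b
  rw [integral_add (h.integrable_quadratic b) (hq.const_mul _), integral_sub h12
    (integrable_sq h.memLp),
    integral_const_mul, integral_const_mul, integral_add (integrable_sq h.memLp₁)
    (integrable_sq h.memLp₂)]
  rfl

/-- This replaces the strip, with its traces and restricted measures, by functions on the plane;
everything afterwards is done with `Adm` and `glE`. -/
theorem mem_energyValues_iff {E : ℝ} :
    E ∈ energyValues a b R ↔ ∃ u v₁ v₂ : ℝ × ℝ → ℂ, Adm a R u v₁ v₂ ∧ E = glE b u v₁ v₂ := by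
  constructor
  · rintro ⟨u, v₁, v₂, h, rfl⟩
    have hm := h.magH1
    have he : energy b R u v₁ v₂ = ∫ x, (b * (‖(strip R).indicator v₁ x‖ ^ 2 +
        ‖(strip R).indicator v₂ x‖ ^ 2) - ‖(strip R).indicator u x‖ ^ 2 +
        (1 / 2) * ‖(strip R).indicator u x‖ ^ 4) := by
      rw [energy, ← integral_indicator (measurableSet_strip R)]
      congr 1; ext x
      by_cases hx : x ∈ strip R <;> simp [hx]
    by_cases hq : Integrable fun x => ‖(strip R).indicator u x‖ ^ 4
    · refine ⟨_, _, _, ⟨hm, fun x hx => by simp [hx], hq⟩, ?_⟩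
      rw [he, hm.integral_energy hq]
    -- The quadratic part is integrable, so without an integrable quartic term the whole integrand
    -- is not integrable, its integral is 0 by convention, and the zero configuration has the same
    -- energy.
    · refine ⟨0, 0, 0, Adm.zero a R, ?_⟩
      rw [he, integral_undef]
      · simp [glE]
      · intro hi
        apply hq
        have := (hi.sub (hm.integrable_quadratic b)).const_mul 2
        refine this.congr (.of_forall fun x => ?_)
        simp only [Pi.sub_apply]; ring
  · rintro ⟨u, v₁, v₂, h, rfl⟩
    refine ⟨u, v₁, v₂, h.mag.inDomain h.eq_zero, ?_⟩
    rw [energy, setIntegral_strip_eq fun x hx => by simp [h.eq_zero x hx],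
      h.mag.integral_energy h.quartic]

theorem zero_mem_energyValues (a b R : ℝ) : (0 : ℝ) ∈ energyValues a b R :=
  mem_energyValues_iff.2 ⟨0, 0, 0, Adm.zero a R, by simp [glE]⟩

end StepGL

end

noncomputable section

namespace StepGL

/-! ### Mollification in `L²` -/

theorem eLpNorm_two_sq (f : ℝ × ℝ → ℂ) :
    eLpNorm f 2 volume ^ 2 = ∫⁻ x, ‖f x‖ₑ ^ 2 := by
  rw [eLpNorm_eq_lintegral_rpow_enorm_toReal (by norm_num) (by norm_num)]
  rw [← ENNReal.rpow_natCast, ← ENNReal.rpow_mul]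
  simp

/-- Translation is continuous in `L²`. -/
theorem exists_lintegral_translate_le {f : ℝ × ℝ → ℂ} (hf : MemLp f 2 volume) {ε : ENNReal}
    (hε : ε ≠ 0) :
    ∃ δ > 0, ∀ y : ℝ × ℝ, ‖y‖ < δ → ∫⁻ x, ‖f (x - y) - f x‖ₑ ^ 2 ≤ ε := by
  let G : C(ℝ × ℝ, C(ℝ × ℝ, ℝ × ℝ)) :=
    ContinuousMap.curry ⟨fun p : (ℝ × ℝ) × (ℝ × ℝ) => p.2 - p.1, by fun_prop⟩
  have hG (y : ℝ × ℝ) : MeasurePreserving (G y) volume volume :=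
    measurePreserving_sub_right volume y
  have hlim : Tendsto (fun y => Lp.compMeasurePreserving (G y) (hG y) (hf.toLp f)) (𝓝 0)
      (𝓝 (Lp.compMeasurePreserving (G 0) (hG 0) (hf.toLp f))) :=
    Tendsto.compMeasurePreservingLp tendsto_const_nhds (G.continuous.tendsto 0) hG (hG 0)
      (by norm_num)
  rw [Metric.tendsto_nhds_nhds] at hlim
  obtain ⟨r, hr, hrε⟩ : ∃ r : ℝ, 0 < r ∧ ENNReal.ofReal r ^ 2 ≤ ε := by
    rcases eq_or_ne ε ⊤ with rfl | ht
    · exact ⟨1, one_pos, le_top⟩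
    · have hp : 0 < ε.toReal := ENNReal.toReal_pos hε ht
      refine ⟨√ε.toReal, by positivity, ?_⟩
      rw [← ENNReal.ofReal_pow (by positivity), Real.sq_sqrt hp.le, ENNReal.ofReal_toReal ht]
  obtain ⟨δ, hδ, h⟩ := hlim r hr
  refine ⟨δ, hδ, fun y hy => ?_⟩
  have h1 := h (x := y) (by simpa [dist_eq_norm] using hy)
  rw [Lp.toLp_compMeasurePreserving, Lp.toLp_compMeasurePreserving, dist_eq_norm, ← MemLp.toLp_sub,
    Lp.norm_toLp] at h1
  refine le_trans ?_ hrε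
  rw [← eLpNorm_two_sq]
  have h2 : (fun x => f (x - y) - f x) = f ∘ (G y) - f ∘ (G 0) := by
    ext x; simp [G]
  rw [h2]
  gcongr
  rw [← ENNReal.ofReal_toReal (MemLp.eLpNorm_ne_top
    ((hf.comp_measurePreserving (hG y)).sub (hf.comp_measurePreserving (hG 0))))]
  exact ENNReal.ofReal_le_ofReal h1.le

/-- Jensen's inequality for the probability density r, by Cauchy–Schwarz applied to r^(1/2) and
r^(1/2) g. -/
theorem sq_lintegral_mul_le {α : Type*} [MeasurableSpace α] {μ : Measure α} {r g : α → ENNReal}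
    (hr : AEMeasurable r μ) (hg : AEMeasurable g μ) (h1 : ∫⁻ x, r x ∂μ = 1) :
    (∫⁻ x, r x * g x ∂μ) ^ 2 ≤ ∫⁻ x, r x * g x ^ 2 ∂μ := by
  have h := ENNReal.lintegral_mul_le_Lp_mul_Lq μ Real.HolderConjugate.two_two
    (hr.pow_const (1 / 2 : ℝ)) ((hr.pow_const (1 / 2 : ℝ)).mul hg)
  have e1 (x : α) : (r x ^ (1 / 2 : ℝ)) ^ (2 : ℝ) = r x := by
    rw [← ENNReal.rpow_mul]; norm_num
  have e2 (x : α) : r x ^ (1 / 2 : ℝ) * r x ^ (1 / 2 : ℝ) = r x := by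
    rw [← e1 x, ← ENNReal.rpow_mul, ENNReal.rpow_two, sq]; norm_num
  simp only [Pi.mul_apply, ENNReal.mul_rpow_of_nonneg _ _ (zero_le_two (α := ℝ)), e1, h1,
    ENNReal.one_rpow, one_mul, ← mul_assoc, e2] at h
  calc (∫⁻ x, r x * g x ∂μ) ^ 2 ≤ ((∫⁻ x, r x * g x ^ (2 : ℝ) ∂μ) ^ (1 / 2 : ℝ)) ^ 2 := by gcongr
    _ = ∫⁻ x, r x * g x ^ 2 ∂μ := by
      rw [← ENNReal.rpow_natCast, ← ENNReal.rpow_mul]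
      norm_num

/-- Convolution with a real mollifier. -/
def mollify (ρ : ℝ × ℝ → ℝ) (f : ℝ × ℝ → ℂ) : ℝ × ℝ → ℂ :=
  convolution ρ f (ContinuousLinearMap.lsmul ℝ ℝ) volume

theorem mollify_apply (ρ : ℝ × ℝ → ℝ) (f : ℝ × ℝ → ℂ) (x : ℝ × ℝ) :
    mollify ρ f x = ∫ y, ρ y • f (x - y) := rfl

/-- Since ρ has mass 1, ρ * f - f is the ρ-average of the differences between f and its translates;
Jensen and Tonelli reduce the bound to the one for each translation. -/
theorem lintegral_mollify_sub_le {ρ : ℝ × ℝ → ℝ} {f : ℝ × ℝ → ℂ} (hf : MemLp f 2 volume)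
    (hρ : Continuous ρ) (hc : HasCompactSupport ρ) (h0 : ∀ x, 0 ≤ ρ x) (h1 : ∫ x, ρ x = 1)
    {δ : ℝ} (hs : ∀ x, δ ≤ ‖x‖ → ρ x = 0) {ε : ENNReal}
    (h : ∀ y : ℝ × ℝ, ‖y‖ < δ → ∫⁻ x, ‖f (x - y) - f x‖ₑ ^ 2 ≤ ε) :
    ∫⁻ x, ‖mollify ρ f x - f x‖ₑ ^ 2 ≤ ε := by
  have hli := hf.locallyIntegrable (by norm_num)
  have hint : Integrable ρ := hρ.integrable_of_hasCompactSupport hc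
  have hr1 : ∫⁻ y, ‖ρ y‖ₑ = 1 := by
    rw [← ofReal_integral_norm_eq_lintegral_enorm hint]
    simp [abs_of_nonneg (h0 _), h1]
  have hrm : Measurable fun y => ‖ρ y‖ₑ := hρ.enorm.measurable
  have hmeas : AEStronglyMeasurable (fun p : (ℝ × ℝ) × (ℝ × ℝ) => f (p.1 - p.2) - f p.1)
      (volume.prod volume) :=
    (hf.1.comp_quasiMeasurePreserving (quasiMeasurePreserving_sub volume volume)).sub
      (hf.1.comp_quasiMeasurePreserving Measure.quasiMeasurePreserving_fst)
  have hpt (x : ℝ × ℝ) : ‖mollify ρ f x - f x‖ₑ ^ 2 ≤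
      ∫⁻ y, ‖ρ y‖ₑ * ‖f (x - y) - f x‖ₑ ^ 2 := by
    have hm : AEMeasurable (fun y => ‖f (x - y) - f x‖ₑ) volume :=
      ((hf.1.comp_quasiMeasurePreserving (quasiMeasurePreserving_sub_left volume x)).sub
        aestronglyMeasurable_const).enorm
    refine le_trans ?_ (sq_lintegral_mul_le hrm.aemeasurable hm hr1)
    gcongr
    have he : mollify ρ f x - f x = ∫ y, ρ y • (f (x - y) - f x) := by
      simp only [smul_sub]
      have hi : Integrable fun y => ρ y • f (x - y) :=
        hc.convolutionExists_left (ContinuousLinearMap.lsmul ℝ ℝ) hρ hli x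
      rw [integral_sub hi (hint.smul_const _), integral_smul_const, h1, one_smul, mollify_apply]
    rw [he]
    refine (enorm_integral_le_lintegral_enorm _).trans (le_of_eq ?_)
    simp only [enorm_smul]
  calc ∫⁻ x, ‖mollify ρ f x - f x‖ₑ ^ 2
      ≤ ∫⁻ x, ∫⁻ y, ‖ρ y‖ₑ * ‖f (x - y) - f x‖ₑ ^ 2 := lintegral_mono hpt
    _ = ∫⁻ y, ∫⁻ x, ‖ρ y‖ₑ * ‖f (x - y) - f x‖ₑ ^ 2 := by
        refine lintegral_lintegral_swap ?_
        exact ((hrm.comp measurable_snd).aemeasurable).mul (hmeas.enorm.pow_const 2)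
    _ ≤ ∫⁻ y, ‖ρ y‖ₑ * ε := by
        refine lintegral_mono fun y => ?_
        by_cases hy : ‖y‖ < δ
        · rw [lintegral_const_mul' _ _ (by simp)]
          gcongr
          exact h y hy
        · simp [hs y (not_lt.1 hy)]
    _ = ε := by rw [lintegral_mul_const _ hrm, hr1, one_mul]

theorem integral_sq_le_of_lintegral {f : ℝ × ℝ → ℂ} (hf : AEStronglyMeasurable f volume) {ε : ℝ}
    (hε : 0 ≤ ε) (h : ∫⁻ x, ‖f x‖ₑ ^ 2 ≤ ENNReal.ofReal ε) :
    MemLp f 2 volume ∧ ∫ x, ‖f x‖ ^ 2 ≤ ε := by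
  have h2 : MemLp f 2 volume := by
    refine ⟨hf, ?_⟩
    have : eLpNorm f 2 volume ^ 2 < ⊤ := by
      rw [eLpNorm_two_sq]; exact h.trans_lt ENNReal.ofReal_lt_top
    by_contra hcon
    rw [not_lt, top_le_iff] at hcon
    simp [hcon] at this
  refine ⟨h2, ?_⟩
  have e := ofReal_integral_eq_lintegral_ofReal (integrable_sq h2)
    (.of_forall fun x => by positivity)
  have : ENNReal.ofReal (∫ x, ‖f x‖ ^ 2) ≤ ENNReal.ofReal ε := by
    rw [e]
    refine le_trans (le_of_eq ?_) h
    congr 1; ext x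
    rw [ENNReal.ofReal_pow (norm_nonneg _), ofReal_norm]
  exact (ENNReal.ofReal_le_ofReal_iff hε).1 this

/-- Mollification approximates in `L²`, uniformly over mollifiers with small support. -/
theorem exists_mollify_approx {f : ℝ × ℝ → ℂ} (hf : MemLp f 2 volume) {ε : ℝ} (hε : 0 < ε) :
    ∃ δ > 0, ∀ ρ : ℝ × ℝ → ℝ, Continuous ρ → HasCompactSupport ρ → (∀ x, 0 ≤ ρ x) →
      ∫ x, ρ x = 1 → (∀ x, δ ≤ ‖x‖ → ρ x = 0) →
      MemLp (fun x => mollify ρ f x - f x) 2 volume ∧ ∫ x, ‖mollify ρ f x - f x‖ ^ 2 ≤ ε := by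
  obtain ⟨δ, hδ, h⟩ := exists_lintegral_translate_le hf
    (ε := ENNReal.ofReal ε) (by simpa using hε)
  refine ⟨δ, hδ, fun ρ hρ hc h0 h1 hs => integral_sq_le_of_lintegral ?_ hε.le
    (lintegral_mollify_sub_le hf hρ hc h0 h1 hs h)⟩
  exact (hc.continuous_convolution_left _ hρ
    (hf.locallyIntegrable (by norm_num))).aestronglyMeasurable.sub hf.1

end StepGL

end

noncomputable section

namespace StepGL

variable {a : ℝ} {u v₁ v₂ : ℝ × ℝ → ℂ}

/-! ### Density of test functions -/

/-- Complex-valued smooth compactly supported functions on the plane. -/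
def IsCTest (ϕ : ℝ × ℝ → ℂ) : Prop :=
  ContDiff ℝ (⊤ : ℕ∞) ϕ ∧ HasCompactSupport ϕ

/-- The magnetic derivative of a smooth function in the direction `x₁`. -/
def mag1 (a : ℝ) (ϕ : ℝ × ℝ → ℂ) (x : ℝ × ℝ) : ℂ :=
  fderiv ℝ ϕ x (1, 0) - Complex.I * (pot a x : ℂ) * ϕ x

/-- The magnetic derivative of a smooth function in the direction `x₂`. -/
def mag2 (ϕ : ℝ × ℝ → ℂ) (x : ℝ × ℝ) : ℂ := fderiv ℝ ϕ x (0, 1)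

namespace IsCTest

variable {ϕ : ℝ × ℝ → ℂ}

theorem continuous (h : IsCTest ϕ) : Continuous ϕ := h.1.continuous

theorem differentiable (h : IsCTest ϕ) : Differentiable ℝ ϕ := h.1.differentiable (by simp)

theorem continuous_fderiv (h : IsCTest ϕ) (e : ℝ × ℝ) : Continuous fun x => fderiv ℝ ϕ x e :=
  (h.1.continuous_fderiv (by simp)).clm_apply continuous_const

theorem continuous_mag1 (h : IsCTest ϕ) (a : ℝ) : Continuous (mag1 a ϕ) := by
  have h1 := h.continuous_fderiv (1, 0)
  have h2 := h.continuous
  have h3 := continuous_pot a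
  unfold mag1
  fun_prop

theorem hasCompactSupport_mag1 (h : IsCTest ϕ) (a : ℝ) : HasCompactSupport (mag1 a ϕ) :=
  (h.2.fderiv_apply ℝ (1, 0)).sub (HasCompactSupport.mul_left h.2)

theorem memLp_of_continuous {f : ℝ × ℝ → ℂ} (h : Continuous f) (hc : HasCompactSupport f) :
    MemLp f 2 volume := h.memLp_of_hasCompactSupport hc

theorem integral_smul_fderiv (h : IsCTest ϕ) {φ : ℝ × ℝ → ℝ} (hφ : IsTest φ) (e : ℝ × ℝ) :
    ∫ x, (fderiv ℝ φ x e • ϕ x + φ x • fderiv ℝ ϕ x e) = 0 := by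
  have i1 : Integrable fun x => fderiv ℝ φ x e • ϕ x :=
    ((hφ.continuous_fderiv e).smul h.continuous).integrable_of_hasCompactSupport h.2.smul_left
  have i2 : Integrable fun x => φ x • fderiv ℝ ϕ x e :=
    (hφ.continuous.smul (h.continuous_fderiv e)).integrable_of_hasCompactSupport hφ.2.smul_right
  have i3 : Integrable fun x => φ x • ϕ x :=
    (hφ.continuous.smul h.continuous).integrable_of_hasCompactSupport hφ.2.smul_right
  rw [integral_add i1 i2, integral_smul_fderiv_eq_neg_fderiv_smul_of_integrable i1 i2 i3
    (fun x _ => hφ.differentiable x) (fun x _ => h.differentiable x), add_neg_cancel]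

theorem magH1 (h : IsCTest ϕ) (a : ℝ) : MagH1 a ϕ (mag1 a ϕ) (mag2 ϕ) where
  memLp := memLp_of_continuous h.continuous h.2
  memLp₁ := memLp_of_continuous (h.continuous_mag1 a) (h.hasCompactSupport_mag1 a)
  memLp₂ := memLp_of_continuous (h.continuous_fderiv _) (h.2.fderiv_apply ℝ _)
  weak₁ φ hφ := by
    rw [← h.integral_smul_fderiv hφ (1, 0)]
    simp [mag1, d1]
  weak₂ φ hφ := h.integral_smul_fderiv hφ (0, 1)

end IsCTest

/-- The derivative falls on ρ, and y ↦ ρ(x - y) is a test function, so the weak identity moves it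
onto f. The derivatives are the ordinary ones: mollification does not commute with multiplication by
the potential. -/
theorem fderiv_mollify {ρ : ℝ × ℝ → ℝ} (hρ : IsTest ρ) {f : ℝ × ℝ → ℂ}
    (hf : LocallyIntegrable f volume) {e : ℝ × ℝ} {w : ℝ × ℝ → ℂ}
    (hw : ∀ φ, IsTest φ → ∫ x, (fderiv ℝ φ x e • f x + φ x • w x) = 0)
    (hwi : LocallyIntegrable w volume) (x : ℝ × ℝ) :
    fderiv ℝ (mollify ρ f) x e = mollify ρ w x := by
  have h1 := (hρ.2.hasFDerivAt_convolution_left (ContinuousLinearMap.lsmul ℝ ℝ)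
    (hρ.1.of_le (by simp)) hf x).fderiv
  have hφ : IsTest fun y => ρ (x - y) :=
    ⟨hρ.1.comp (contDiff_const.sub contDiff_id), hρ.2.comp_homeomorph (Homeomorph.subLeft x)⟩
  have hd (y : ℝ × ℝ) : fderiv ℝ (fun y => ρ (x - y)) y e = -(fderiv ℝ ρ (x - y) e) := by
    have : HasFDerivAt (fun y => ρ (x - y)) ((fderiv ℝ ρ (x - y)).comp
        (-ContinuousLinearMap.id ℝ (ℝ × ℝ))) y :=
      (hρ.differentiable (x - y)).hasFDerivAt.comp y ((hasFDerivAt_id y).const_sub x)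
    rw [this.fderiv]; simp
  have h2 := hw _ hφ
  simp only [hd] at h2
  have i1 : Integrable fun y => (fderiv ℝ ρ (x - y) e) • f y := by
    refine integrable_smul_of_compact hf ?_ ?_
    · exact (hρ.continuous_fderiv e).comp (continuous_const.sub continuous_id)
    · exact (hρ.2.fderiv_apply ℝ e).comp_homeomorph (Homeomorph.subLeft x)
  have i2 : Integrable fun y => ρ (x - y) • w y :=
    integrable_smul_of_compact hwi hφ.continuous hφ.2
  simp only [neg_smul] at h2
  have i1' : Integrable fun y => -((fderiv ℝ ρ (x - y) e) • f y) := i1.neg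
  rw [integral_add i1' i2, integral_neg, neg_add_eq_zero] at h2
  have h3 : mollify ρ w x = ∫ y, ρ (x - y) • w y := by
    rw [mollify_apply, ← integral_sub_left_eq_self _ volume x]
    simp
  have hcd : ConvolutionExistsAt (fderiv ℝ ρ) f x
      ((ContinuousLinearMap.lsmul ℝ ℝ).precompL (ℝ × ℝ)) volume :=
    (hρ.2.fderiv ℝ).convolutionExists_left _ (hρ.1.continuous_fderiv (by simp)) hf x
  rw [show mollify ρ f = convolution ρ f (ContinuousLinearMap.lsmul ℝ ℝ) volume from rfl, h1, h3,
    ← h2, convolution_def, ContinuousLinearMap.integral_apply hcd,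
    ← integral_sub_left_eq_self _ volume x]
  simp [ContinuousLinearMap.precompL_apply]

theorem integral_sq_add_le {f g : ℝ × ℝ → ℂ} (hf : MemLp f 2 volume) (hg : MemLp g 2 volume) :
    ∫ x, ‖f x + g x‖ ^ 2 ≤ 2 * (∫ x, ‖f x‖ ^ 2) + 2 * ∫ x, ‖g x‖ ^ 2 := by
  rw [← integral_const_mul, ← integral_const_mul,
    ← integral_add ((integrable_sq hf).const_mul 2) ((integrable_sq hg).const_mul 2)]
  refine integral_mono (integrable_sq (hf.add hg))
    (((integrable_sq hf).const_mul 2).add ((integrable_sq hg).const_mul 2)) fun x => ?_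
  have := norm_add_le (f x) (g x)
  have := norm_nonneg (f x + g x)
  simp only
  nlinarith [sq_nonneg (‖f x‖ - ‖g x‖)]

theorem abs_pot_le (a : ℝ) (x : ℝ × ℝ) : |pot a x| ≤ (1 + |a|) * ‖x‖ := by
  have h : |x.2| ≤ ‖x‖ := norm_snd_le x
  unfold pot step
  rw [abs_mul, abs_neg]
  gcongr
  split_ifs
  · simp
  · simp

/-- Approximation of compactly supported magnetic Sobolev functions. -/
theorem MagH1.exists_test_of_compact (h : MagH1 a u v₁ v₂) {r : ℝ} (hr : 0 ≤ r)
    (hs : ∀ x, r < ‖x‖ → u x = 0) {ε : ℝ} (hε : 0 < ε) :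
    ∃ ϕ, IsCTest ϕ ∧ ∫ x, ‖ϕ x - u x‖ ^ 2 ≤ ε ∧ ∫ x, ‖mag1 a ϕ x - v₁ x‖ ^ 2 ≤ ε ∧
      ∫ x, ‖mag2 ϕ x - v₂ x‖ ^ 2 ≤ ε := by
  set K : ℝ := (1 + |a|) * (r + 1) with hK
  have hK0 : 0 ≤ K := by positivity
  set w : ℝ × ℝ → ℂ := fun x => v₁ x + Complex.I * (pot a x : ℂ) * u x with hw
  have hpu : ∀ f : ℝ × ℝ → ℂ, MemLp f 2 volume → (∀ x, r + 1 < ‖x‖ → f x = 0) →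
      MemLp (fun x => Complex.I * (pot a x : ℂ) * f x) 2 volume ∧
      ∫ x, ‖Complex.I * (pot a x : ℂ) * f x‖ ^ 2 ≤ K ^ 2 * ∫ x, ‖f x‖ ^ 2 := by
    intro f hf hfs
    have hb (x : ℝ × ℝ) : ‖Complex.I * (pot a x : ℂ) * f x‖ ≤ K * ‖f x‖ := by
      by_cases hx : r + 1 < ‖x‖
      · simp [hfs x hx]
      · rw [norm_mul, norm_mul, Complex.norm_I, one_mul, Complex.norm_real, Real.norm_eq_abs]
        gcongr
        exact (abs_pot_le a x).trans (by rw [hK]; gcongr; exact not_lt.1 hx)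
    have hm : MemLp (fun x => Complex.I * (pot a x : ℂ) * f x) 2 volume := by
      refine MemLp.of_le_mul (c := K) hf ?_ (.of_forall hb)
      have := continuous_pot a
      exact (Continuous.aestronglyMeasurable (by fun_prop)).mul hf.1
    refine ⟨hm, ?_⟩
    rw [← integral_const_mul]
    refine integral_mono (integrable_sq hm) ((integrable_sq hf).const_mul _) fun x => ?_
    simp only
    rw [← mul_pow]
    have := hb x
    gcongr
  have hwm : MemLp w 2 volume :=
    h.memLp₁.add (hpu u h.memLp fun x hx => hs x (by linarith)).1
  -- Chosen so that 2η + 2K²η = ε, the form in which the error in the direction x₁ appears below.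
  set η : ℝ := ε / (2 + 2 * K ^ 2) with hη
  have hη0 : 0 < η := by positivity
  have hηε : η ≤ ε := div_le_self hε.le (by nlinarith)
  obtain ⟨δ₀, hδ₀, m₀⟩ := exists_mollify_approx h.memLp hη0
  obtain ⟨δ₁, hδ₁, m₁⟩ := exists_mollify_approx hwm hη0
  obtain ⟨δ₂, hδ₂, m₂⟩ := exists_mollify_approx h.memLp₂ hη0
  set δ := min (min δ₀ δ₁) (min δ₂ 1) with hδ
  have hδ0 : 0 < δ := by positivity
  let B : ContDiffBump (0 : ℝ × ℝ) := ⟨δ / 2, δ, by positivity, by linarith⟩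
  set ρ := B.normed volume with hρ
  have hρt : IsTest ρ := ⟨B.contDiff_normed, B.hasCompactSupport_normed⟩
  have hρs (x : ℝ × ℝ) (hx : δ ≤ ‖x‖) : ρ x = 0 := by
    rw [← Function.notMem_support, hρ, B.support_normed_eq]
    simpa using hx
  obtain ⟨a₀, b₀⟩ := m₀ ρ hρt.continuous hρt.2 B.nonneg_normed B.integral_normed
    fun x hx => hρs x (le_trans (by simp [hδ]) hx)
  obtain ⟨a₁, b₁⟩ := m₁ ρ hρt.continuous hρt.2 B.nonneg_normed B.integral_normed
    fun x hx => hρs x (le_trans (by simp [hδ]) hx)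
  obtain ⟨a₂, b₂⟩ := m₂ ρ hρt.continuous hρt.2 B.nonneg_normed B.integral_normed
    fun x hx => hρs x (le_trans (by simp [hδ]) hx)
  have hus : HasCompactSupport u := HasCompactSupport.intro (isCompact_closedBall (0 : ℝ × ℝ) r)
    fun x hx => hs x (by simpa using hx)
  have hwl := hwm.locallyIntegrable (by norm_num)
  have hd1 (x : ℝ × ℝ) : fderiv ℝ (mollify ρ u) x (1, 0) = mollify ρ w x :=
    fderiv_mollify hρt h.locallyIntegrable h.weak₁ hwl x
  have hd2 (x : ℝ × ℝ) : fderiv ℝ (mollify ρ u) x (0, 1) = mollify ρ v₂ x :=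
    fderiv_mollify hρt h.locallyIntegrable h.weak₂ h.locallyIntegrable₂ x
  have hzero (x : ℝ × ℝ) (hx : r + 1 < ‖x‖) : mollify ρ u x - u x = 0 := by
    rw [hs x (by linarith), sub_zero, mollify_apply]
    refine integral_eq_zero_of_ae (.of_forall fun y => ?_)
    by_cases hy : δ ≤ ‖y‖
    · simp [hρs y hy]
    · have : ‖x‖ - ‖y‖ ≤ ‖x - y‖ := norm_sub_norm_le x y
      have : δ ≤ 1 := by simp [hδ]
      rw [not_le] at hy
      simp [hs (x - y) (by linarith)]
  obtain ⟨p1, p2⟩ := hpu _ a₀ hzero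
  refine ⟨mollify ρ u, ⟨hρt.2.contDiff_convolution_left _ hρt.1 h.locallyIntegrable,
    HasCompactSupport.convolution _ hρt.2 hus⟩, b₀.trans hηε, ?_, ?_⟩
  -- The error is that of mollifying w = ∂₁u plus the potential times that of mollifying u. The
  -- latter lives in the ball of radius r + 1, where the potential is at most K.
  · have e (x : ℝ × ℝ) : mag1 a (mollify ρ u) x - v₁ x =
        (mollify ρ w x - w x) + -(Complex.I * (pot a x : ℂ) * (mollify ρ u x - u x)) := by
      rw [mag1, hd1, hw]; ring
    simp only [e]
    refine (integral_sq_add_le a₁ p1.neg).trans ?_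
    simp only [Pi.neg_apply, norm_neg]
    have : 2 * η + 2 * (K ^ 2 * η) = ε := by rw [hη]; field_simp
    nlinarith
  · simp only [mag2, hd2]
    exact b₂.trans hηε

/-- A smooth function equal to `1` on `[-1, 1]` and to `0` off `[-2, 2]`. -/
def plateau (t : ℝ) : ℝ := Real.smoothTransition (2 - t ^ 2)

theorem contDiff_plateau : ContDiff ℝ (⊤ : ℕ∞) plateau :=
  contDiff_smoothTransition.comp (by fun_prop)

theorem plateau_eq_one {t : ℝ} (h : |t| ≤ 1) : plateau t = 1 :=
  Real.smoothTransition.one_of_one_le (by nlinarith [sq_abs t, abs_nonneg t])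

theorem plateau_eq_zero {t : ℝ} (h : 2 ≤ |t|) : plateau t = 0 :=
  Real.smoothTransition.zero_of_nonpos (by nlinarith [sq_abs t, abs_nonneg t])

theorem abs_plateau_le (t : ℝ) : |plateau t| ≤ 1 := by
  rw [plateau, abs_of_nonneg (Real.smoothTransition.nonneg _)]
  exact Real.smoothTransition.le_one _

theorem hasCompactSupport_plateau : HasCompactSupport plateau :=
  HasCompactSupport.intro (isCompact_Icc (a := (-2 : ℝ)) (b := 2)) fun x hx => by
    apply plateau_eq_zero
    by_contra! h
    exact hx ⟨by linarith [(abs_lt.1 h).1], by linarith [(abs_lt.1 h).2]⟩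

theorem exists_deriv_le {k : ℝ → ℝ} (hk : ContDiff ℝ (⊤ : ℕ∞) k) (hc : HasCompactSupport (deriv k)) :
    ∃ C : ℝ, 1 ≤ C ∧ ∀ t, |deriv k t| ≤ C := by
  obtain ⟨C, hC⟩ := (hk.continuous_deriv (by simp)).bounded_above_of_compact_support hc
  exact ⟨max C 1, le_max_right _ _, fun t => (hC t).trans (le_max_left _ _)⟩

theorem deriv_comp_div {k : ℝ → ℝ} (hk : Differentiable ℝ k) (L t : ℝ) :
    deriv (fun s => k (s / L)) t = deriv k (t / L) / L := by
  have h := (hk (t / L)).hasDerivAt.comp t ((hasDerivAt_id t).div_const L)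
  rw [show (fun s => k (s / L)) = k ∘ (fun s => id s / L) from rfl, h.deriv]
  ring

theorem eventually_plateau (t : ℝ) :
    ∀ᶠ n : ℕ in atTop, plateau (t / (n + 1)) = 1 ∧ deriv plateau (t / (n + 1)) = 0 := by
  filter_upwards [(tendsto_natCast_atTop_atTop (R := ℝ)).eventually_gt_atTop |t|] with n hn
  have hp : (0 : ℝ) < n + 1 := by positivity
  have h1 : |t / (n + 1)| < 1 := by
    rw [abs_div, abs_of_pos hp, div_lt_one hp]; linarith
  refine ⟨plateau_eq_one h1.le, ?_⟩
  have : plateau =ᶠ[𝓝 (t / (n + 1))] fun _ => 1 := by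
    filter_upwards [(continuous_abs.tendsto _).eventually_lt_const h1] with s hs
    exact plateau_eq_one hs.le
  rw [this.deriv_eq, deriv_const]

theorem tendsto_integral_sq_of_dominated {F : ℕ → ℝ × ℝ → ℂ} {g : ℝ × ℝ → ℝ}
    (hF : ∀ n, AEStronglyMeasurable (F n) volume) (hg : Integrable fun x => g x ^ 2)
    (hb : ∀ n x, ‖F n x‖ ≤ g x) (hlim : ∀ x, ∀ᶠ n in atTop, F n x = 0) :
    Tendsto (fun n => ∫ x, ‖F n x‖ ^ 2) atTop (𝓝 0) := by
  have := tendsto_integral_of_dominated_convergence (μ := (volume : Measure (ℝ × ℝ)))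
    (F := fun n x => ‖F n x‖ ^ 2) (f := fun _ => 0) (fun x => g x ^ 2)
    (fun n => (hF n).norm.pow 2) hg
    (fun n => .of_forall fun x => by
      rw [Real.norm_eq_abs, abs_of_nonneg (by positivity)]
      have := hb n x
      gcongr)
    (.of_forall fun x => tendsto_const_nhds.congr' (by
      filter_upwards [hlim x] with n hn
      simp [hn]))
  simpa using this

/-- Smooth compactly supported functions are dense in the magnetic Sobolev space. -/
theorem MagH1.exists_test (h : MagH1 a u v₁ v₂) {ε : ℝ} (hε : 0 < ε) :
    ∃ ϕ, IsCTest ϕ ∧ ∫ x, ‖ϕ x - u x‖ ^ 2 ≤ ε ∧ ∫ x, ‖mag1 a ϕ x - v₁ x‖ ^ 2 ≤ ε ∧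
      ∫ x, ‖mag2 ϕ x - v₂ x‖ ^ 2 ≤ ε := by
  obtain ⟨C, hC1, hC⟩ := exists_deriv_le contDiff_plateau hasCompactSupport_plateau.deriv
  have hpd : Differentiable ℝ plateau := contDiff_plateau.differentiable (by simp)
  let k : ℕ → ℝ → ℝ := fun n s => plateau (s / (n + 1))
  have hk (n : ℕ) : ContDiff ℝ (⊤ : ℕ∞) (k n) := contDiff_plateau.comp (by fun_prop)
  have hk0 (n : ℕ) (s : ℝ) : |k n s| ≤ 1 := abs_plateau_le _
  have hk1 (n : ℕ) (s : ℝ) : |deriv (k n) s| ≤ C := by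
    rw [deriv_comp_div hpd, abs_div, abs_of_pos (by positivity : (0 : ℝ) < n + 1)]
    exact (div_le_self (abs_nonneg _) (by linarith [(n.cast_nonneg : (0 : ℝ) ≤ n)])).trans (hC _)
  have hm (n : ℕ) := (h.smul_fst (hk n) (fun s => (hk0 n s).trans hC1) (hk1 n)).smul_snd (hk n)
    (fun s => (hk0 n s).trans hC1) (hk1 n)
  have hev (x : ℝ × ℝ) : ∀ᶠ n : ℕ in atTop, k n x.1 = 1 ∧ k n x.2 = 1 ∧ deriv (k n) x.1 = 0 ∧
      deriv (k n) x.2 = 0 := by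
    filter_upwards [eventually_plateau x.1, eventually_plateau x.2] with n h1 h2
    refine ⟨h1.1, h2.1, ?_, ?_⟩
    · rw [deriv_comp_div hpd, h1.2, zero_div]
    · rw [deriv_comp_div hpd, h2.2, zero_div]
  have hsm {k r : ℝ} {z : ℂ} (hkr : |k| ≤ r) : ‖k • z‖ ≤ r * ‖z‖ := by
    rw [norm_smul, Real.norm_eq_abs]; gcongr
  have hgi {f g : ℝ × ℝ → ℂ} (hf : MemLp f 2 volume) (hg : MemLp g 2 volume) :
      Integrable fun x => (2 * ‖f x‖ + C * ‖g x‖) ^ 2 :=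
    ((hf.norm.const_mul 2).add (hg.norm.const_mul C)).integrable_sq
  have l0 := tendsto_integral_sq_of_dominated (fun n => ((hm n).memLp.sub h.memLp).1)
    (hgi h.memLp h.memLp) (fun n x => by
      have e1 := hsm (z := k n x.1 • u x) (hk0 n x.2)
      have e2 := hsm (z := u x) (hk0 n x.1)
      refine (norm_sub_le _ _).trans ?_
      nlinarith [norm_nonneg (u x)]) (fun x => by
      filter_upwards [hev x] with n hn
      simp [hn])
  have l1 := tendsto_integral_sq_of_dominated (fun n => ((hm n).memLp₁.sub h.memLp₁).1)
    (hgi h.memLp₁ h.memLp) (fun n x => by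
      have e1 := hsm (z := k n x.1 • v₁ x + deriv (k n) x.1 • u x) (hk0 n x.2)
      have e2 := hsm (z := v₁ x) (hk0 n x.1)
      have e3 := hsm (z := u x) (hk1 n x.1)
      have e4 := norm_add_le (k n x.1 • v₁ x) (deriv (k n) x.1 • u x)
      refine (norm_sub_le _ _).trans ?_
      linarith) (fun x => by
      filter_upwards [hev x] with n hn
      simp [hn])
  have l2 := tendsto_integral_sq_of_dominated (fun n => ((hm n).memLp₂.sub h.memLp₂).1)
    (hgi h.memLp₂ h.memLp) (fun n x => by
      have e1 := hsm (z := k n x.1 • v₂ x) (hk0 n x.2)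
      have e2 := hsm (z := v₂ x) (hk0 n x.1)
      have e3 := hsm (z := k n x.1 • u x) (hk1 n x.2)
      have e4 := hsm (z := u x) (hk0 n x.1)
      have e5 := norm_add_le (k n x.2 • k n x.1 • v₂ x) (deriv (k n) x.2 • k n x.1 • u x)
      refine (norm_sub_le _ _).trans ?_
      nlinarith [norm_nonneg (u x)]) (fun x => by
      filter_upwards [hev x] with n hn
      simp [hn])
  -- Two approximations, by cut-off and by mollification, are combined through ‖f + g‖² ≤ 2‖f‖² +
  -- 2‖g‖².
  have hε4 : 0 < ε / 4 := by positivity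
  obtain ⟨n, n0, n1, n2⟩ := ((l0.eventually_le_const hε4).and
    ((l1.eventually_le_const hε4).and (l2.eventually_le_const hε4))).exists
  obtain ⟨ϕ, hϕ, p0, p1, p2⟩ := (hm n).exists_test_of_compact (r := 2 * (n + 1)) (by positivity)
    (fun x hx => by
      have hn : (0 : ℝ) < n + 1 := by positivity
      have hx' : 2 * ((n : ℝ) + 1) < |x.1| ∨ 2 * ((n : ℝ) + 1) < |x.2| := by
        simpa [Prod.norm_def] using hx
      have key (s : ℝ) (hs : 2 * ((n : ℝ) + 1) < |s|) : k n s = 0 := by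
        apply plateau_eq_zero
        rw [abs_div, abs_of_pos hn, le_div_iff₀ hn]
        exact hs.le
      rcases hx' with h' | h'
      · simp [key _ h']
      · simp [key _ h']) hε4
  have comb {f g w : ℝ × ℝ → ℂ} (hf : MemLp f 2 volume) (hg : MemLp g 2 volume)
      (hw : MemLp w 2 volume) (h1 : ∫ x, ‖f x - g x‖ ^ 2 ≤ ε / 4)
      (h2 : ∫ x, ‖(g - w) x‖ ^ 2 ≤ ε / 4) : ∫ x, ‖f x - w x‖ ^ 2 ≤ ε := by
    have := integral_sq_add_le (hf.sub hg) (hg.sub hw)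
    simp only [Pi.sub_apply, sub_add_sub_cancel] at this h2
    linarith
  have hϕm := hϕ.magH1 a
  exact ⟨ϕ, hϕ, comb hϕm.memLp (hm n).memLp h.memLp p0 n0,
    comb hϕm.memLp₁ (hm n).memLp₁ h.memLp₁ p1 n1, comb hϕm.memLp₂ (hm n).memLp₂ h.memLp₂ p2 n2⟩

end StepGL

end

noncomputable section

namespace StepGL

variable {a : ℝ} {u v₁ v₂ : ℝ × ℝ → ℂ}

/-! ### Magnetic lower bounds -/

theorem integral_norm_mul_norm_le {f g : ℝ × ℝ → ℂ} (hf : MemLp f 2 volume)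
    (hg : MemLp g 2 volume) :
    ∫ x, ‖f x‖ * ‖g x‖ ≤ √(∫ x, ‖f x‖ ^ 2) * √(∫ x, ‖g x‖ ^ 2) := by
  have h := integral_mul_le_Lp_mul_Lq_of_nonneg (μ := (volume : Measure (ℝ × ℝ)))
    Real.HolderConjugate.two_two (f := fun x => ‖f x‖) (g := fun x => ‖g x‖)
    (.of_forall fun x => norm_nonneg _) (.of_forall fun x => norm_nonneg _)
    (by simpa using hf.norm) (by simpa using hg.norm)
  simpa [Real.sqrt_eq_rpow] using h

theorem integrable_norm_mul_norm {f g : ℝ × ℝ → ℂ} (hf : MemLp f 2 volume)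
    (hg : MemLp g 2 volume) : Integrable fun x => ‖f x‖ * ‖g x‖ :=
  hf.norm.integrable_mul hg.norm

theorem integrable_bdd_mul_sq {f : ℝ × ℝ → ℂ} (hf : MemLp f 2 volume) {k : ℝ × ℝ → ℝ} {C : ℝ}
    (hk : Measurable k) (hC : ∀ x, |k x| ≤ C) : Integrable fun x => k x * ‖f x‖ ^ 2 :=
  (integrable_sq hf).bdd_mul hk.aestronglyMeasurable (.of_forall hC)

/-- Weighted quadratic functionals are continuous in `L²`. -/
theorem tendsto_integral_mul_sq {F : ℕ → ℝ × ℝ → ℂ} {f : ℝ × ℝ → ℂ} {k : ℝ × ℝ → ℝ} {C : ℝ}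
    (hk : Measurable k) (hC : ∀ x, |k x| ≤ C) (hF : ∀ n, MemLp (F n) 2 volume)
    (hf : MemLp f 2 volume) (hlim : Tendsto (fun n => ∫ x, ‖F n x - f x‖ ^ 2) atTop (𝓝 0)) :
    Tendsto (fun n => ∫ x, k x * ‖F n x‖ ^ 2) atTop (𝓝 (∫ x, k x * ‖f x‖ ^ 2)) := by
  rw [tendsto_iff_norm_sub_tendsto_zero]
  have hC0 : 0 ≤ C := (abs_nonneg _).trans (hC 0)
  have hb : Tendsto (fun n => C * ((∫ x, ‖F n x - f x‖ ^ 2) +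
      2 * (√(∫ x, ‖F n x - f x‖ ^ 2) * √(∫ x, ‖f x‖ ^ 2)))) atTop (𝓝 0) := by
    have := (hlim.add ((hlim.sqrt.mul_const √(∫ x, ‖f x‖ ^ 2)).const_mul 2)).const_mul C
    simpa using this
  refine squeeze_zero (fun n => norm_nonneg _) (fun n => ?_) hb
  have hd := (hF n).sub hf
  rw [← integral_sub (integrable_bdd_mul_sq (hF n) hk hC) (integrable_bdd_mul_sq hf hk hC)]
  refine (norm_integral_le_integral_norm _).trans ?_
  have i1 : Integrable fun x => ‖F n x - f x‖ ^ 2 := integrable_sq hd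
  have i2 : Integrable fun x => ‖F n x - f x‖ * ‖f x‖ := integrable_norm_mul_norm hd hf
  calc ∫ x, ‖k x * ‖F n x‖ ^ 2 - k x * ‖f x‖ ^ 2‖
      ≤ ∫ x, C * (‖F n x - f x‖ ^ 2 + 2 * (‖F n x - f x‖ * ‖f x‖)) := by
        refine integral_mono (((integrable_bdd_mul_sq (hF n) hk hC).sub
          (integrable_bdd_mul_sq hf hk hC)).norm) ((i1.add (i2.const_mul 2)).const_mul C)
          fun x => ?_
        simp only
        rw [← mul_sub, norm_mul, Real.norm_eq_abs, Real.norm_eq_abs]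
        refine mul_le_mul (hC x) ?_ (abs_nonneg _) hC0
        have h1 : ‖F n x‖ ≤ ‖F n x - f x‖ + ‖f x‖ := by
          simpa using norm_add_le (F n x - f x) (f x)
        have h2 : ‖f x‖ ≤ ‖F n x - f x‖ + ‖F n x‖ := by
          simpa [norm_sub_rev] using norm_add_le (f x - F n x) (F n x)
        rw [abs_le]
        constructor <;> nlinarith [norm_nonneg (F n x), norm_nonneg (f x),
          norm_nonneg (F n x - f x)]
    _ = C * ((∫ x, ‖F n x - f x‖ ^ 2) + 2 * ∫ x, ‖F n x - f x‖ * ‖f x‖) := by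
        rw [integral_const_mul, integral_add i1 (i2.const_mul 2), integral_const_mul]
    _ ≤ _ := by
        gcongr
        exact integral_norm_mul_norm_le hd hf

theorem tendsto_integral_sq {F : ℕ → ℝ × ℝ → ℂ} {f : ℝ × ℝ → ℂ} (hF : ∀ n, MemLp (F n) 2 volume)
    (hf : MemLp f 2 volume) (hlim : Tendsto (fun n => ∫ x, ‖F n x - f x‖ ^ 2) atTop (𝓝 0)) :
    Tendsto (fun n => ∫ x, ‖F n x‖ ^ 2) atTop (𝓝 (∫ x, ‖f x‖ ^ 2)) := by
  simpa using tendsto_integral_mul_sq (k := fun _ => 1) (C := 1) measurable_const (by simp)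
    hF hf hlim

theorem MagH1.exists_test_seq (h : MagH1 a u v₁ v₂) :
    ∃ ϕ : ℕ → ℝ × ℝ → ℂ, (∀ n, IsCTest (ϕ n)) ∧
      Tendsto (fun n => ∫ x, ‖ϕ n x - u x‖ ^ 2) atTop (𝓝 0) ∧
      Tendsto (fun n => ∫ x, ‖mag1 a (ϕ n) x - v₁ x‖ ^ 2) atTop (𝓝 0) ∧
      Tendsto (fun n => ∫ x, ‖mag2 (ϕ n) x - v₂ x‖ ^ 2) atTop (𝓝 0) := by
  choose ϕ h0 h1 h2 h3 using fun n : ℕ => h.exists_test (ε := 1 / ((n : ℝ) + 1)) (by positivity)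
  refine ⟨ϕ, h0, ?_, ?_, ?_⟩
  · exact squeeze_zero (fun n => by positivity) h1 tendsto_one_div_add_atTop_nhds_zero_nat
  · exact squeeze_zero (fun n => by positivity) h2 tendsto_one_div_add_atTop_nhds_zero_nat
  · exact squeeze_zero (fun n => by positivity) h3 tendsto_one_div_add_atTop_nhds_zero_nat

theorem lipschitzWith_pot (a : ℝ) : LipschitzWith (1 + ‖a‖₊) (pot a) := by
  refine LipschitzWith.of_dist_le_mul fun x y => ?_
  have h1 := abs_max_sub_max_le_abs x.2 y.2 0
  have h2 := abs_max_sub_max_le_abs (-x.2) (-y.2) 0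
  have h3 : |x.2 - y.2| ≤ dist x y := by
    rw [dist_eq_norm]; exact norm_snd_le (x - y)
  have h4 : |-x.2 - -y.2| = |x.2 - y.2| := by rw [← abs_neg]; ring_nf
  rw [Real.dist_eq, pot_eq, pot_eq]
  push_cast
  rw [Real.norm_eq_abs]
  calc |-max x.2 0 + a * max (-x.2) 0 - (-max y.2 0 + a * max (-y.2) 0)|
      = |-(max x.2 0 - max y.2 0) + a * (max (-x.2) 0 - max (-y.2) 0)| := by ring_nf
    _ ≤ |max x.2 0 - max y.2 0| + |a| * |max (-x.2) 0 - max (-y.2) 0| := by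
        refine (abs_add_le _ _).trans ?_
        rw [abs_neg, abs_mul]
    _ ≤ dist x y + |a| * dist x y := by
        gcongr
        · exact h1.trans h3
        · exact h2.trans (h4.trans_le h3)
    _ = (1 + |a|) * dist x y := by ring

theorem lineDeriv_pot (a : ℝ) {x : ℝ × ℝ} (hx : x.2 ≠ 0) :
    lineDeriv ℝ (pot a) x (0, 1) = -step a x := by
  have e (t : ℝ) : pot a (x + t • (0, 1)) = step a (x + t • (0, 1)) * (-(x.2 + t)) := by
    simp [pot]
  have hd (c : ℝ) : deriv (fun t : ℝ => c * (-(x.2 + t))) 0 = -c := by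
    have : HasDerivAt (fun t : ℝ => c * (-(x.2 + t))) (c * (-(0 + 1))) 0 :=
      (((hasDerivAt_const (0 : ℝ) x.2).add (hasDerivAt_id 0)).neg).const_mul c
    rw [this.deriv]; ring
  have hs : ∀ᶠ t : ℝ in 𝓝 0, step a (x + t • (0, 1)) = step a x := by
    rcases lt_or_gt_of_ne hx with h | h
    · have : ∀ᶠ t : ℝ in 𝓝 0, x.2 + t < 0 :=
        ((continuous_const.add continuous_id).tendsto (0 : ℝ)).eventually_lt_const (by simpa using h)
      filter_upwards [this] with t ht
      simp [step, ht.not_gt, h.not_gt]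
    · have : ∀ᶠ t : ℝ in 𝓝 0, 0 < x.2 + t :=
        ((continuous_const.add continuous_id).tendsto (0 : ℝ)).eventually_const_lt (by simpa using h)
      filter_upwards [this] with t ht
      simp [step, ht, h]
  rw [lineDeriv, ← hd (step a x)]
  apply Filter.EventuallyEq.deriv_eq
  filter_upwards [hs] with t ht
  rw [e, ht]

theorem ae_snd_ne_zero : ∀ᵐ x : ℝ × ℝ, x.2 ≠ 0 := by
  have : volume ((univ : Set ℝ) ×ˢ ({0} : Set ℝ)) = 0 := by
    rw [Measure.volume_eq_prod, Measure.prod_prod]; simp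
  refine measure_mono_null (fun x hx => ?_) this
  simpa using hx

theorem measurable_step (a : ℝ) : Measurable (step a) :=
  Measurable.ite (measurableSet_lt measurable_const measurable_snd) measurable_const
    measurable_const

/-- The potential is only Lipschitz; integration by parts is still valid, with its almost everywhere
derivative -σ and no contribution from the line x₂ = 0. -/
theorem integral_pot_mul_d2 (a : ℝ) {ψ : ℝ × ℝ → ℝ} (hψ : IsTest ψ) :
    ∫ x, pot a x * d2 ψ x = ∫ x, step a x * ψ x := by
  obtain ⟨D, hD⟩ := ContDiff.lipschitzWith_of_hasCompactSupport hψ.2 hψ.1 (by simp)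
  have h := (lipschitzWith_pot a).integral_lineDeriv_mul_eq (μ := volume) hD hψ.2 (0, 1)
  have h1 : ∫ x, lineDeriv ℝ (pot a) x (0, 1) * ψ x = ∫ x, -(step a x * ψ x) := by
    refine integral_congr_ae ?_
    filter_upwards [ae_snd_ne_zero] with x hx
    rw [lineDeriv_pot a hx]; ring
  have h2 : ∫ x, lineDeriv ℝ ψ x (-(0, 1)) * pot a x = ∫ x, -(pot a x * d2 ψ x) := by
    congr 1; ext x
    rw [(hψ.differentiable x).lineDeriv_eq_fderiv, map_neg, d2]; ring
  rw [h1, h2, integral_neg, integral_neg, neg_inj] at h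
  exact h.symm

theorem IsTest.isTest_d1 {φ : ℝ × ℝ → ℝ} (h : IsTest φ) : IsTest (d1 φ) :=
  ⟨(h.1.fderiv_right (m := (⊤ : ℕ∞)) (by simp)).clm_apply contDiff_const,
    h.hasCompactSupport_d1⟩

theorem IsTest.isTest_d2 {φ : ℝ × ℝ → ℝ} (h : IsTest φ) : IsTest (d2 φ) :=
  ⟨(h.1.fderiv_right (m := (⊤ : ℕ∞)) (by simp)).clm_apply contDiff_const,
    h.hasCompactSupport_d2⟩

theorem IsTest.mul {φ ψ : ℝ × ℝ → ℝ} (h : IsTest φ) (h' : IsTest ψ) : IsTest fun x => φ x * ψ x :=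
  h'.mul_left h.1

theorem IsTest.integrable {φ : ℝ × ℝ → ℝ} (h : IsTest φ) : Integrable φ :=
  h.continuous.integrable_of_hasCompactSupport h.2

theorem d1_d2_comm {φ : ℝ × ℝ → ℝ} (h : IsTest φ) (x : ℝ × ℝ) : d1 (d2 φ) x = d2 (d1 φ) x := by
  have hs : IsSymmSndFDerivAt ℝ φ x :=
    ((h.1.of_le (m := 2) (WithTop.coe_le_coe.2 (le_top : (2 : ℕ∞) ≤ ⊤))).contDiffAt).isSymmSndFDerivAt
      (by simp)
  have hd : DifferentiableAt ℝ (fderiv ℝ φ) x :=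
    (h.1.fderiv_right (m := (⊤ : ℕ∞)) (by simp)).differentiable (by simp) x
  have e (v w : ℝ × ℝ) : fderiv ℝ (fun y => fderiv ℝ φ y v) x w =
      fderiv ℝ (fderiv ℝ φ) x w v := by
    rw [fderiv_clm_apply hd (differentiableAt_const v)]
    simp
  change fderiv ℝ (fun y => fderiv ℝ φ y (0, 1)) x (1, 0) =
    fderiv ℝ (fun y => fderiv ℝ φ y (1, 0)) x (0, 1)
  rw [e, e]
  exact hs.eq _ _

/-- The Jacobian of the pair (p, q) is a divergence: integrate by parts twice and use the symmetry
of second derivatives. -/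
theorem integral_d1_mul_d2 {p q : ℝ × ℝ → ℝ} (hp : IsTest p) (hq : IsTest q) :
    ∫ x, d1 q x * d2 p x = ∫ x, d1 p x * d2 q x := by
  have h1 := integral_mul_fderiv_eq_neg_fderiv_mul_of_integrable (μ := (volume : Measure (ℝ × ℝ)))
    (f := d2 p) (g := q) (v := (1, 0)) (hp.isTest_d2.isTest_d1.mul hq).integrable (hp.isTest_d2.mul hq.isTest_d1).integrable
    (hp.isTest_d2.mul hq).integrable (fun x _ => hp.isTest_d2.differentiable x) (fun x _ => hq.differentiable x)
  have h2 := integral_mul_fderiv_eq_neg_fderiv_mul_of_integrable (μ := (volume : Measure (ℝ × ℝ)))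
    (f := d1 p) (g := q) (v := (0, 1)) (hp.isTest_d1.isTest_d2.mul hq).integrable (hp.isTest_d1.mul hq.isTest_d2).integrable
    (hp.isTest_d1.mul hq).integrable (fun x _ => hp.isTest_d1.differentiable x) (fun x _ => hq.differentiable x)
  have h3 : ∀ x, fderiv ℝ (d2 p) x (1, 0) = fderiv ℝ (d1 p) x (0, 1) := d1_d2_comm hp
  simp only [h3] at h1
  calc ∫ x, d1 q x * d2 p x = ∫ x, d2 p x * fderiv ℝ q x (1, 0) := by
        congr 1; ext x; rw [d1]; ring
    _ = ∫ x, d1 p x * fderiv ℝ q x (0, 1) := by rw [h1, h2]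
    _ = _ := rfl

end StepGL

end

/-! ### Commutator and weighted inequalities, on test functions and then by density -/

noncomputable section

namespace StepGL

variable {a : ℝ} {u v₁ v₂ : ℝ × ℝ → ℂ}

namespace IsCTest

variable {ϕ : ℝ × ℝ → ℂ}

theorem isTest_re (h : IsCTest ϕ) : IsTest fun x => (ϕ x).re :=
  ⟨Complex.reCLM.contDiff.comp h.1, h.2.comp_left (g := Complex.re) rfl⟩

theorem isTest_im (h : IsCTest ϕ) : IsTest fun x => (ϕ x).im :=
  ⟨Complex.imCLM.contDiff.comp h.1, h.2.comp_left (g := Complex.im) rfl⟩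

theorem fderiv_re (h : IsCTest ϕ) (x e : ℝ × ℝ) :
    fderiv ℝ (fun x => (ϕ x).re) x e = (fderiv ℝ ϕ x e).re := by
  have : HasFDerivAt (fun x => (ϕ x).re) (Complex.reCLM.comp (fderiv ℝ ϕ x)) x :=
    Complex.reCLM.hasFDerivAt.comp x (h.differentiable x).hasFDerivAt
  rw [this.fderiv]; rfl

theorem fderiv_im (h : IsCTest ϕ) (x e : ℝ × ℝ) :
    fderiv ℝ (fun x => (ϕ x).im) x e = (fderiv ℝ ϕ x e).im := by
  have : HasFDerivAt (fun x => (ϕ x).im) (Complex.imCLM.comp (fderiv ℝ ϕ x)) x :=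
    Complex.imCLM.hasFDerivAt.comp x (h.differentiable x).hasFDerivAt
  rw [this.fderiv]; rfl

theorem isTest_normSq (h : IsCTest ϕ) : IsTest fun x => ‖ϕ x‖ ^ 2 := by
  have h1 := h.isTest_re.mul h.isTest_re
  have h2 := h.isTest_im.mul h.isTest_im
  have e : (fun x => ‖ϕ x‖ ^ 2) = fun x => (ϕ x).re * (ϕ x).re + (ϕ x).im * (ϕ x).im := by
    ext x; rw [Complex.sq_norm, Complex.normSq_apply]
  rw [e]
  exact ⟨h1.1.add h2.1, h1.2.add h2.2⟩

theorem d2_normSq (h : IsCTest ϕ) (x : ℝ × ℝ) :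
    d2 (fun x => ‖ϕ x‖ ^ 2) x =
      2 * ((ϕ x).re * (mag2 ϕ x).re + (ϕ x).im * (mag2 ϕ x).im) := by
  have e : (fun x => ‖ϕ x‖ ^ 2) = fun x => (ϕ x).re * (ϕ x).re + (ϕ x).im * (ϕ x).im := by
    ext x; rw [Complex.sq_norm, Complex.normSq_apply]
  have hr := h.isTest_re.differentiable x
  have hi := h.isTest_im.differentiable x
  rw [e, d2, fderiv_fun_add (hr.fun_mul hr) (hi.fun_mul hi), fderiv_fun_mul hr hr, fderiv_fun_mul hi hi]
  simp only [add_apply, smul_apply, h.fderiv_re,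
    h.fderiv_im, smul_eq_mul, mag2]
  ring

theorem abs_d2_normSq_le (h : IsCTest ϕ) (x : ℝ × ℝ) :
    |d2 (fun x => ‖ϕ x‖ ^ 2) x| ≤ 2 * (‖ϕ x‖ * ‖mag2 ϕ x‖) := by
  rw [h.d2_normSq, abs_mul, abs_two]
  gcongr
  have e : (ϕ x).re * (mag2 ϕ x).re + (ϕ x).im * (mag2 ϕ x).im =
      (ϕ x * (starRingEnd ℂ) (mag2 ϕ x)).re := by
    simp
  rw [e]
  refine (Complex.abs_re_le_norm _).trans ?_
  simp

/-- The commutator inequality on test functions. -/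
theorem abs_integral_step_le (h : IsCTest ϕ) (a : ℝ) :
    |∫ x, step a x * ‖ϕ x‖ ^ 2| ≤ (∫ x, ‖mag1 a ϕ x‖ ^ 2) + ∫ x, ‖mag2 ϕ x‖ ^ 2 := by
  have hm := h.magH1 a
  have hp := h.isTest_re
  have hq := h.isTest_im
  have i1 : Integrable fun x => pot a x * d2 (fun x => ‖ϕ x‖ ^ 2) x :=
    ((continuous_pot a).mul h.isTest_normSq.continuous_d2).integrable_of_hasCompactSupport
      (HasCompactSupport.mul_left h.isTest_normSq.hasCompactSupport_d2)
  have i2 := (hq.isTest_d1.mul hp.isTest_d2).integrable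
  have i3 := (hp.isTest_d1.mul hq.isTest_d2).integrable
  -- This is [D₁, D₂] = -iσ in weak form. Expanding Im(D₁ϕ · conj D₂ϕ) gives a potential term,
  -- integrated by parts to σ|ϕ|², and the Jacobian of (Re ϕ, Im ϕ), whose integral is zero.
  have key : ∫ x, step a x * ‖ϕ x‖ ^ 2 =
      ∫ x, -2 * (mag1 a ϕ x * (starRingEnd ℂ) (mag2 ϕ x)).im := by
    rw [← integral_pot_mul_d2 a h.isTest_normSq]
    have e (x : ℝ × ℝ) : -2 * (mag1 a ϕ x * (starRingEnd ℂ) (mag2 ϕ x)).im =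
        pot a x * d2 (fun x => ‖ϕ x‖ ^ 2) x - 2 * (d1 (fun x => (ϕ x).im) x *
          d2 (fun x => (ϕ x).re) x - d1 (fun x => (ϕ x).re) x * d2 (fun x => (ϕ x).im) x) := by
      rw [h.d2_normSq]
      simp only [d1, d2, h.fderiv_re, h.fderiv_im, mag1, mag2]
      simp
      ring
    simp only [e]
    have i4 : Integrable fun x => 2 * (d1 (fun x => (ϕ x).im) x * d2 (fun x => (ϕ x).re) x -
        d1 (fun x => (ϕ x).re) x * d2 (fun x => (ϕ x).im) x) := (i2.sub i3).const_mul 2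
    rw [integral_sub i1 i4, integral_const_mul, integral_sub i2 i3,
      integral_d1_mul_d2 hp hq]
    simp
  rw [key, ← integral_add (integrable_sq hm.memLp₁) (integrable_sq hm.memLp₂)]
  refine abs_integral_le_integral_abs.trans ?_
  refine integral_mono_of_nonneg (.of_forall fun x => abs_nonneg _)
    ((integrable_sq hm.memLp₁).add (integrable_sq hm.memLp₂)) (.of_forall fun x => ?_)
  simp only
  rw [abs_mul, abs_neg, abs_two]
  have := (Complex.abs_im_le_norm (mag1 a ϕ x * (starRingEnd ℂ) (mag2 ϕ x)))
  rw [norm_mul, Complex.norm_conj] at this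
  nlinarith [sq_nonneg (‖mag1 a ϕ x‖ - ‖mag2 ϕ x‖)]

/-- The weight is the derivative of the bounded function arctan x₂; integrating by parts puts the
derivative on |ϕ|². The bound controls mass near the line x₂ = 0, where the field gives no
information. -/
theorem integral_weight_le (h : IsCTest ϕ) :
    ∫ x : ℝ × ℝ, (1 + x.2 ^ 2)⁻¹ * ‖ϕ x‖ ^ 2 ≤
      Real.pi * (√(∫ x, ‖ϕ x‖ ^ 2) * √(∫ x, ‖mag2 ϕ x‖ ^ 2)) := by
  have hm := h.magH1 0
  have ht := h.isTest_normSq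
  have hat : Differentiable ℝ fun x : ℝ × ℝ => Real.arctan x.2 :=
    Real.differentiable_arctan.comp differentiable_snd
  have hfd (x : ℝ × ℝ) : fderiv ℝ (fun x : ℝ × ℝ => Real.arctan x.2) x (0, 1) =
      (1 + x.2 ^ 2)⁻¹ := by
    have := d2_comp_snd Real.differentiable_arctan x
    rw [d2] at this
    rw [this, Real.deriv_arctan]; simp
  have c1 : Continuous fun x : ℝ × ℝ => (1 + x.2 ^ 2)⁻¹ :=
    Continuous.inv₀ (by fun_prop) fun x => by positivity
  have c2 : Continuous fun x : ℝ × ℝ => Real.arctan x.2 := hat.continuous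
  have i1 : Integrable fun x : ℝ × ℝ => (1 + x.2 ^ 2)⁻¹ * ‖ϕ x‖ ^ 2 :=
    (c1.mul ht.continuous).integrable_of_hasCompactSupport (HasCompactSupport.mul_left ht.2)
  have i2 : Integrable fun x : ℝ × ℝ => Real.arctan x.2 * d2 (fun x => ‖ϕ x‖ ^ 2) x :=
    (c2.mul ht.continuous_d2).integrable_of_hasCompactSupport
      (HasCompactSupport.mul_left ht.hasCompactSupport_d2)
  have i3 : Integrable fun x : ℝ × ℝ => Real.arctan x.2 * ‖ϕ x‖ ^ 2 :=
    (c2.mul ht.continuous).integrable_of_hasCompactSupport (HasCompactSupport.mul_left ht.2)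
  have hp := integral_mul_fderiv_eq_neg_fderiv_mul_of_integrable
    (μ := (volume : Measure (ℝ × ℝ))) (f := fun x : ℝ × ℝ => Real.arctan x.2)
    (g := fun x => ‖ϕ x‖ ^ 2) (v := (0, 1)) (by simpa only [hfd] using i1) i2 i3
    (fun x _ => hat x) (fun x _ => ht.differentiable x)
  simp only [hfd] at hp
  rw [← neg_eq_iff_eq_neg, ← integral_neg] at hp
  rw [← hp]
  calc _ ≤ ∫ x, Real.pi * (‖ϕ x‖ * ‖mag2 ϕ x‖) := by
        refine integral_mono i2.neg ((integrable_norm_mul_norm hm.memLp hm.memLp₂).const_mul _)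
          fun x => ?_
        refine (neg_le_abs _).trans ?_
        simp only
        rw [abs_mul]
        have h1 : |Real.arctan x.2| ≤ Real.pi / 2 :=
          abs_le.2 ⟨(Real.neg_pi_div_two_lt_arctan _).le, (Real.arctan_lt_pi_div_two _).le⟩
        have h2 := h.abs_d2_normSq_le x
        calc _ ≤ Real.pi / 2 * (2 * (‖ϕ x‖ * ‖mag2 ϕ x‖)) := by
              refine mul_le_mul h1 h2 (abs_nonneg _) (by positivity)
          _ = _ := by ring
    _ ≤ _ := by
        rw [integral_const_mul]
        gcongr
        exact integral_norm_mul_norm_le hm.memLp hm.memLp₂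

end IsCTest

theorem abs_step_le (ha : |a| ≤ 1) (x : ℝ × ℝ) : |step a x| ≤ 1 := by
  unfold step; split_ifs <;> simp [ha]

/-- The commutator inequality. -/
theorem MagH1.abs_integral_step_le (h : MagH1 a u v₁ v₂) (ha : |a| ≤ 1) :
    |∫ x, step a x * ‖u x‖ ^ 2| ≤ (∫ x, ‖v₁ x‖ ^ 2) + ∫ x, ‖v₂ x‖ ^ 2 := by
  obtain ⟨ϕ, hϕ, l0, l1, l2⟩ := h.exists_test_seq
  refine le_of_tendsto_of_tendsto'
    (tendsto_integral_mul_sq (measurable_step a) (abs_step_le ha)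
      (fun n => ((hϕ n).magH1 a).memLp) h.memLp l0).abs
    ((tendsto_integral_sq (fun n => ((hϕ n).magH1 a).memLp₁) h.memLp₁ l1).add
      (tendsto_integral_sq (fun n => ((hϕ n).magH1 a).memLp₂) h.memLp₂ l2))
    fun n => (hϕ n).abs_integral_step_le a

theorem measurable_weight : Measurable fun x : ℝ × ℝ => (1 + x.2 ^ 2)⁻¹ := by fun_prop

theorem abs_weight_le (x : ℝ × ℝ) : |(1 + x.2 ^ 2)⁻¹| ≤ 1 := by
  rw [abs_of_nonneg (by positivity)]
  exact inv_le_one_of_one_le₀ (by nlinarith [sq_nonneg x.2])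

theorem MagH1.integral_weight_le (h : MagH1 a u v₁ v₂) :
    ∫ x : ℝ × ℝ, (1 + x.2 ^ 2)⁻¹ * ‖u x‖ ^ 2 ≤
      Real.pi * (√(∫ x, ‖u x‖ ^ 2) * √(∫ x, ‖v₂ x‖ ^ 2)) := by
  obtain ⟨ϕ, hϕ, l0, l1, l2⟩ := h.exists_test_seq
  refine le_of_tendsto_of_tendsto'
    (tendsto_integral_mul_sq measurable_weight abs_weight_le
      (fun n => ((hϕ n).magH1 a).memLp) h.memLp l0)
    (((tendsto_integral_sq (fun n => ((hϕ n).magH1 a).memLp) h.memLp l0).sqrt.mul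
      (tendsto_integral_sq (fun n => ((hϕ n).magH1 a).memLp₂) h.memLp₂ l2).sqrt).const_mul _)
    fun n => (hϕ n).integral_weight_le

/-- Here σ ≥ a everywhere, so the commutator inequality is already the spectral bound. -/
theorem MagH1.le_of_pos (h : MagH1 a u v₁ v₂) (ha : 0 < a) (ha1 : a ≤ 1) :
    a * ∫ x, ‖u x‖ ^ 2 ≤ (∫ x, ‖v₁ x‖ ^ 2) + ∫ x, ‖v₂ x‖ ^ 2 := by
  have haa : |a| ≤ 1 := by rwa [abs_of_pos ha]
  refine le_trans ?_ (h.abs_integral_step_le haa)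
  refine le_trans ?_ (le_abs_self _)
  rw [← integral_const_mul]
  refine integral_mono ((integrable_sq h.memLp).const_mul a)
    (integrable_bdd_mul_sq h.memLp (measurable_step a) (abs_step_le haa)) fun x => ?_
  simp only
  gcongr
  unfold step; split_ifs <;> linarith

end StepGL

end

noncomputable section

namespace StepGL

variable {a b R L : ℝ} {u v₁ v₂ : ℝ × ℝ → ℂ}

/-! ### Localization in the direction `x₂` -/

/-- A smooth angle, `0` on `[-1, 1]` and `π / 2` off `[-2, 2]`. -/
def angle (t : ℝ) : ℝ := Real.pi / 2 * Real.smoothTransition (t ^ 2 - 1)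

theorem contDiff_angle : ContDiff ℝ (⊤ : ℕ∞) angle :=
  contDiff_const.mul (contDiff_smoothTransition.comp (by fun_prop))

theorem angle_eq_zero {t : ℝ} (h : |t| ≤ 1) : angle t = 0 := by
  rw [angle, Real.smoothTransition.zero_of_nonpos (by nlinarith [sq_abs t, abs_nonneg t]), mul_zero]

theorem angle_eq_pi_div_two {t : ℝ} (h : 3 / 2 ≤ |t|) : angle t = Real.pi / 2 := by
  rw [angle, Real.smoothTransition.one_of_one_le (by nlinarith [sq_abs t, abs_nonneg t]), mul_one]

theorem deriv_angle_eq_zero {t : ℝ} (h : 2 ≤ |t|) : deriv angle t = 0 := by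
  have : angle =ᶠ[𝓝 t] fun _ => Real.pi / 2 := by
    filter_upwards [(continuous_abs.tendsto t).eventually_const_lt (show 3 / 2 < |t| by linarith)]
      with s hs
    exact angle_eq_pi_div_two hs.le
  rw [this.deriv_eq, deriv_const]

theorem hasCompactSupport_deriv_angle : HasCompactSupport (deriv angle) :=
  HasCompactSupport.intro (isCompact_Icc (a := (-2 : ℝ)) (b := 2)) fun x hx => by
    apply deriv_angle_eq_zero
    by_contra! h
    exact hx ⟨by linarith [(abs_lt.1 h).1], by linarith [(abs_lt.1 h).2]⟩

theorem exists_angle_bound : ∃ C : ℝ, 1 ≤ C ∧ ∀ t, |deriv angle t| ≤ C :=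
  exists_deriv_le contDiff_angle hasCompactSupport_deriv_angle

/-- A bound on the derivative of `angle`. -/
def angleC : ℝ := exists_angle_bound.choose

theorem one_le_angleC : 1 ≤ angleC := exists_angle_bound.choose_spec.1

theorem abs_deriv_angle_le (t : ℝ) : |deriv angle t| ≤ angleC := exists_angle_bound.choose_spec.2 t

/-- The derivative of the scaled angle. -/
def angleSlope (L t : ℝ) : ℝ := deriv angle (t / L) / L

theorem hasDerivAt_angle_div (L t : ℝ) :
    HasDerivAt (fun s => angle (s / L)) (angleSlope L t) t := by
  have hd : Differentiable ℝ angle := contDiff_angle.differentiable (by simp)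
  rw [angleSlope, ← deriv_comp_div hd]
  exact DifferentiableAt.hasDerivAt (hd.comp (differentiable_id.div_const L) t)

theorem abs_angleSlope_le (hL : 0 < L) (t : ℝ) : |angleSlope L t| ≤ angleC / L := by
  rw [angleSlope, abs_div, abs_of_pos hL]
  gcongr
  exact abs_deriv_angle_le _

theorem angleSlope_eq_zero (hL : 0 < L) {t : ℝ} (h : 2 * L ≤ |t|) : angleSlope L t = 0 := by
  rw [angleSlope, deriv_angle_eq_zero, zero_div]
  rwa [abs_div, abs_of_pos hL, le_div_iff₀ hL]

theorem continuous_angleSlope (L : ℝ) : Continuous (angleSlope L) :=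
  ((contDiff_angle.continuous_deriv (by simp)).comp (continuous_id.div_const L)).div_const L

/-- Inner and outer cut-off functions, with squares summing to `1`. -/
def cIn (L t : ℝ) : ℝ := Real.cos (angle (t / L))

def cOut (L t : ℝ) : ℝ := Real.sin (angle (t / L))

theorem contDiff_cIn (L : ℝ) : ContDiff ℝ (⊤ : ℕ∞) (cIn L) :=
  Real.contDiff_cos.comp (contDiff_angle.comp (by fun_prop))

theorem contDiff_cOut (L : ℝ) : ContDiff ℝ (⊤ : ℕ∞) (cOut L) :=
  Real.contDiff_sin.comp (contDiff_angle.comp (by fun_prop))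

/-- Parametrizing the two cut-offs by one angle makes the squares of their derivatives add up to
exactly `angleSlope ^ 2`, which is the whole localization error. -/
theorem deriv_cIn (L t : ℝ) : deriv (cIn L) t = -cOut L t * angleSlope L t :=
  ((hasDerivAt_angle_div L t).cos).deriv

theorem deriv_cOut (L t : ℝ) : deriv (cOut L) t = cIn L t * angleSlope L t :=
  ((hasDerivAt_angle_div L t).sin).deriv

theorem abs_cIn_le (L t : ℝ) : |cIn L t| ≤ 1 := Real.abs_cos_le_one _

theorem abs_cOut_le (L t : ℝ) : |cOut L t| ≤ 1 := Real.abs_sin_le_one _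

theorem cIn_sq_add_cOut_sq (L t : ℝ) : cIn L t ^ 2 + cOut L t ^ 2 = 1 := Real.cos_sq_add_sin_sq _

theorem cIn_eq_zero (hL : 0 < L) {t : ℝ} (h : 2 * L ≤ |t|) : cIn L t = 0 := by
  rw [cIn, angle_eq_pi_div_two, Real.cos_pi_div_two]
  rw [abs_div, abs_of_pos hL, le_div_iff₀ hL]
  linarith

theorem cOut_eq_zero (hL : 0 < L) {t : ℝ} (h : |t| ≤ L) : cOut L t = 0 := by
  rw [cOut, angle_eq_zero, Real.sin_zero]
  rwa [abs_div, abs_of_pos hL, div_le_one hL]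

theorem MagH1.inner (h : MagH1 a u v₁ v₂) (hL : 0 < L) :
    MagH1 a (fun x => cIn L x.2 • u x) (fun x => cIn L x.2 • v₁ x)
      (fun x => cIn L x.2 • v₂ x + (-cOut L x.2 * angleSlope L x.2) • u x) := by
  have := h.smul_snd (contDiff_cIn L) (C := 1 + angleC / L)
    (fun t => (abs_cIn_le L t).trans (by
      have := div_pos (zero_lt_one.trans_le one_le_angleC) hL; linarith)) (fun t => by
      rw [deriv_cIn, abs_mul, abs_neg]
      have h1 := abs_angleSlope_le hL t
      have h2 := abs_cOut_le L t
      nlinarith [abs_nonneg (angleSlope L t)])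
  simpa only [deriv_cIn] using this

theorem MagH1.outer (h : MagH1 a u v₁ v₂) (hL : 0 < L) :
    MagH1 a (fun x => cOut L x.2 • u x) (fun x => cOut L x.2 • v₁ x)
      (fun x => cOut L x.2 • v₂ x + (cIn L x.2 * angleSlope L x.2) • u x) := by
  have := h.smul_snd (contDiff_cOut L) (C := 1 + angleC / L)
    (fun t => (abs_cOut_le L t).trans (by
      have := div_pos (zero_lt_one.trans_le one_le_angleC) hL; linarith)) (fun t => by
      rw [deriv_cOut, abs_mul]
      have h1 := abs_angleSlope_le hL t
      have h2 := abs_cIn_le L t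
      nlinarith [abs_nonneg (angleSlope L t)])
  simpa only [deriv_cOut] using this

/-- The pointwise localization identity. -/
theorem normSq_localize (c s m : ℝ) (z w : ℂ) (h : c ^ 2 + s ^ 2 = 1) :
    ‖c • z + (-s * m) • w‖ ^ 2 + ‖s • z + (c * m) • w‖ ^ 2 = ‖z‖ ^ 2 + m ^ 2 * ‖w‖ ^ 2 := by
  simp only [Complex.sq_norm, Complex.normSq_apply]
  simp
  linear_combination (z.re ^ 2 + z.im ^ 2 + m ^ 2 * (w.re ^ 2 + w.im ^ 2)) * h

theorem normSq_smul (c : ℝ) (z : ℂ) : ‖c • z‖ ^ 2 = c ^ 2 * ‖z‖ ^ 2 := by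
  rw [norm_smul, mul_pow, Real.norm_eq_abs, sq_abs]

theorem integrable_slope_sq (hu : MemLp u 2 volume) (hL : 0 < L) :
    Integrable fun x => angleSlope L x.2 ^ 2 * ‖u x‖ ^ 2 := by
  refine integrable_bdd_mul_sq (C := (angleC / L) ^ 2) hu
    (((continuous_angleSlope L).comp continuous_snd).pow 2).measurable fun x => ?_
  rw [abs_of_nonneg (sq_nonneg _), ← sq_abs]
  have := abs_angleSlope_le hL x.2
  gcongr

/-- The localization formula. -/
theorem MagH1.integral_localize (h : MagH1 a u v₁ v₂) (hL : 0 < L) :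
    ((∫ x, ‖cIn L x.2 • v₁ x‖ ^ 2) +
      ∫ x, ‖cIn L x.2 • v₂ x + (-cOut L x.2 * angleSlope L x.2) • u x‖ ^ 2) +
    ((∫ x, ‖cOut L x.2 • v₁ x‖ ^ 2) +
      ∫ x, ‖cOut L x.2 • v₂ x + (cIn L x.2 * angleSlope L x.2) • u x‖ ^ 2) =
    (∫ x, ‖v₁ x‖ ^ 2) + (∫ x, ‖v₂ x‖ ^ 2) + ∫ x, angleSlope L x.2 ^ 2 * ‖u x‖ ^ 2 := by
  have hi := h.inner hL
  have ho := h.outer hL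
  have e1 : ((∫ x, ‖cIn L x.2 • v₁ x‖ ^ 2) + ∫ x, ‖cOut L x.2 • v₁ x‖ ^ 2) = ∫ x, ‖v₁ x‖ ^ 2 := by
    rw [← integral_add (integrable_sq hi.memLp₁) (integrable_sq ho.memLp₁)]
    congr 1; ext x
    rw [normSq_smul, normSq_smul, ← add_mul, cIn_sq_add_cOut_sq, one_mul]
  have e2 : ((∫ x, ‖cIn L x.2 • v₂ x + (-cOut L x.2 * angleSlope L x.2) • u x‖ ^ 2) +
      ∫ x, ‖cOut L x.2 • v₂ x + (cIn L x.2 * angleSlope L x.2) • u x‖ ^ 2) =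
      (∫ x, ‖v₂ x‖ ^ 2) + ∫ x, angleSlope L x.2 ^ 2 * ‖u x‖ ^ 2 := by
    rw [← integral_add (integrable_sq hi.memLp₂) (integrable_sq ho.memLp₂),
      ← integral_add (integrable_sq h.memLp₂) (integrable_slope_sq h.memLp hL)]
    congr 1; ext x
    exact normSq_localize _ _ _ _ _ (cIn_sq_add_cOut_sq L x.2)
  linarith

theorem integral_sq_localize (hu : MemLp u 2 volume) (L : ℝ) :
    (∫ x, ‖cIn L x.2 • u x‖ ^ 2) + ∫ x, ‖cOut L x.2 • u x‖ ^ 2 = ∫ x, ‖u x‖ ^ 2 := by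
  have c1 : AEStronglyMeasurable (fun x : ℝ × ℝ => cIn L x.2) volume :=
    ((contDiff_cIn L).continuous.comp continuous_snd).aestronglyMeasurable
  have c2 : AEStronglyMeasurable (fun x : ℝ × ℝ => cOut L x.2) volume :=
    ((contDiff_cOut L).continuous.comp continuous_snd).aestronglyMeasurable
  rw [← integral_add (integrable_sq (memLp_bounded_smul hu c1 fun x => abs_cIn_le L x.2))
    (integrable_sq (memLp_bounded_smul hu c2 fun x => abs_cOut_le L x.2))]
  congr 1; ext x
  rw [normSq_smul, normSq_smul, ← add_mul, cIn_sq_add_cOut_sq, one_mul]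

/-- A smooth function equal to `0` for `t ≤ -L` and to `1` for `t ≥ L`. -/
def upper (L t : ℝ) : ℝ := Real.smoothTransition ((t / L + 1) / 2)

theorem contDiff_upper (L : ℝ) : ContDiff ℝ (⊤ : ℕ∞) (upper L) :=
  contDiff_smoothTransition.comp (by fun_prop)

theorem upper_eq_one (hL : 0 < L) {t : ℝ} (h : L ≤ t) : upper L t = 1 :=
  Real.smoothTransition.one_of_one_le (by
    have := (one_le_div hL).2 h; linarith)

theorem upper_eq_zero (hL : 0 < L) {t : ℝ} (h : t ≤ -L) : upper L t = 0 :=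
  Real.smoothTransition.zero_of_nonpos (by
    have : t / L ≤ -1 := by rw [div_le_iff₀ hL]; linarith
    linarith)

theorem deriv_upper_eq_zero (hL : 0 < L) {t : ℝ} (h : L < |t|) : deriv (upper L) t = 0 := by
  rcases lt_abs.1 h with h | h
  · have : upper L =ᶠ[𝓝 t] fun _ => 1 := by
      filter_upwards [lt_mem_nhds h] with s hs
      exact upper_eq_one hL hs.le
    rw [this.deriv_eq, deriv_const]
  · have : upper L =ᶠ[𝓝 t] fun _ => 0 := by
      filter_upwards [gt_mem_nhds (show t < -L by linarith)] with s hs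
      exact upper_eq_zero hL hs.le
    rw [this.deriv_eq, deriv_const]

theorem upper_nonneg (L t : ℝ) : 0 ≤ upper L t := Real.smoothTransition.nonneg _

theorem upper_le_one (L t : ℝ) : upper L t ≤ 1 := Real.smoothTransition.le_one _

/-- Away from the discontinuity line the magnetic field has intensity at least `|a|`. -/
theorem MagH1.le_of_eq_zero (h : MagH1 a u v₁ v₂) (ha : a < 0) (ha1 : -1 ≤ a) (hL : 0 < L)
    (hz : ∀ x : ℝ × ℝ, |x.2| ≤ L → u x = 0) :
    |a| * ∫ x, ‖u x‖ ^ 2 ≤ (∫ x, ‖v₁ x‖ ^ 2) + ∫ x, ‖v₂ x‖ ^ 2 := by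
  have haa : |a| ≤ 1 := by rw [abs_of_neg ha]; linarith
  have hdc : HasCompactSupport (deriv (upper L)) :=
    HasCompactSupport.intro (isCompact_Icc (a := -L) (b := L)) fun x hx => by
      apply deriv_upper_eq_zero hL
      by_contra! hcon
      exact hx ⟨(abs_le.1 hcon).1, (abs_le.1 hcon).2⟩
  obtain ⟨C, hC1, hC⟩ := exists_deriv_le (contDiff_upper L) hdc
  -- The transition of `upper` takes place where u vanishes, so splitting u into two halves costs no
  -- derivative term.
  have hdu (x : ℝ × ℝ) : deriv (upper L) x.2 • u x = 0 := by
    by_cases hx : |x.2| ≤ L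
    · rw [hz x hx, smul_zero]
    · rw [deriv_upper_eq_zero hL (not_le.1 hx), zero_smul]
  have hd : Differentiable ℝ (upper L) := (contDiff_upper L).differentiable (by simp)
  have hp := h.smul_snd (contDiff_upper L) (C := C)
    (fun t => by rw [abs_of_nonneg (upper_nonneg L t)]; exact (upper_le_one L t).trans hC1) hC
  have hm := h.smul_snd (k := fun t => 1 - upper L t) (contDiff_const.sub (contDiff_upper L))
    (C := C) (fun t => by
      rw [abs_of_nonneg (by linarith [upper_le_one L t])]; linarith [upper_nonneg L t])
    (fun t => by rw [deriv_const_sub, abs_neg]; exact hC t)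
  simp only [deriv_const_sub, neg_smul, hdu, neg_zero, add_zero] at hp hm
  -- On each half σ is constant, so the commutator inequality gives intensity 1 above and |a| below;
  -- the first is at least |a|.
  have ip := hp.abs_integral_step_le haa
  have im := hm.abs_integral_step_le haa
  have ep : ∫ x, step a x * ‖upper L x.2 • u x‖ ^ 2 = ∫ x, ‖upper L x.2 • u x‖ ^ 2 := by
    congr 1; ext x
    by_cases hx : |x.2| ≤ L
    · simp [hz x hx]
    · rcases lt_abs.1 (not_le.1 hx) with h' | h'
      · simp [step, hL.trans h']
      · simp [upper_eq_zero hL (show x.2 ≤ -L by linarith)]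
  have em : ∫ x, step a x * ‖(1 - upper L x.2) • u x‖ ^ 2 =
      a * ∫ x, ‖(1 - upper L x.2) • u x‖ ^ 2 := by
    rw [← integral_const_mul]
    congr 1; ext x
    by_cases hx : |x.2| ≤ L
    · simp [hz x hx]
    · rcases lt_abs.1 (not_le.1 hx) with h' | h'
      · simp [upper_eq_one hL h'.le]
      · simp [step, show ¬ 0 < x.2 by linarith]
  rw [ep, abs_of_nonneg (by positivity)] at ip
  rw [em, abs_mul, abs_of_nonneg (show 0 ≤ ∫ x, ‖(1 - upper L x.2) • u x‖ ^ 2 by positivity)] at im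
  have e0 : ∫ x, ‖u x‖ ^ 2 =
      (∫ x, ‖upper L x.2 • u x‖ ^ 2) + ∫ x, ‖(1 - upper L x.2) • u x‖ ^ 2 := by
    rw [← integral_add (integrable_sq hp.memLp) (integrable_sq hm.memLp)]
    congr 1; ext x
    by_cases hx : |x.2| ≤ L
    · simp [hz x hx]
    · rcases lt_abs.1 (not_le.1 hx) with h' | h'
      · simp [upper_eq_one hL h'.le]
      · simp [upper_eq_zero hL (show x.2 ≤ -L by linarith)]
  have ev {v : ℝ × ℝ → ℂ} (hv : MemLp v 2 volume)
      (hv1 : MemLp (fun x => upper L x.2 • v x) 2 volume)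
      (hv2 : MemLp (fun x => (1 - upper L x.2) • v x) 2 volume) :
      (∫ x, ‖upper L x.2 • v x‖ ^ 2) + ∫ x, ‖(1 - upper L x.2) • v x‖ ^ 2 ≤ ∫ x, ‖v x‖ ^ 2 := by
    rw [← integral_add (integrable_sq hv1) (integrable_sq hv2)]
    refine integral_mono ((integrable_sq hv1).add (integrable_sq hv2)) (integrable_sq hv)
      fun x => ?_
    simp only [normSq_smul]
    have h1 := upper_nonneg L x.2
    have h2 := upper_le_one L x.2
    have h3 : upper L x.2 ^ 2 + (1 - upper L x.2) ^ 2 ≤ 1 := by nlinarith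
    nlinarith [sq_nonneg ‖v x‖]
  have e1 := ev h.memLp₁ hp.memLp₁ hm.memLp₁
  have e2 := ev h.memLp₂ hp.memLp₂ hm.memLp₂
  have hpos : 0 ≤ ∫ x, ‖upper L x.2 • u x‖ ^ 2 := by positivity
  rw [e0]
  nlinarith

/-- Localization of the quadratic energy: the outer part is non-negative. -/
theorem MagH1.inner_quadratic_le (h : MagH1 a u v₁ v₂) (ha : a < 0) (ha1 : -1 ≤ a)
    (hb : 1 / |a| ≤ b) (hL : 0 < L) :
    b * ((∫ x, ‖cIn L x.2 • v₁ x‖ ^ 2) +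
      ∫ x, ‖cIn L x.2 • v₂ x + (-cOut L x.2 * angleSlope L x.2) • u x‖ ^ 2) -
      ∫ x, ‖cIn L x.2 • u x‖ ^ 2 ≤
    b * ((∫ x, ‖v₁ x‖ ^ 2) + ∫ x, ‖v₂ x‖ ^ 2) - (∫ x, ‖u x‖ ^ 2) +
      b * ∫ x, angleSlope L x.2 ^ 2 * ‖u x‖ ^ 2 := by
  have ha0 : 0 < |a| := abs_pos.2 ha.ne
  have hb0 : 0 < b := (one_div_pos.2 ha0).trans_le hb
  have hba : 1 ≤ b * |a| := by rwa [div_le_iff₀ ha0] at hb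
  have ho := (h.outer hL).le_of_eq_zero ha ha1 hL fun x hx => by
    simp [cOut_eq_zero hL hx]
  have h1 := h.integral_localize hL
  have h2 := integral_sq_localize h.memLp L
  have h3 : 0 ≤ ∫ x, ‖cOut L x.2 • u x‖ ^ 2 := by positivity
  have h4 := mul_le_mul_of_nonneg_left ho hb0.le
  have h5 := congrArg (b * ·) h1
  simp only [mul_add] at h4 h5 ⊢
  nlinarith

end StepGL

end

noncomputable section

namespace StepGL

variable {a b R L : ℝ} {u v₁ v₂ : ℝ × ℝ → ℂ}

/-! ### Coercivity and lower bounds for the energy -/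

theorem slope_sq_le (hL : 0 < L) (x : ℝ × ℝ) :
    angleSlope L x.2 ^ 2 ≤ (angleC / L) ^ 2 := by
  rw [← sq_abs]
  have := abs_angleSlope_le hL x.2
  gcongr

/-- For `a ∈ [-1, 0)` the magnetic quadratic form is bounded below by a positive constant. -/
theorem exists_coercive (ha : a < 0) (ha1 : -1 ≤ a) :
    ∃ c > 0, ∀ u v₁ v₂ : ℝ × ℝ → ℂ, MagH1 a u v₁ v₂ →
      c * ∫ x, ‖u x‖ ^ 2 ≤ (∫ x, ‖v₁ x‖ ^ 2) + ∫ x, ‖v₂ x‖ ^ 2 := by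
  have ha0 : 0 < |a| := abs_pos.2 ha.ne
  -- With m = ‖u‖² and q the form, the inner mass and the localization error are bounded by
  -- multiples of the weighted mass P ≤ π√m√q, and the outer mass by (q + 5 `angleC`² P)/|a|. In sum
  -- m ≤ K√m√q + q/|a|.
  set K : ℝ := 5 * Real.pi * (1 + angleC ^ 2 / |a|) with hK
  have hK0 : 0 < K := by
    have := Real.pi_pos
    positivity
  refine ⟨1 / (K ^ 2 + 2 / |a|), by positivity, fun u v₁ v₂ h => ?_⟩
  set m := ∫ x, ‖u x‖ ^ 2 with hm
  set q := (∫ x, ‖v₁ x‖ ^ 2) + ∫ x, ‖v₂ x‖ ^ 2 with hq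
  have hv10 : 0 ≤ ∫ x, ‖v₁ x‖ ^ 2 := by positivity
  have hm0 : 0 ≤ m := by positivity
  have hq0 : 0 ≤ q := by positivity
  set P := ∫ x : ℝ × ℝ, (1 + x.2 ^ 2)⁻¹ * ‖u x‖ ^ 2 with hP
  have hPi : Integrable fun x : ℝ × ℝ => (1 + x.2 ^ 2)⁻¹ * ‖u x‖ ^ 2 :=
    integrable_bdd_mul_sq h.memLp measurable_weight abs_weight_le
  have hPle : P ≤ Real.pi * (√m * √q) := by
    refine h.integral_weight_le.trans ?_
    have := Real.pi_pos
    gcongr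
    linarith
  have hw (x : ℝ × ℝ) (hx : |x.2| < 2) : 1 ≤ 5 * (1 + x.2 ^ 2)⁻¹ := by
    rw [← div_eq_mul_inv, le_div_iff₀ (by positivity)]
    nlinarith [sq_abs x.2, abs_nonneg x.2]
  have hi := h.inner one_pos
  have ho := h.outer one_pos
  have s1 : ∫ x, ‖cIn 1 x.2 • u x‖ ^ 2 ≤ 5 * P := by
    rw [hP, ← integral_const_mul]
    refine integral_mono (integrable_sq hi.memLp) (hPi.const_mul 5) fun x => ?_
    simp only [normSq_smul, ← mul_assoc]
    gcongr
    by_cases hx : |x.2| < 2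
    · refine le_trans ?_ (hw x hx)
      rw [← sq_abs]
      exact pow_le_one₀ (abs_nonneg _) (abs_cIn_le _ _)
    · rw [cIn_eq_zero one_pos (by linarith [not_lt.1 hx]), zero_pow two_ne_zero]
      positivity
  have s2 : ∫ x, angleSlope 1 x.2 ^ 2 * ‖u x‖ ^ 2 ≤ angleC ^ 2 * (5 * P) := by
    rw [hP, ← integral_const_mul, ← integral_const_mul]
    refine integral_mono (integrable_slope_sq h.memLp one_pos) ((hPi.const_mul 5).const_mul _)
      fun x => ?_
    simp only
    by_cases hx : |x.2| < 2
    · have h1 := slope_sq_le one_pos x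
      rw [div_one] at h1
      calc _ ≤ angleC ^ 2 * (1 * ‖u x‖ ^ 2) := by rw [one_mul]; gcongr
        _ ≤ angleC ^ 2 * ((5 * (1 + x.2 ^ 2)⁻¹) * ‖u x‖ ^ 2) := by
            gcongr
            exact hw x hx
        _ = _ := by ring
    · rw [angleSlope_eq_zero one_pos (by linarith [not_lt.1 hx])]
      simp only [ne_eq, OfNat.ofNat_ne_zero, not_false_eq_true, zero_pow, zero_mul]
      positivity
  have s3 := ho.le_of_eq_zero ha ha1 one_pos fun x hx => by simp [cOut_eq_zero one_pos hx]
  have s4 := h.integral_localize one_pos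
  have s5 := integral_sq_localize h.memLp 1
  have s6 : 0 ≤ (∫ x, ‖cIn 1 x.2 • v₁ x‖ ^ 2) +
      ∫ x, ‖cIn 1 x.2 • v₂ x + (-cOut 1 x.2 * angleSlope 1 x.2) • u x‖ ^ 2 := by positivity
  have s7 : |a| * ∫ x, ‖cOut 1 x.2 • u x‖ ^ 2 ≤ q + angleC ^ 2 * (5 * P) := by linarith
  have s8 : ∫ x, ‖cOut 1 x.2 • u x‖ ^ 2 ≤ (q + angleC ^ 2 * (5 * P)) / |a| := by
    rwa [le_div_iff₀ ha0, mul_comm]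
  have s9 : m ≤ K * (√m * √q) + q / |a| := by
    have e : K * (√m * √q) = 5 * (1 + angleC ^ 2 / |a|) * (Real.pi * (√m * √q)) := by
      rw [hK]; ring
    have h1 : 5 * (1 + angleC ^ 2 / |a|) * P ≤ K * (√m * √q) := by
      rw [e]; gcongr
    have h2 : (q + angleC ^ 2 * (5 * P)) / |a| = q / |a| + 5 * (angleC ^ 2 / |a|) * P := by
      field_simp
    nlinarith
  -- Young's inequality absorbs half of m into the left-hand side, leaving m ≤ (K² + 2/|a|) q.
  have s10 : K * (√m * √q) ≤ m / 2 + K ^ 2 * q / 2 := by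
    have e1 := Real.sq_sqrt hm0
    have e2 := Real.sq_sqrt hq0
    nlinarith [sq_nonneg (√m - K * √q)]
  rw [one_div, inv_mul_le_iff₀ (by positivity)]
  have : (K ^ 2 + 2 / |a|) * q = K ^ 2 * q + 2 * (q / |a|) := by ring
  linarith

/-- The box `(-R/2, R/2) × (-2L, 2L)`. -/
def box (R L : ℝ) : Set (ℝ × ℝ) := Ioo (-R / 2) (R / 2) ×ˢ Ioo (-(2 * L)) (2 * L)

theorem volume_box (hR : 0 < R) (L : ℝ) : volume (box R L) = ENNReal.ofReal (4 * R * L) := by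
  rw [box, Measure.volume_eq_prod, Measure.prod_prod, Real.volume_Ioo, Real.volume_Ioo,
    ← ENNReal.ofReal_mul (by linarith)]
  congr 1; ring

theorem mem_box_of (hx1 : ∀ x, x ∉ strip R → u x = 0) {x : ℝ × ℝ} (hx : x ∉ box R L) :
    u x = 0 ∨ 2 * L ≤ |x.2| := by
  by_cases h : x ∈ strip R
  · right
    by_contra! h'
    exact hx ⟨h.1, by linarith [(abs_lt.1 h').1], (abs_lt.1 h').2⟩
  · exact Or.inl (hx1 x h)

/-- Pointwise |u|² ≤ s|u|⁴ + 1/(4s), integrated over a box of area 4RL. The free parameter s decides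
how much of the quartic energy is spent. -/
theorem integral_box_sq_le (hu : MemLp u 2 volume) (hq : Integrable fun x => ‖u x‖ ^ 4)
    (hR : 0 < R) (hL : 0 < L) {s : ℝ} (hs : 0 < s) :
    ∫ x in box R L, ‖u x‖ ^ 2 ≤ s * (∫ x, ‖u x‖ ^ 4) + 1 / s * (R * L) := by
  have hv : volume (box R L) ≠ ⊤ := by rw [volume_box hR L]; exact ENNReal.ofReal_ne_top
  have hfin : IsFiniteMeasure (volume.restrict (box R L)) :=
    ⟨by rw [Measure.restrict_apply_univ]; exact lt_top_iff_ne_top.2 hv⟩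
  have i1 : Integrable (fun x => s * ‖u x‖ ^ 4) (volume.restrict (box R L)) :=
    (hq.const_mul s).integrableOn
  calc ∫ x in box R L, ‖u x‖ ^ 2 ≤ ∫ x in box R L, (s * ‖u x‖ ^ 4 + 1 / (4 * s)) := by
        refine integral_mono (integrable_sq hu).integrableOn (i1.add (integrable_const _))
          fun x => ?_
        simp only
        have : s * ‖u x‖ ^ 4 + 1 / (4 * s) - ‖u x‖ ^ 2 = s * (‖u x‖ ^ 2 - 1 / (2 * s)) ^ 2 := by
          field_simp; ring
        have : 0 ≤ s * (‖u x‖ ^ 2 - 1 / (2 * s)) ^ 2 := by positivity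
        linarith
    _ = s * (∫ x in box R L, ‖u x‖ ^ 4) + 1 / s * (R * L) := by
        rw [integral_add i1 (integrable_const _), integral_const_mul, integral_const]
        simp only [smul_eq_mul]
        rw [Measure.real, Measure.restrict_apply_univ, volume_box hR L, ENNReal.toReal_ofReal (by positivity)]
        field_simp
    _ ≤ _ := by
        gcongr ?_ + _
        exact mul_le_mul_of_nonneg_left
          (setIntegral_le_integral hq (.of_forall fun x => by positivity)) hs.le

theorem integral_mul_sq_le_box {k : ℝ × ℝ → ℝ} {C : ℝ} (hu : MemLp u 2 volume)
    (hk : ∀ x, k x ≤ C) (hki : Integrable fun x => k x * ‖u x‖ ^ 2)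
    (hz : ∀ x, x ∉ box R L → k x * ‖u x‖ ^ 2 = 0) :
    ∫ x, k x * ‖u x‖ ^ 2 ≤ C * ∫ x in box R L, ‖u x‖ ^ 2 := by
  rw [← setIntegral_eq_integral_of_forall_compl_eq_zero hz, ← integral_const_mul]
  refine integral_mono hki.integrableOn ((integrable_sq hu).integrableOn.const_mul C) fun x => ?_
  simp only
  gcongr
  exact hk x

theorem Adm.slope_le_box (h : Adm a R u v₁ v₂) (hL : 0 < L) :
    ∫ x, angleSlope L x.2 ^ 2 * ‖u x‖ ^ 2 ≤ (angleC / L) ^ 2 * ∫ x in box R L, ‖u x‖ ^ 2 := by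
  refine integral_mul_sq_le_box h.mag.memLp (slope_sq_le hL) (integrable_slope_sq h.mag.memLp hL)
    fun x hx => ?_
  rcases mem_box_of (fun x hx => (h.eq_zero x hx).1) hx with h' | h'
  · simp [h']
  · simp [angleSlope_eq_zero hL h']

theorem Adm.inner_sq_le_box (h : Adm a R u v₁ v₂) (hL : 0 < L) :
    ∫ x, ‖cIn L x.2 • u x‖ ^ 2 ≤ ∫ x in box R L, ‖u x‖ ^ 2 := by
  have hi := integrable_sq (h.mag.inner hL).memLp
  simp only [normSq_smul] at hi ⊢
  refine (integral_mul_sq_le_box (R := R) (L := L) (C := 1) h.mag.memLp (fun x => ?_) hi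
    fun x hx => ?_).trans_eq (one_mul _)
  · rw [← sq_abs]
    exact pow_le_one₀ (abs_nonneg _) (abs_cIn_le _ _)
  · rcases mem_box_of (fun x hx => (h.eq_zero x hx).1) hx with h' | h'
    · simp [h']
    · simp [cIn_eq_zero hL h']

/-- A universal constant. -/
def lowerC : ℝ := 16 * angleC ^ 4

theorem lowerC_ge : 16 ≤ lowerC := by
  have := one_le_pow₀ one_le_angleC (n := 4)
  unfold lowerC; linarith

theorem one_le_of_inv_abs_le (ha0 : a ≠ 0) (ha : |a| ≤ 1) (hb : 1 / |a| ≤ b) : 1 ≤ b :=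
  ((one_le_div (abs_pos.2 ha0)).2 ha).trans hb

theorem abs_le_one_of_neg (ha : a < 0) (ha1 : -1 ≤ a) : |a| ≤ 1 := by
  rw [abs_of_neg ha]; linarith

/-- The energy controls the quartic term up to a multiple of `b² R`. -/
theorem Adm.lower_bound (h : Adm a R u v₁ v₂) (ha : a < 0) (ha1 : -1 ≤ a) (hb : 1 / |a| ≤ b)
    (hR : 0 < R) : (1 / 4) * (∫ x, ‖u x‖ ^ 4) - lowerC * b ^ 2 * R ≤ glE b u v₁ v₂ := by
  have hb1 : 1 ≤ b := one_le_of_inv_abs_le ha.ne (abs_le_one_of_neg ha ha1) hb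
  have h1 := h.mag.inner_quadratic_le ha ha1 hb one_pos
  have h2 := h.slope_le_box one_pos
  have h3 := h.inner_sq_le_box one_pos
  have h4 : 0 ≤ (∫ x, ‖cIn 1 x.2 • v₁ x‖ ^ 2) +
      ∫ x, ‖cIn 1 x.2 • v₂ x + (-cOut 1 x.2 * angleSlope 1 x.2) • u x‖ ^ 2 := by positivity
  -- The negative part of the energy is at most c times the mass B in the box: the inner mass
  -- contributes 1, the localization error at scale 1 contributes b `angleC`². Taking s = 1/(4c)
  -- then uses only half of the quartic term.
  set c : ℝ := 1 + b * angleC ^ 2 with hc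
  have hc0 : 0 < c := by positivity
  have h5 := integral_box_sq_le h.mag.memLp h.quartic hR one_pos (s := 1 / (4 * c)) (by positivity)
  set B := ∫ x in box R 1, ‖u x‖ ^ 2
  rw [div_one] at h2
  have h6 : c * B ≤ (1 / 4) * (∫ x, ‖u x‖ ^ 4) + 4 * c ^ 2 * R := by
    calc c * B ≤ c * (1 / (4 * c) * (∫ x, ‖u x‖ ^ 4) + 1 / (1 / (4 * c)) * (R * 1)) := by gcongr
      _ = _ := by field_simp
  have h7 : 4 * c ^ 2 * R ≤ lowerC * b ^ 2 * R := by
    have hA : 1 ≤ b * angleC ^ 2 := by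
      have := one_le_pow₀ one_le_angleC (n := 2)
      nlinarith
    have : c ^ 2 ≤ (2 * (b * angleC ^ 2)) ^ 2 := by
      gcongr; rw [hc]; linarith
    rw [lowerC]
    have e : 16 * angleC ^ 4 * b ^ 2 * R = 4 * (2 * (b * angleC ^ 2)) ^ 2 * R := by ring
    rw [e]; gcongr
  have h8 : b * ∫ x, angleSlope 1 x.2 ^ 2 * ‖u x‖ ^ 2 ≤ b * (angleC ^ 2 * B) := by gcongr
  have h9 := mul_nonneg (zero_le_one.trans hb1) h4
  have h10 : c * B = B + b * (angleC ^ 2 * B) := by rw [hc]; ring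
  unfold glE
  linarith

theorem energyValues_bddBelow_of_neg (ha : a < 0) (ha1 : -1 ≤ a) (hb : 1 / |a| ≤ b) (hR : 0 < R) :
    -(lowerC * b ^ 2 * R) ∈ lowerBounds (energyValues a b R) := by
  intro E hE
  obtain ⟨u, v₁, v₂, h, rfl⟩ := mem_energyValues_iff.1 hE
  have := h.lower_bound ha ha1 hb hR
  have : 0 ≤ ∫ x, ‖u x‖ ^ 4 := by positivity
  linarith

theorem glE_nonneg_of_form {lam : ℝ} (hb : 0 ≤ b) (hlam : 1 ≤ b * lam)
    (h : lam * ∫ x, ‖u x‖ ^ 2 ≤ (∫ x, ‖v₁ x‖ ^ 2) + ∫ x, ‖v₂ x‖ ^ 2) : 0 ≤ glE b u v₁ v₂ := by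
  have h1 := mul_le_mul_of_nonneg_left h hb
  have h2 : 0 ≤ ∫ x, ‖u x‖ ^ 2 := by positivity
  have h3 : 0 ≤ ∫ x, ‖u x‖ ^ 4 := by positivity
  unfold glE
  nlinarith

theorem energyValues_nonneg_of_pos (ha : 0 < a) (ha1 : a < 1) (hb : 1 / |a| ≤ b) :
    0 ∈ lowerBounds (energyValues a b R) := by
  intro E hE
  obtain ⟨u, v₁, v₂, h, rfl⟩ := mem_energyValues_iff.1 hE
  rw [abs_of_pos ha] at hb
  have hb0 : 0 < b := (one_div_pos.2 ha).trans_le hb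
  refine glE_nonneg_of_form hb0.le ?_ (h.mag.le_of_pos ha ha1.le)
  rwa [div_le_iff₀ ha] at hb

end StepGL

end

noncomputable section

namespace StepGL

variable {a : ℝ} {u v₁ v₂ : ℝ × ℝ → ℂ}

/-! ### The bottom of the spectrum -/

theorem isWeakMagGrad_iff (hu : MemLp u 2 volume) (h₁ : MemLp v₁ 2 volume)
    (h₂ : MemLp v₂ 2 volume) : IsWeakMagGrad a univ u v₁ v₂ ↔ MagH1 a u v₁ v₂ := by
  have lu := hu.locallyIntegrable (by norm_num)
  have l1 := h₁.locallyIntegrable (by norm_num)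
  have l2 := h₂.locallyIntegrable (by norm_num)
  have key {φ : ℝ × ℝ → ℝ} (hφ : IsTest φ) :
      ((∫ x, φ x • v₁ x =
        ∫ x, (-(d1 φ x • u x) - φ x • (Complex.I * (pot a x : ℂ) * u x))) ↔
        ∫ x, (d1 φ x • u x + φ x • (v₁ x + Complex.I * (pot a x : ℂ) * u x)) = 0) ∧
      ((∫ x, φ x • v₂ x = ∫ x, -(d2 φ x • u x)) ↔ ∫ x, (d2 φ x • u x + φ x • v₂ x) = 0) := by
    constructor
    · have i1 : Integrable fun x => -(d1 φ x • u x) - φ x • (Complex.I * (pot a x : ℂ) * u x) :=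
        (integrable_smul_of_compact lu hφ.continuous_d1 hφ.hasCompactSupport_d1).neg.sub
          (integrable_smul_of_compact (locallyIntegrable_pot_mul a lu) hφ.continuous hφ.2)
      rw [← sub_eq_zero, ← integral_sub (integrable_smul_of_compact l1 hφ.continuous hφ.2) i1]
      refine Eq.congr ?_ rfl
      congr 1; ext x
      simp only [Complex.real_smul]; ring
    · have i2 : Integrable fun x => -(d2 φ x • u x) :=
        (integrable_smul_of_compact lu hφ.continuous_d2 hφ.hasCompactSupport_d2).neg
      rw [← sub_eq_zero, ← integral_sub (integrable_smul_of_compact l2 hφ.continuous hφ.2) i2]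
      refine Eq.congr ?_ rfl
      congr 1; ext x
      simp only [Complex.real_smul]; ring
  constructor
  · intro h
    refine ⟨hu, h₁, h₂, fun φ hφ => (key hφ).1.1 ?_, fun φ hφ => (key hφ).2.1 ?_⟩
    · simpa using (h φ hφ (subset_univ _)).1
    · simpa using (h φ hφ (subset_univ _)).2
  · intro h φ hφ _
    simp only [Measure.restrict_univ]
    exact ⟨(key hφ).1.2 (h.weak₁ φ hφ), (key hφ).2.2 (h.weak₂ φ hφ)⟩

theorem MagH1.congr {u' v₁' v₂' : ℝ × ℝ → ℂ} (h : MagH1 a u v₁ v₂) (h0 : u =ᵐ[volume] u')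
    (h1 : v₁ =ᵐ[volume] v₁') (h2 : v₂ =ᵐ[volume] v₂') : MagH1 a u' v₁' v₂' where
  memLp := h.memLp.ae_eq h0
  memLp₁ := h.memLp₁.ae_eq h1
  memLp₂ := h.memLp₂.ae_eq h2
  weak₁ φ hφ := by
    rw [← h.weak₁ φ hφ]
    refine integral_congr_ae ?_
    filter_upwards [h0, h1] with x e0 e1
    rw [e0, e1]
  weak₂ φ hφ := by
    rw [← h.weak₂ φ hφ]
    refine integral_congr_ae ?_
    filter_upwards [h0, h2] with x e0 e2
    rw [e0, e2]

theorem IsTest.isCTest {φ : ℝ × ℝ → ℝ} (h : IsTest φ) : IsCTest fun x => (φ x : ℂ) :=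
  ⟨Complex.ofRealCLM.contDiff.comp h.1, h.2.comp_left (g := Complex.ofReal) rfl⟩

theorem IsTest.fderiv_ofReal {φ : ℝ × ℝ → ℝ} (h : IsTest φ) (x e : ℝ × ℝ) :
    fderiv ℝ (fun x => (φ x : ℂ)) x e = (fderiv ℝ φ x e : ℂ) := by
  have : HasFDerivAt (fun x => (φ x : ℂ)) (Complex.ofRealCLM.comp (fderiv ℝ φ x)) x :=
    Complex.ofRealCLM.hasFDerivAt.comp x (h.differentiable x).hasFDerivAt
  rw [this.fderiv]; rfl

theorem IsTest.mag1_ofReal {φ : ℝ × ℝ → ℝ} (h : IsTest φ) (x : ℝ × ℝ) :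
    mag1 a (fun x => (φ x : ℂ)) x = d1 φ x - Complex.I * pot a x * φ x := by
  rw [mag1, h.fderiv_ofReal]; rfl

theorem IsTest.mag2_ofReal {φ : ℝ × ℝ → ℝ} (h : IsTest φ) (x : ℝ × ℝ) :
    mag2 (fun x => (φ x : ℂ)) x = d2 φ x := by
  rw [mag2, h.fderiv_ofReal]; rfl

theorem inner_toLp {f : ℝ × ℝ → ℂ} (hf : MemLp f 2 volume) (g : L2) :
    inner ℂ (hf.toLp f) g = ∫ x, (starRingEnd ℂ) (f x) * g x := by
  rw [L2.inner_def]
  refine integral_congr_ae ?_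
  filter_upwards [hf.coeFn_toLp] with x hx
  rw [hx, RCLike.inner_apply, mul_comm]

theorem integrable_conj_mul {f : ℝ × ℝ → ℂ} (hf : MemLp f 2 volume) {g : ℝ × ℝ → ℂ}
    (hg : MemLp g 2 volume) : Integrable fun x => (starRingEnd ℂ) (f x) * g x :=
  MemLp.integrable_mul (p := 2) (q := 2) hf.star hg

theorem norm_toLp_sq {f : ℝ × ℝ → ℂ} (hf : MemLp f 2 volume) :
    ‖hf.toLp f‖ ^ 2 = ∫ x, ‖f x‖ ^ 2 := by
  have h1 := inner_self_eq_norm_sq_to_K (𝕜 := ℂ) (hf.toLp f)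
  rw [L2.inner_def] at h1
  have h2 : ∫ x, inner ℂ ((hf.toLp f) x) ((hf.toLp f) x) = ((∫ x, ‖f x‖ ^ 2 : ℝ) : ℂ) := by
    rw [← integral_complex_ofReal]
    refine integral_congr_ae ?_
    filter_upwards [hf.coeFn_toLp] with x hx
    rw [hx, inner_self_eq_norm_sq_to_K]
    simp
  rw [h2] at h1
  exact (Complex.ofReal_injective (by push_cast; simpa using h1)).symm

theorem norm_sq_L2 (f : L2) : ‖f‖ ^ 2 = ∫ x, ‖f x‖ ^ 2 := by
  have := norm_toLp_sq (Lp.memLp f)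
  rwa [Lp.toLp_coeFn] at this

/-- Three copies of `L²`. -/
abbrev H3 : Type := PiLp 2 fun _ : Fin 3 => L2

def mk3 (f g h : L2) : H3 := WithLp.toLp 2 ![f, g, h]

theorem inner_H3 (x y : H3) :
    inner ℂ x y = inner ℂ (x 0) (y 0) + inner ℂ (x 1) (y 1) + inner ℂ (x 2) (y 2) := by
  rw [PiLp.inner_apply, Fin.sum_univ_three]

theorem norm_sq_H3 (x : H3) : ‖x‖ ^ 2 = ‖x 0‖ ^ 2 + ‖x 1‖ ^ 2 + ‖x 2‖ ^ 2 := by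
  rw [PiLp.norm_sq_eq_of_L2, Fin.sum_univ_three]

@[simp] theorem mk3_zero (f g h : L2) : mk3 f g h 0 = f := rfl
@[simp] theorem mk3_one (f g h : L2) : mk3 f g h 1 = g := rfl
@[simp] theorem mk3_two (f g h : L2) : mk3 f g h 2 = h := rfl

/-- The vectors whose orthogonal complement encodes the weak magnetic gradient. -/
def gradTests (a : ℝ) : Set H3 :=
  {w | ∃ (φ : ℝ × ℝ → ℝ) (hφ : IsTest φ),
    w = mk3 ((hφ.isCTest.magH1 a).memLp₁.toLp _) ((hφ.isCTest.magH1 a).memLp.toLp _) 0 ∨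
    w = mk3 ((hφ.isCTest.magH1 a).memLp₂.toLp _) 0 ((hφ.isCTest.magH1 a).memLp.toLp _)}

/-- The form domain as a closed subspace of `L² × L² × L²`. -/
def formDomain (a : ℝ) : Submodule ℂ H3 := (Submodule.span ℂ (gradTests a))ᗮ

/-- Conjugation in the first slot turns `mag1 a φ` into ∂₁φ + i(pot)φ, so orthogonality to
`gradTests` is the pair of weak identities. An orthogonal complement is closed, which gives
completeness of the form domain. -/
theorem mem_formDomain_iff {U : H3} : U ∈ formDomain a ↔ MagH1 a (U 0) (U 1) (U 2) := by
  have key {φ : ℝ × ℝ → ℝ} (hφ : IsTest φ) :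
      (inner ℂ (mk3 ((hφ.isCTest.magH1 a).memLp₁.toLp _) ((hφ.isCTest.magH1 a).memLp.toLp _) 0) U =
        ∫ x, (d1 φ x • U 0 x + φ x • (U 1 x + Complex.I * (pot a x : ℂ) * U 0 x))) ∧
      (inner ℂ (mk3 ((hφ.isCTest.magH1 a).memLp₂.toLp _) 0 ((hφ.isCTest.magH1 a).memLp.toLp _)) U =
        ∫ x, (d2 φ x • U 0 x + φ x • U 2 x)) := by
    have hm := hφ.isCTest.magH1 a
    constructor
    · rw [inner_H3]
      simp only [mk3_zero, mk3_one, mk3_two, inner_zero_left, add_zero]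
      rw [inner_toLp, inner_toLp, ← integral_add (integrable_conj_mul hm.memLp₁ (Lp.memLp _))
        (integrable_conj_mul hm.memLp (Lp.memLp _))]
      congr 1; ext x
      rw [hφ.mag1_ofReal]
      simp
      ring
    · rw [inner_H3]
      simp only [mk3_zero, mk3_one, mk3_two, inner_zero_left, add_zero]
      rw [inner_toLp, inner_toLp, ← integral_add (integrable_conj_mul hm.memLp₂ (Lp.memLp _))
        (integrable_conj_mul hm.memLp (Lp.memLp _))]
      congr 1; ext x
      rw [hφ.mag2_ofReal]
      simp
  constructor
  · intro h
    rw [formDomain, Submodule.mem_orthogonal] at h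
    refine ⟨Lp.memLp _, Lp.memLp _, Lp.memLp _, fun φ hφ => ?_, fun φ hφ => ?_⟩
    · rw [← (key hφ).1]
      exact h _ (Submodule.subset_span ⟨φ, hφ, Or.inl rfl⟩)
    · rw [← (key hφ).2]
      exact h _ (Submodule.subset_span ⟨φ, hφ, Or.inr rfl⟩)
  · intro h
    rw [formDomain, Submodule.mem_orthogonal]
    intro w hw
    induction hw using Submodule.span_induction with
    | mem w hw =>
      obtain ⟨φ, hφ, rfl | rfl⟩ := hw
      · rw [(key hφ).1, h.weak₁ φ hφ]
      · rw [(key hφ).2, h.weak₂ φ hφ]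
    | zero => simp
    | add x y _ _ hx hy => rw [inner_add_left, hx, hy, add_zero]
    | smul c x _ hx => rw [inner_smul_left, hx, mul_zero]

theorem MagH1.mem_formDomain (h : MagH1 a u v₁ v₂) :
    mk3 (h.memLp.toLp u) (h.memLp₁.toLp v₁) (h.memLp₂.toLp v₂) ∈ formDomain a :=
  mem_formDomain_iff.2 (h.congr h.memLp.coeFn_toLp.symm h.memLp₁.coeFn_toLp.symm
    h.memLp₂.coeFn_toLp.symm)

/-- The element of the form domain given by a magnetic Sobolev function. -/
def MagH1.vec (h : MagH1 a u v₁ v₂) : formDomain a :=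
  ⟨mk3 (h.memLp.toLp u) (h.memLp₁.toLp v₁) (h.memLp₂.toLp v₂), h.mem_formDomain⟩

instance (a : ℝ) : CompleteSpace (formDomain a) := by
  unfold formDomain; infer_instance

/-- The embedding of the form domain into `L²`. -/
def embed (a : ℝ) : formDomain a →L[ℂ] L2 :=
  (PiLp.proj 2 (fun _ : Fin 3 => L2) 0 : H3 →L[ℂ] L2) ∘L (formDomain a).subtypeL

theorem embed_apply (U : formDomain a) : embed a U = U.1 0 := rfl

/-- The resolvent of the Hamiltonian at `-1`. -/
def resolvent (a : ℝ) : L2 →L[ℂ] L2 := embed a ∘L ContinuousLinearMap.adjoint (embed a)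

theorem tendsto_toLp {F : ℕ → ℝ × ℝ → ℂ} (hF : ∀ n, MemLp (F n) 2 volume) (f : L2)
    (h : Tendsto (fun n => ∫ x, ‖F n x - f x‖ ^ 2) atTop (𝓝 0)) :
    Tendsto (fun n => (hF n).toLp (F n)) atTop (𝓝 f) := by
  rw [tendsto_iff_norm_sub_tendsto_zero]
  have h1 (n : ℕ) : ‖(hF n).toLp (F n) - f‖ = √(∫ x, ‖F n x - f x‖ ^ 2) := by
    have e : (hF n).toLp (F n) - f = ((hF n).sub (Lp.memLp f)).toLp _ := by
      rw [MemLp.toLp_sub (hF n) (Lp.memLp f), Lp.toLp_coeFn]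
    rw [← Real.sqrt_sq (norm_nonneg ((hF n).toLp (F n) - f)), e, norm_toLp_sq]
    rfl
  simp only [h1]
  simpa using h.sqrt

/-- Density of test functions in the graph norm. It extends the weak equation for the Hamiltonian
from test functions to all of the form domain. -/
theorem formDomain_induction {U : H3} (hU : U ∈ formDomain a) (ℓ : H3 → ℂ) (hℓ : Continuous ℓ)
    (h : ∀ ϕ : ℝ × ℝ → ℂ, ∀ hϕ : IsCTest ϕ, ℓ (hϕ.magH1 a).vec.1 = 0) : ℓ U = 0 := by
  obtain ⟨ϕ, hϕ, l0, l1, l2⟩ := (mem_formDomain_iff.1 hU).exists_test_seq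
  have hm (n : ℕ) := (hϕ n).magH1 a
  have hlim : Tendsto (fun n => (hm n).vec.1) atTop (𝓝 U) := by
    have t : Tendsto (fun n => (WithLp.ofLp (hm n).vec.1 : Fin 3 → L2)) atTop
        (𝓝 (WithLp.ofLp U)) := by
      rw [tendsto_pi_nhds]
      intro i
      fin_cases i
      · exact tendsto_toLp (fun n => (hm n).memLp) _ l0
      · exact tendsto_toLp (fun n => (hm n).memLp₁) _ l1
      · exact tendsto_toLp (fun n => (hm n).memLp₂) _ l2
    exact ((PiLp.continuous_toLp 2 (fun _ : Fin 3 => L2)).tendsto _).comp t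
  have h2 := (hℓ.tendsto U).comp hlim
  simp only [Function.comp_def] at h2
  refine tendsto_nhds_unique h2 ?_
  simp only [h _ (hϕ _)]
  exact tendsto_const_nhds

end StepGL

end

/-! ### The Hamiltonian as the operator of its form, and β as the infimum of the form -/

noncomputable section

namespace StepGL

variable {a : ℝ} {u v₁ v₂ : ℝ × ℝ → ℂ}

/-- The weak divergence tested against complex test functions. -/
theorem inner_of_isWeakMagNegDiv {g w₁ w₂ : L2} (h : IsWeakMagNegDiv a w₁ w₂ g)
    {ϕ : ℝ × ℝ → ℂ} (hϕ : IsCTest ϕ) :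
    inner ℂ ((hϕ.magH1 a).memLp.toLp ϕ) g =
      inner ℂ ((hϕ.magH1 a).memLp₁.toLp _) w₁ + inner ℂ ((hϕ.magH1 a).memLp₂.toLp _) w₂ := by
  have hre := hϕ.isTest_re
  have him := hϕ.isTest_im
  have hm := hϕ.magH1 a
  have hl {f : L2} : LocallyIntegrable f volume := (Lp.memLp f).locallyIntegrable (by norm_num)
  have i0 {φ : ℝ × ℝ → ℝ} (hφ : IsTest φ) : Integrable fun x => φ x • g x :=
    integrable_smul_of_compact hl hφ.continuous hφ.2
  have i1 {φ : ℝ × ℝ → ℝ} (hφ : IsTest φ) : Integrable fun x =>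
      d1 φ x • w₁ x + φ x • (Complex.I * (pot a x : ℂ) * w₁ x) + d2 φ x • w₂ x :=
    ((integrable_smul_of_compact hl hφ.continuous_d1 hφ.hasCompactSupport_d1).add
      (integrable_smul_of_compact (locallyIntegrable_pot_mul a hl) hφ.continuous hφ.2)).add
      (integrable_smul_of_compact hl hφ.continuous_d2 hφ.hasCompactSupport_d2)
  rw [inner_toLp, inner_toLp, inner_toLp, ← integral_add (integrable_conj_mul hm.memLp₁
    (Lp.memLp _)) (integrable_conj_mul hm.memLp₂ (Lp.memLp _))]
  calc ∫ x, (starRingEnd ℂ) (ϕ x) * g x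
      = ∫ x, ((ϕ x).re • g x - Complex.I * ((ϕ x).im • g x)) := by
        congr 1; ext x
        have : (starRingEnd ℂ) (ϕ x) = (ϕ x).re - Complex.I * (ϕ x).im := by
          apply Complex.ext <;> simp
        rw [this]; simp only [Complex.real_smul]; ring
    _ = _ := by
        rw [integral_sub (i0 hre) ((i0 him).const_mul _), integral_const_mul, h _ hre, h _ him,
          ← integral_const_mul, ← integral_sub (i1 hre) ((i1 him).const_mul _)]
        congr 1; ext x
        have e1 : (starRingEnd ℂ) (mag1 a ϕ x) = d1 (fun x => (ϕ x).re) x -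
            Complex.I * d1 (fun x => (ϕ x).im) x + Complex.I * pot a x *
            ((ϕ x).re - Complex.I * (ϕ x).im) := by
          simp only [d1, hϕ.fderiv_re, hϕ.fderiv_im, mag1]
          apply Complex.ext <;> simp
        have e2 : (starRingEnd ℂ) (mag2 ϕ x) = d2 (fun x => (ϕ x).re) x -
            Complex.I * d2 (fun x => (ϕ x).im) x := by
          simp only [d2, hϕ.fderiv_re, hϕ.fderiv_im, mag2]
          apply Complex.ext <;> simp
        rw [e1, e2]; simp only [Complex.real_smul]; ring

/-- The Hamiltonian is the operator of the magnetic quadratic form. -/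
theorem hamiltonianGraph_iff {w g : L2} : HamiltonianGraph a w g ↔ w = resolvent a (g + w) := by
  constructor
  · rintro ⟨v₁, v₂, h₁, h₂, hg, hd⟩
    have hm := (isWeakMagGrad_iff (Lp.memLp w) h₁ h₂).1 hg
    have hd' : IsWeakMagNegDiv a (h₁.toLp v₁) (h₂.toLp v₂) g := by
      intro φ hφ
      rw [hd φ hφ]
      refine integral_congr_ae ?_
      filter_upwards [h₁.coeFn_toLp, h₂.coeFn_toLp] with x e1 e2
      rw [e1, e2]
    -- J* f is the Riesz representative of W ↦ ⟨W₀, f⟩ in the graph inner product. For f = g + w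
    -- this says that the form of (W, w) is ⟨W₀, g⟩, the equation of the Hamiltonian tested against
    -- W.
    have key : ContinuousLinearMap.adjoint (embed a) (g + w) = hm.vec := by
      refine ext_inner_left ℂ fun W => ?_
      rw [ContinuousLinearMap.adjoint_inner_right, embed_apply, Submodule.coe_inner, inner_H3,
        inner_add_right]
      have h0 : inner ℂ (W.1 0) g - (inner ℂ (W.1 1) (h₁.toLp v₁) +
          inner ℂ (W.1 2) (h₂.toLp v₂)) = 0 := by
        refine formDomain_induction W.2 (fun W => inner ℂ (W 0) g - (inner ℂ (W 1) (h₁.toLp v₁) +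
          inner ℂ (W 2) (h₂.toLp v₂))) ?_ fun ϕ hϕ => ?_
        · fun_prop
        · exact sub_eq_zero.2 (inner_of_isWeakMagNegDiv hd' hϕ)
      have e0 : hm.vec.1 0 = w := Lp.toLp_coeFn w (Lp.memLp w)
      have e1 : hm.vec.1 1 = h₁.toLp v₁ := rfl
      have e2 : hm.vec.1 2 = h₂.toLp v₂ := rfl
      rw [e0, e1, e2]
      linear_combination h0
    rw [resolvent, ContinuousLinearMap.comp_apply, key]
    exact (Lp.toLp_coeFn w (Lp.memLp w)).symm
  · intro h
    -- Conversely, the last two components of J*(g + w) serve as the magnetic gradient of w; pairing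
    -- with test functions gives the divergence equation.
    set U := ContinuousLinearMap.adjoint (embed a) (g + w) with hU
    have hw : w = U.1 0 := h
    have hm := mem_formDomain_iff.1 U.2
    rw [← hw] at hm
    refine ⟨U.1 1, U.1 2, Lp.memLp _, Lp.memLp _,
      (isWeakMagGrad_iff (Lp.memLp w) (Lp.memLp _) (Lp.memLp _)).2 hm, fun φ hφ => ?_⟩
    have ht := hφ.isCTest.magH1 a
    have h1 := ContinuousLinearMap.adjoint_inner_right (embed a) ht.vec (g + w)
    rw [← hU, embed_apply, Submodule.coe_inner, inner_H3, inner_add_right, ← hw] at h1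
    have e0 : ht.vec.1 0 = ht.memLp.toLp _ := rfl
    have e1 : ht.vec.1 1 = ht.memLp₁.toLp _ := rfl
    have e2 : ht.vec.1 2 = ht.memLp₂.toLp _ := rfl
    rw [e0, e1, e2] at h1
    have h2 : inner ℂ (ht.memLp.toLp _) g = inner ℂ (ht.memLp₁.toLp _) (U.1 1) +
        inner ℂ (ht.memLp₂.toLp _) (U.1 2) := by
      linear_combination -h1
    rw [inner_toLp, inner_toLp, inner_toLp, ← integral_add (integrable_conj_mul ht.memLp₁
      (Lp.memLp _)) (integrable_conj_mul ht.memLp₂ (Lp.memLp _))] at h2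
    calc ∫ x, φ x • g x = ∫ x, (starRingEnd ℂ) (φ x : ℂ) * g x := by
          congr 1; ext x; simp
      _ = _ := by
          rw [h2]
          congr 1; ext x
          rw [hφ.mag1_ofReal, hφ.mag2_ofReal]
          simp
          ring

theorem embed_ne_zero (a : ℝ) : embed a ≠ 0 := by
  intro h0
  let B : ContDiffBump (0 : ℝ × ℝ) := ⟨1, 2, one_pos, one_lt_two⟩
  have hB : IsTest fun x => B.normed volume x := ⟨B.contDiff_normed, B.hasCompactSupport_normed⟩
  have ht := hB.isCTest.magH1 a
  have h1 : ht.memLp.toLp _ = 0 := by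
    have : embed a ht.vec = 0 := by rw [h0]; rfl
    exact this
  have h2 : (fun x => ((B.normed volume x : ℝ) : ℂ)) =ᵐ[volume] 0 := by
    have := ht.memLp.coeFn_toLp
    rw [h1] at this
    exact this.symm.trans (Lp.coeFn_zero ℂ 2 volume)
  have h3 : ∫ x, B.normed volume x = 0 := by
    refine integral_eq_zero_of_ae ?_
    filter_upwards [h2] with x hx
    simpa using hx
  rw [B.integral_normed] at h3
  exact one_ne_zero h3

theorem norm_embed_pos (a : ℝ) : 0 < ‖embed a‖ :=
  lt_of_le_of_ne (ContinuousLinearMap.opNorm_nonneg _) fun h =>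
    embed_ne_zero a ((ContinuousLinearMap.opNorm_zero_iff _).1 h.symm)

theorem inner_resolvent_self (x : L2) :
    inner ℂ (resolvent a x) x = ((‖ContinuousLinearMap.adjoint (embed a) x‖ ^ 2 : ℝ) : ℂ) := by
  rw [resolvent, ContinuousLinearMap.comp_apply, ← ContinuousLinearMap.adjoint_inner_right,
    inner_self_eq_norm_sq_to_K]
  simp

theorem norm_adjoint_embed_le (x : L2) :
    ‖ContinuousLinearMap.adjoint (embed a) x‖ ≤ ‖embed a‖ * ‖x‖ := by
  refine (ContinuousLinearMap.le_opNorm _ x).trans_eq ?_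
  rw [LinearIsometryEquiv.norm_map]

/-- The infimum of the magnetic quadratic form on normalized functions. -/
def formBottom (a : ℝ) : ℝ := 1 / ‖embed a‖ ^ 2 - 1

/-- With S = J J* and c = t + 1, the equation (𝓛 - t)w = f reads w = S(f + cw), that is (1 - cS)(f +
cw) = f and w = S(1 - cS)⁻¹f. Since ⟨(1 - cS)x, x⟩ = ‖x‖² - c‖J*x‖² and c‖J‖² < 1, the operator 1 -
cS is coercive, hence invertible. -/
theorem notMem_spectrum_of_lt {t : ℝ} (ht : t < formBottom a) :
    (t : ℂ) ∉ hamiltonianSpectrum a := by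
  have hN := norm_embed_pos a
  set N := ‖embed a‖ with hNdef
  set c : ℝ := t + 1 with hc
  have hcN : c * N ^ 2 < 1 := by
    have : c < 1 / N ^ 2 := by rw [formBottom] at ht; rw [hc]; linarith
    rwa [lt_div_iff₀ (by positivity)] at this
  let B : L2 →L[ℂ] L2 := ContinuousLinearMap.id ℂ L2 - (c : ℂ) • resolvent a
  have hBx (x : L2) : B x = x - (c : ℂ) • resolvent a x := rfl
  have hκ : 0 < min 1 (1 - c * N ^ 2) := lt_min one_pos (by linarith)
  have hB : IsUnit B := by
    refine ContinuousLinearMap.isUnit_of_forall_le_norm_inner_map B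
      (c := Real.toNNReal (min 1 (1 - c * N ^ 2))) (Real.toNNReal_pos.2 hκ) fun x => ?_
    refine le_trans ?_ (Complex.re_le_norm _)
    rw [hBx, inner_sub_left, inner_smul_left, inner_resolvent_self, inner_self_eq_norm_sq_to_K]
    have h1 := norm_adjoint_embed_le (a := a) x
    have h2 : ‖ContinuousLinearMap.adjoint (embed a) x‖ ^ 2 ≤ N ^ 2 * ‖x‖ ^ 2 := by
      rw [← mul_pow]; gcongr
    rw [Real.coe_toNNReal _ hκ.le]
    have e : (((‖x‖ : ℂ)) ^ 2 - (starRingEnd ℂ) (c : ℂ) *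
        ((‖ContinuousLinearMap.adjoint (embed a) x‖ ^ 2 : ℝ) : ℂ)).re =
        ‖x‖ ^ 2 - c * ‖ContinuousLinearMap.adjoint (embed a) x‖ ^ 2 := by
      rw [Complex.conj_ofReal]
      norm_cast
    refine le_trans ?_ (le_of_eq e.symm)
    have h3 : 0 ≤ ‖ContinuousLinearMap.adjoint (embed a) x‖ ^ 2 := by positivity
    rcases le_total c 0 with h | h
    · have : ‖x‖ ^ 2 * min 1 (1 - c * N ^ 2) ≤ ‖x‖ ^ 2 * 1 := by gcongr; exact min_le_left _ _
      nlinarith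
    · have : ‖x‖ ^ 2 * min 1 (1 - c * N ^ 2) ≤ ‖x‖ ^ 2 * (1 - c * N ^ 2) := by
        gcongr; exact min_le_right _ _
      nlinarith
  obtain ⟨B', hB'⟩ := hB
  have hl (x : L2) : (↑B'⁻¹ : L2 →L[ℂ] L2) (B x) = x := by
    have : (↑B'⁻¹ : L2 →L[ℂ] L2) * B = 1 := by rw [← hB']; exact B'.inv_mul
    exact DFunLike.congr_fun this x
  have hr (x : L2) : B ((↑B'⁻¹ : L2 →L[ℂ] L2) x) = x := by
    have : B * (↑B'⁻¹ : L2 →L[ℂ] L2) = 1 := by rw [← hB']; exact B'.mul_inv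
    exact DFunLike.congr_fun this x
  rw [hamiltonianSpectrum, mem_ofPred_eq, not_not]
  refine ⟨resolvent a ∘L (↑B'⁻¹ : L2 →L[ℂ] L2), fun f w => ?_⟩
  rw [hamiltonianGraph_iff, ContinuousLinearMap.comp_apply]
  have e : f + (t : ℂ) • w + w = f + (c : ℂ) • w := by
    rw [hc]; push_cast; rw [add_smul, one_smul, add_assoc]
  rw [e]
  constructor
  · intro h
    have h1 : B (f + (c : ℂ) • w) = f := by rw [hBx, ← h, add_sub_cancel_right]
    have h2 := hl (f + (c : ℂ) • w)
    rw [h1] at h2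
    rw [h2]; exact h
  · intro h
    have h1 := hr f
    rw [hBx, ← h, sub_eq_iff_eq_add] at h1
    rw [← h1]; exact h

/-- At c = 1/‖J‖² an inverse T would make 1 + cT a bounded right inverse of 1 - cS, so the
self-adjoint operator 1 - cS would be bounded below. It is not: vectors nearly attaining the norm of
J* are almost in its kernel. -/
theorem formBottom_mem_spectrum (a : ℝ) : (formBottom a : ℂ) ∈ hamiltonianSpectrum a := by
  rintro ⟨T, hT⟩
  have hN := norm_embed_pos a
  set N := ‖embed a‖ with hNdef
  set c : ℝ := 1 / N ^ 2 with hc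
  have hc0 : 0 < c := by positivity
  have hcN : c * N ^ 2 = 1 := by rw [hc]; field_simp
  have hTf (f : L2) : T f = resolvent a (f + (c : ℂ) • T f) := by
    have := hamiltonianGraph_iff.1 ((hT f (T f)).2 rfl)
    have e : f + (formBottom a : ℂ) • T f + T f = f + (c : ℂ) • T f := by
      rw [formBottom, ← hNdef, ← hc]; push_cast; rw [sub_smul, one_smul]; abel
    rwa [e] at this
  let Rt : L2 →L[ℂ] L2 := ContinuousLinearMap.id ℂ L2 + (c : ℂ) • T
  have hRt (f : L2) : Rt f = f + (c : ℂ) • T f := rfl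
  have hBR (f : L2) : Rt f - (c : ℂ) • resolvent a (Rt f) = f := by
    rw [hRt, ← hTf, add_sub_cancel_right]
  have hsa (x y : L2) : inner ℂ (resolvent a x) y = inner ℂ x (resolvent a y) := by
    rw [resolvent, ContinuousLinearMap.comp_apply, ContinuousLinearMap.comp_apply,
      ← ContinuousLinearMap.adjoint_inner_right, ContinuousLinearMap.adjoint_inner_left]
  set K := ‖Rt‖ with hK
  have hinv (x : L2) : ‖x‖ ≤ K * ‖x - (c : ℂ) • resolvent a x‖ := by
    by_cases hx : x = 0
    · rw [hx, norm_zero]; positivity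
    have h1 : inner ℂ x x = inner ℂ (x - (c : ℂ) • resolvent a x) (Rt x) := by
      conv_lhs => rw [← hBR x]
      nth_rw 1 [hBR x]
      rw [inner_sub_right, inner_sub_left, inner_smul_right, inner_smul_left, hsa,
        Complex.conj_ofReal]
    have h2 : ‖x‖ * ‖x‖ ≤ K * ‖x - (c : ℂ) • resolvent a x‖ * ‖x‖ := by
      calc ‖x‖ * ‖x‖ = ‖inner ℂ x x‖ := by rw [inner_self_eq_norm_sq_to_K]; simp [sq]
        _ ≤ ‖x - (c : ℂ) • resolvent a x‖ * ‖Rt x‖ := by rw [h1]; exact norm_inner_le_norm _ _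
        _ ≤ ‖x - (c : ℂ) • resolvent a x‖ * (K * ‖x‖) := by
            gcongr; exact Rt.le_opNorm x
        _ = _ := by ring
    exact le_of_mul_le_mul_right h2 (norm_pos_iff.2 hx)
  -- Any ρ < 1 with ρ > K²(1 - ρ) would do: the vector x below satisfies ρ < ‖x‖² ≤ K²(1 - ρ).
  set ρ : ℝ := (K ^ 2 + 1 / 2) / (K ^ 2 + 1) with hρ
  have hρ1 : ρ < 1 := by rw [hρ, div_lt_one (by positivity)]; linarith
  have hρ0 : 0 < ρ := by positivity
  have hlt : N * √ρ < ‖ContinuousLinearMap.adjoint (embed a)‖ := by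
    rw [LinearIsometryEquiv.norm_map]
    have : √ρ < 1 := by rw [Real.sqrt_lt' one_pos]; simpa using hρ1
    nlinarith
  obtain ⟨x, hx1, hx2⟩ := ContinuousLinearMap.exists_lt_apply_of_lt_opNorm _ hlt
  set A := ‖ContinuousLinearMap.adjoint (embed a) x‖ with hA
  have hA2 : N ^ 2 * ρ < A ^ 2 := by
    have : (N * √ρ) ^ 2 < A ^ 2 := by gcongr
    rwa [mul_pow, Real.sq_sqrt hρ0.le] at this
  have hAx : A ≤ N * ‖x‖ := norm_adjoint_embed_le x
  have hAx2 : A ^ 2 ≤ N ^ 2 * ‖x‖ ^ 2 := by rw [← mul_pow]; gcongr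
  have hS : ‖resolvent a x‖ ≤ N * A := by
    rw [resolvent, ContinuousLinearMap.comp_apply]
    exact ContinuousLinearMap.le_opNorm _ _
  have hS2 : ‖resolvent a x‖ ^ 2 ≤ N ^ 2 * A ^ 2 := by rw [← mul_pow]; gcongr
  -- Expanding the square gives ‖x‖² - 2cA² + c²‖Sx‖², and the last term is at most c²N²A² = cA².
  have hB2 : ‖x - (c : ℂ) • resolvent a x‖ ^ 2 ≤ ‖x‖ ^ 2 - c * A ^ 2 := by
    have h1 := norm_sub_sq (𝕜 := ℂ) x ((c : ℂ) • resolvent a x)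
    have h2 : RCLike.re (inner ℂ x ((c : ℂ) • resolvent a x)) = c * A ^ 2 := by
      rw [inner_smul_right, ← hsa, inner_resolvent_self, ← hA]
      norm_cast
    have h3 : ‖(c : ℂ) • resolvent a x‖ ^ 2 = c ^ 2 * ‖resolvent a x‖ ^ 2 := by
      rw [norm_smul, mul_pow, Complex.norm_real, Real.norm_eq_abs, sq_abs]
    rw [h2, h3] at h1
    have h4 : c ^ 2 * ‖resolvent a x‖ ^ 2 ≤ c ^ 2 * (N ^ 2 * A ^ 2) := by gcongr
    have h5 : c ^ 2 * (N ^ 2 * A ^ 2) = c * A ^ 2 := by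
      linear_combination c * A ^ 2 * hcN
    linarith
  have hfin : ‖x‖ ^ 2 ≤ K ^ 2 * ‖x - (c : ℂ) • resolvent a x‖ ^ 2 := by
    have := hinv x
    rw [← mul_pow]; gcongr
  have hxρ : ρ < ‖x‖ ^ 2 := by
    have : N ^ 2 * ρ < N ^ 2 * ‖x‖ ^ 2 := hA2.trans_le hAx2
    exact lt_of_mul_lt_mul_left this (by positivity)
  have hcA : ρ < c * A ^ 2 := by
    have : c * (N ^ 2 * ρ) < c * A ^ 2 := by gcongr
    rwa [← mul_assoc, hcN, one_mul] at this
  have hx1' : ‖x‖ ^ 2 ≤ 1 := pow_le_one₀ (norm_nonneg _) hx1.le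
  have h6 : K ^ 2 * ‖x - (c : ℂ) • resolvent a x‖ ^ 2 ≤ K ^ 2 * (1 - ρ) := by
    gcongr; linarith
  have h7 : ρ * (K ^ 2 + 1) = K ^ 2 + 1 / 2 := by rw [hρ]; field_simp
  nlinarith

theorem beta_eq_formBottom (a : ℝ) : beta a = formBottom a := by
  refine IsLeast.csInf_eq ⟨formBottom_mem_spectrum a, fun t ht => ?_⟩
  by_contra! h
  exact notMem_spectrum_of_lt h ht

theorem MagH1.norm_vec_sq (h : MagH1 a u v₁ v₂) :
    ‖h.vec‖ ^ 2 = (∫ x, ‖u x‖ ^ 2) + (∫ x, ‖v₁ x‖ ^ 2) + ∫ x, ‖v₂ x‖ ^ 2 := by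
  rw [Submodule.coe_norm, norm_sq_H3, ← norm_toLp_sq h.memLp, ← norm_toLp_sq h.memLp₁,
    ← norm_toLp_sq h.memLp₂]
  rfl

/-- `β_a` is a lower bound of the magnetic quadratic form. -/
theorem MagH1.beta_mul_le (h : MagH1 a u v₁ v₂) :
    beta a * ∫ x, ‖u x‖ ^ 2 ≤ (∫ x, ‖v₁ x‖ ^ 2) + ∫ x, ‖v₂ x‖ ^ 2 := by
  have hN := norm_embed_pos a
  have h1 : ‖embed a h.vec‖ ^ 2 ≤ ‖embed a‖ ^ 2 * ‖h.vec‖ ^ 2 := by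
    rw [← mul_pow]
    have := (embed a).le_opNorm h.vec
    gcongr
  have h2 : ‖embed a h.vec‖ ^ 2 = ∫ x, ‖u x‖ ^ 2 := norm_toLp_sq h.memLp
  rw [h2, h.norm_vec_sq] at h1
  rw [beta_eq_formBottom, formBottom, sub_mul, one_mul, one_div, sub_le_iff_le_add,
    inv_mul_le_iff₀ (by positivity)]
  linarith

/-- `β_a` is the greatest lower bound of the quadratic form on test functions. -/
theorem exists_test_lt {s : ℝ} (hs : beta a < s) :
    ∃ ϕ, IsCTest ϕ ∧ (∫ x, ‖mag1 a ϕ x‖ ^ 2) + ∫ x, ‖mag2 ϕ x‖ ^ 2 < s * ∫ x, ‖ϕ x‖ ^ 2 := by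
  have hN := norm_embed_pos a
  obtain ⟨u, v₁, v₂, h, hlt⟩ : ∃ u v₁ v₂ : ℝ × ℝ → ℂ, MagH1 a u v₁ v₂ ∧
      (∫ x, ‖v₁ x‖ ^ 2) + ∫ x, ‖v₂ x‖ ^ 2 < s * ∫ x, ‖u x‖ ^ 2 := by
    by_contra! hcon
    have hs1 : 0 < s + 1 := by
      have : -1 < beta a := by
        rw [beta_eq_formBottom, formBottom]
        have : 0 < 1 / ‖embed a‖ ^ 2 := by positivity
        linarith
      linarith
    -- If the form were at least s‖u‖² throughout, the squared graph norm would be at least (s +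
    -- 1)‖u‖², bounding ‖J‖² by 1/(s + 1) and so forcing β ≥ s.
    have hb : ‖embed a‖ ≤ √(1 / (s + 1)) := by
      refine ContinuousLinearMap.opNorm_le_bound _ (Real.sqrt_nonneg _) fun U => ?_
      have h1 := hcon _ _ _ (mem_formDomain_iff.1 U.2)
      rw [← norm_sq_L2, ← norm_sq_L2, ← norm_sq_L2] at h1
      have h2 := norm_sq_H3 U.1
      rw [← Real.sqrt_sq (norm_nonneg U), ← Real.sqrt_mul (by positivity)]
      refine Real.le_sqrt_of_sq_le ?_
      rw [embed_apply, one_div, ← div_eq_inv_mul, le_div_iff₀ hs1, Submodule.coe_norm]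
      linarith
    have h3 : ‖embed a‖ ^ 2 ≤ 1 / (s + 1) := by
      calc _ ≤ √(1 / (s + 1)) ^ 2 := by gcongr
        _ = _ := Real.sq_sqrt (by positivity)
    rw [beta_eq_formBottom, formBottom] at hs
    have h4 : 1 / ‖embed a‖ ^ 2 < s + 1 := by linarith
    rw [div_lt_iff₀ (by positivity)] at h4
    rw [le_div_iff₀ hs1] at h3
    linarith
  obtain ⟨ϕ, hϕ, l0, l1, l2⟩ := h.exists_test_seq
  have hL := (tendsto_integral_sq (fun n => ((hϕ n).magH1 a).memLp₁) h.memLp₁ l1).add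
    (tendsto_integral_sq (fun n => ((hϕ n).magH1 a).memLp₂) h.memLp₂ l2)
  have hR := (tendsto_integral_sq (fun n => ((hϕ n).magH1 a).memLp) h.memLp l0).const_mul s
  obtain ⟨n, hn⟩ := (hL.eventually_lt hR hlt).exists
  exact ⟨ϕ n, hϕ n, hn⟩

theorem beta_pos (ha : a < 0) (ha1 : -1 ≤ a) : 0 < beta a := by
  obtain ⟨c, hc, h⟩ := exists_coercive ha ha1
  by_contra! hb
  obtain ⟨ϕ, hϕ, hlt⟩ := exists_test_lt (hb.trans_lt hc)
  exact absurd (h _ _ _ (hϕ.magH1 a)) (not_le.2 hlt)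

end StepGL

end

noncomputable section

namespace StepGL

variable {a b R M L : ℝ} {u v₁ v₂ u' v₁' v₂' : ℝ × ℝ → ℂ}

/-! ### Gluing and averaging in the direction `x₁` -/

theorem integrable_norm_pow_add {f g : ℝ × ℝ → ℂ} (hfg : ∀ x, f x = 0 ∨ g x = 0) {n : ℕ}
    (hn : n ≠ 0) (hf : Integrable fun x => ‖f x‖ ^ n) (hg : Integrable fun x => ‖g x‖ ^ n) :
    (Integrable fun x => ‖f x + g x‖ ^ n) ∧
      ∫ x, ‖f x + g x‖ ^ n = (∫ x, ‖f x‖ ^ n) + ∫ x, ‖g x‖ ^ n := by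
  have e : (fun x => ‖f x + g x‖ ^ n) = fun x => ‖f x‖ ^ n + ‖g x‖ ^ n := by
    ext x
    rcases hfg x with h | h <;> simp [h, hn]
  rw [e]
  exact ⟨hf.add hg, integral_add hf hg⟩

theorem glE_translate (b s : ℝ) (u v₁ v₂ : ℝ × ℝ → ℂ) :
    glE b (fun x => u (x + (s, 0))) (fun x => v₁ (x + (s, 0))) (fun x => v₂ (x + (s, 0))) =
      glE b u v₁ v₂ := by
  unfold glE
  rw [integral_add_right_eq_self (fun x => ‖u x‖ ^ 2), integral_add_right_eq_self
    (fun x => ‖v₁ x‖ ^ 2), integral_add_right_eq_self (fun x => ‖v₂ x‖ ^ 2),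
    integral_add_right_eq_self (fun x => ‖u x‖ ^ 4)]

theorem mem_strip {x : ℝ × ℝ} : x ∈ strip R ↔ -R / 2 < x.1 ∧ x.1 < R / 2 := by
  simp [strip]

/-- Gluing two configurations along a common boundary line. -/
theorem Adm.exists_glue (h : Adm a R u v₁ v₂) (h' : Adm a M u' v₁' v₂') (hR : 0 < R) (hM : 0 < M) :
    ∃ w w₁ w₂, Adm a (R + M) w w₁ w₂ ∧ glE b w w₁ w₂ = glE b u v₁ v₂ + glE b u' v₁' v₂' := by
  -- The shifts make the two strips abut at x₁ = (R - M)/2 inside the strip of length R + M. At each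
  -- point one of the configurations vanishes, so all integrals of powers add.
  have hm := h.mag.translate (M / 2)
  have hm' := h'.mag.translate (-R / 2)
  have hz (x : ℝ × ℝ) (hx : ¬ x.1 < R / 2 - M / 2) :
      u (x + (M / 2, 0)) = 0 ∧ v₁ (x + (M / 2, 0)) = 0 ∧ v₂ (x + (M / 2, 0)) = 0 := by
    refine h.eq_zero _ fun hx' => ?_
    have := (mem_strip.1 hx').2
    simp only [Prod.fst_add] at this
    exact hx (by linarith)
  have hz' (x : ℝ × ℝ) (hx : x.1 < R / 2 - M / 2) :
      u' (x + (-R / 2, 0)) = 0 ∧ v₁' (x + (-R / 2, 0)) = 0 ∧ v₂' (x + (-R / 2, 0)) = 0 := by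
    refine h'.eq_zero _ fun hx' => ?_
    have := (mem_strip.1 hx').1
    simp only [Prod.fst_add] at this
    linarith
  have hd (x : ℝ × ℝ) : u (x + (M / 2, 0)) = 0 ∨ u' (x + (-R / 2, 0)) = 0 := by
    by_cases hx : x.1 < R / 2 - M / 2
    · exact Or.inr (hz' x hx).1
    · exact Or.inl (hz x hx).1
  have hd1 (x : ℝ × ℝ) : v₁ (x + (M / 2, 0)) = 0 ∨ v₁' (x + (-R / 2, 0)) = 0 := by
    by_cases hx : x.1 < R / 2 - M / 2
    · exact Or.inr (hz' x hx).2.1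
    · exact Or.inl (hz x hx).2.1
  have hd2 (x : ℝ × ℝ) : v₂ (x + (M / 2, 0)) = 0 ∨ v₂' (x + (-R / 2, 0)) = 0 := by
    by_cases hx : x.1 < R / 2 - M / 2
    · exact Or.inr (hz' x hx).2.2
    · exact Or.inl (hz x hx).2.2
  have q4 := integrable_norm_pow_add hd four_ne_zero (h.quartic.comp_add_right _)
    (h'.quartic.comp_add_right _)
  refine ⟨_, _, _, ⟨hm.add hm', fun x hx => ?_, q4.1⟩, ?_⟩
  · have h1 : x + (M / 2, 0) ∉ strip R := fun hx' => hx (by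
      rw [mem_strip] at hx' ⊢
      simp only [Prod.fst_add] at hx'
      constructor <;> linarith)
    have h2 : x + (-R / 2, 0) ∉ strip M := fun hx' => hx (by
      rw [mem_strip] at hx' ⊢
      simp only [Prod.fst_add] at hx'
      constructor <;> linarith)
    have e1 := h.eq_zero _ h1
    have e2 := h'.eq_zero _ h2
    simp [e1, e2]
  · rw [← glE_translate b (M / 2) u v₁ v₂, ← glE_translate b (-R / 2) u' v₁' v₂']
    unfold glE
    rw [q4.2, (integrable_norm_pow_add hd two_ne_zero (integrable_sq hm.memLp)
      (integrable_sq hm'.memLp)).2, (integrable_norm_pow_add hd1 two_ne_zero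
      (integrable_sq hm.memLp₁) (integrable_sq hm'.memLp₁)).2,
      (integrable_norm_pow_add hd2 two_ne_zero (integrable_sq hm.memLp₂)
      (integrable_sq hm'.memLp₂)).2]
    ring

theorem deriv_smoothTransition_eq_zero {t : ℝ} (h : t < 0 ∨ 1 < t) :
    deriv Real.smoothTransition t = 0 := by
  rcases h with h | h
  · have : Real.smoothTransition =ᶠ[𝓝 t] fun _ => 0 := by
      filter_upwards [gt_mem_nhds h] with s hs
      exact Real.smoothTransition.zero_of_nonpos hs.le
    rw [this.deriv_eq, deriv_const]
  · have : Real.smoothTransition =ᶠ[𝓝 t] fun _ => 1 := by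
      filter_upwards [lt_mem_nhds h] with s hs
      exact Real.smoothTransition.one_of_one_le hs.le
    rw [this.deriv_eq, deriv_const]

theorem exists_transition_bound : ∃ C : ℝ, 1 ≤ C ∧ ∀ t, |deriv Real.smoothTransition t| ≤ C := by
  refine exists_deriv_le contDiff_smoothTransition (HasCompactSupport.intro
    (isCompact_Icc (a := (0 : ℝ)) (b := 1)) fun x hx => deriv_smoothTransition_eq_zero ?_)
  by_contra! h
  exact hx h

/-- A bound on the derivative of the smooth transition function. -/
def transC : ℝ := exists_transition_bound.choose

theorem one_le_transC : 1 ≤ transC := exists_transition_bound.choose_spec.1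

theorem abs_deriv_transition_le (t : ℝ) : |deriv Real.smoothTransition t| ≤ transC :=
  exists_transition_bound.choose_spec.2 t

/-- A smooth cut-off supported in `[-R/2, R/2]`, equal to `1` at distance `1` from the ends. -/
def cell (R s : ℝ) : ℝ := Real.smoothTransition (s + R / 2) * Real.smoothTransition (R / 2 - s)

theorem contDiff_cell (R : ℝ) : ContDiff ℝ (⊤ : ℕ∞) (cell R) :=
  (contDiff_smoothTransition.comp (by fun_prop)).mul (contDiff_smoothTransition.comp (by fun_prop))

theorem differentiable_cell (R : ℝ) : Differentiable ℝ (cell R) :=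
  (contDiff_cell R).differentiable (by simp)

theorem cell_nonneg (R s : ℝ) : 0 ≤ cell R s :=
  mul_nonneg (Real.smoothTransition.nonneg _) (Real.smoothTransition.nonneg _)

theorem cell_le_one (R s : ℝ) : cell R s ≤ 1 :=
  mul_le_one₀ (Real.smoothTransition.le_one _) (Real.smoothTransition.nonneg _)
    (Real.smoothTransition.le_one _)

theorem cell_eq_zero {s : ℝ} (h : ¬ (-R / 2 < s ∧ s < R / 2)) : cell R s = 0 := by
  rw [not_and_or, not_lt, not_lt] at h
  rcases h with h | h
  · rw [cell, Real.smoothTransition.zero_of_nonpos (by linarith), zero_mul]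
  · rw [cell, Real.smoothTransition.zero_of_nonpos (show R / 2 - s ≤ 0 by linarith), mul_zero]

theorem cell_eq_one {s : ℝ} (h : -R / 2 + 1 ≤ s) (h' : s ≤ R / 2 - 1) : cell R s = 1 := by
  rw [cell, Real.smoothTransition.one_of_one_le (by linarith),
    Real.smoothTransition.one_of_one_le (by linarith), mul_one]

/-- A zero of a non-negative function is a minimum. This makes the gradient of a cut-off
configuration vanish pointwise off its strip, as `Adm` requires. -/
theorem deriv_cell_eq_zero_of_eq_zero {s : ℝ} (h : cell R s = 0) : deriv (cell R) s = 0 := by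
  refine IsLocalMin.deriv_eq_zero (.of_forall fun t => ?_)
  rw [h]; exact cell_nonneg R t

theorem deriv_cell (R s : ℝ) : deriv (cell R) s =
    deriv Real.smoothTransition (s + R / 2) * Real.smoothTransition (R / 2 - s) -
      Real.smoothTransition (s + R / 2) * deriv Real.smoothTransition (R / 2 - s) := by
  have hd : Differentiable ℝ Real.smoothTransition :=
    contDiff_smoothTransition.differentiable (by simp)
  have h1 : HasDerivAt (fun s => Real.smoothTransition (s + R / 2))
      (deriv Real.smoothTransition (s + R / 2) * 1) s :=
    (hd _).hasDerivAt.comp s ((hasDerivAt_id s).add_const _)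
  have h2 : HasDerivAt (fun s => Real.smoothTransition (R / 2 - s))
      (deriv Real.smoothTransition (R / 2 - s) * -1) s :=
    (hd _).hasDerivAt.comp s ((hasDerivAt_id s).const_sub _)
  rw [show cell R = fun s => Real.smoothTransition (s + R / 2) * Real.smoothTransition (R / 2 - s)
    from rfl, (h1.fun_mul h2).deriv]
  ring

theorem abs_deriv_cell_le (R s : ℝ) : |deriv (cell R) s| ≤ 2 * transC := by
  rw [deriv_cell]
  refine (abs_sub _ _).trans ?_
  rw [abs_mul, abs_mul, abs_of_nonneg (Real.smoothTransition.nonneg _),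
    abs_of_nonneg (Real.smoothTransition.nonneg _)]
  have h1 := abs_deriv_transition_le (s + R / 2)
  have h2 := abs_deriv_transition_le (R / 2 - s)
  have h3 := Real.smoothTransition.le_one (s + R / 2)
  have h4 := Real.smoothTransition.le_one (R / 2 - s)
  have h5 := Real.smoothTransition.nonneg (s + R / 2)
  have h6 := Real.smoothTransition.nonneg (R / 2 - s)
  nlinarith [abs_nonneg (deriv Real.smoothTransition (s + R / 2)),
    abs_nonneg (deriv Real.smoothTransition (R / 2 - s))]

theorem deriv_cell_eq_zero {s : ℝ} (h : -R / 2 + 1 < s) (h' : s < R / 2 - 1) :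
    deriv (cell R) s = 0 := by
  rw [deriv_cell, deriv_smoothTransition_eq_zero (Or.inr (by linarith)),
    deriv_smoothTransition_eq_zero (Or.inr (show 1 < R / 2 - s by linarith))]
  ring

theorem hasCompactSupport_cell (R : ℝ) : HasCompactSupport (cell R) :=
  HasCompactSupport.intro (isCompact_Icc (a := -R / 2) (b := R / 2)) fun s hs => by
    refine cell_eq_zero fun h => hs ⟨h.1.le, h.2.le⟩

theorem hasCompactSupport_cell_pow (R : ℝ) {n : ℕ} (hn : n ≠ 0) :
    HasCompactSupport fun s => cell R s ^ n :=
  HasCompactSupport.intro (hasCompactSupport_cell R) fun s hs => by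
    rw [image_eq_zero_of_notMem_tsupport hs, zero_pow hn]

theorem continuous_deriv_cell (R : ℝ) : Continuous (deriv (cell R)) :=
  (contDiff_cell R).continuous_deriv (by simp)

theorem integral_cell_sq_le (hR : 0 < R) : ∫ s, cell R s ^ 2 ≤ R := by
  have hz (s : ℝ) (hs : s ∉ Icc (-R / 2) (R / 2)) : cell R s ^ 2 = 0 := by
    rw [cell_eq_zero fun h => hs ⟨h.1.le, h.2.le⟩]; simp
  rw [← setIntegral_eq_integral_of_forall_compl_eq_zero hz]
  have hc := (contDiff_cell R).continuous
  calc ∫ s in Icc (-R / 2) (R / 2), cell R s ^ 2 ≤ ∫ s in Icc (-R / 2) (R / 2), (1 : ℝ) := by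
        refine setIntegral_mono_on (hc.pow 2).integrableOn_Icc continuous_const.integrableOn_Icc
          measurableSet_Icc fun s _ => ?_
        exact pow_le_one₀ (cell_nonneg R s) (cell_le_one R s)
    _ = R := by
        simp [Real.volume_real_Icc]
        rw [max_eq_left (by linarith)]; ring

theorem le_integral_cell_sq (hR : 2 ≤ R) : R - 2 ≤ ∫ s, cell R s ^ 2 := by
  have hc := (contDiff_cell R).continuous
  have hi : Integrable fun s => cell R s ^ 2 :=
    (hc.pow 2).integrable_of_hasCompactSupport (hasCompactSupport_cell_pow R two_ne_zero)
  calc R - 2 = ∫ s in Icc (-R / 2 + 1) (R / 2 - 1), (1 : ℝ) := by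
        simp [Real.volume_real_Icc]
        rw [max_eq_left (by linarith)]; ring
    _ = ∫ s in Icc (-R / 2 + 1) (R / 2 - 1), cell R s ^ 2 := by
        refine setIntegral_congr_fun measurableSet_Icc fun s hs => ?_
        rw [cell_eq_one hs.1 hs.2, one_pow]
    _ ≤ _ := setIntegral_le_integral hi (.of_forall fun s => by positivity)

/-- The bound does not depend on R: the derivative, at most 2 `transC`, lives on two end layers of
width 1. -/
theorem integral_deriv_cell_sq_le (R : ℝ) : ∫ s, deriv (cell R) s ^ 2 ≤ 8 * transC ^ 2 := by
  have hc := continuous_deriv_cell R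
  set A := Icc (-R / 2) (-R / 2 + 1)
  set B := Icc (R / 2 - 1) (R / 2)
  have hi : Integrable fun s => A.indicator (fun _ => 4 * transC ^ 2) s +
      B.indicator (fun _ => 4 * transC ^ 2) s :=
    ((integrable_indicator_iff measurableSet_Icc).2 continuous_const.integrableOn_Icc).add
      ((integrable_indicator_iff measurableSet_Icc).2 continuous_const.integrableOn_Icc)
  have hpos : 0 ≤ 4 * transC ^ 2 := by positivity
  calc ∫ s, deriv (cell R) s ^ 2 ≤ ∫ s, (A.indicator (fun _ => 4 * transC ^ 2) s +
        B.indicator (fun _ => 4 * transC ^ 2) s) := by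
        refine integral_mono_of_nonneg (.of_forall fun s => by positivity) hi
          (.of_forall fun s => ?_)
        simp only
        have hA0 : 0 ≤ A.indicator (fun _ => 4 * transC ^ 2) s :=
          indicator_nonneg (fun _ _ => hpos) s
        have hB0 : 0 ≤ B.indicator (fun _ => 4 * transC ^ 2) s :=
          indicator_nonneg (fun _ _ => hpos) s
        have hb : deriv (cell R) s ^ 2 ≤ 4 * transC ^ 2 := by
          rw [← sq_abs]
          calc _ ≤ (2 * transC) ^ 2 := by gcongr; exact abs_deriv_cell_le R s
            _ = _ := by ring
        by_cases h1 : s ∈ A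
        · rw [indicator_of_mem h1]; linarith
        by_cases h2 : s ∈ B
        · rw [indicator_of_mem h2]; linarith
        have h0 : deriv (cell R) s = 0 := by
          by_cases h3 : -R / 2 < s ∧ s < R / 2
          · refine deriv_cell_eq_zero ?_ ?_
            · by_contra! h; exact h1 ⟨h3.1.le, h⟩
            · by_contra! h; exact h2 ⟨h, h3.2.le⟩
          · exact deriv_cell_eq_zero_of_eq_zero (cell_eq_zero h3)
        rw [h0]; simp only [ne_eq, OfNat.ofNat_ne_zero, not_false_eq_true, zero_pow]
        linarith
    _ = 8 * transC ^ 2 := by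
        rw [integral_add ((integrable_indicator_iff measurableSet_Icc).2
          continuous_const.integrableOn_Icc) ((integrable_indicator_iff measurableSet_Icc).2
          continuous_const.integrableOn_Icc), integral_indicator measurableSet_Icc,
          integral_indicator measurableSet_Icc]
        simp only [integral_const, MeasurableSet.univ, measureReal_restrict_apply, univ_inter,
          Real.volume_real_Icc, smul_eq_mul]
        norm_num
        ring

/-- The integrand is half the derivative of a compactly supported function. This removes the cross
term of the kinetic energy after averaging. -/
theorem integral_cell_mul_deriv (R : ℝ) : ∫ s, cell R s * deriv (cell R) s = 0 := by
  have hc := (contDiff_cell R).continuous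
  have hs := hasCompactSupport_cell R
  have h := integral_eq_zero_of_hasDerivAt_of_integrable (f := fun s => cell R s * cell R s)
    (f' := fun s => deriv (cell R) s * cell R s + cell R s * deriv (cell R) s)
    (fun s => (differentiable_cell R s).hasDerivAt.mul (differentiable_cell R s).hasDerivAt)
    (((continuous_deriv_cell R).mul hc).add
      (hc.mul (continuous_deriv_cell R)) |>.integrable_of_hasCompactSupport
      (HasCompactSupport.add (HasCompactSupport.mul_left hs) (HasCompactSupport.mul_right hs)))
    ((hc.mul hc).integrable_of_hasCompactSupport (HasCompactSupport.mul_left hs))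
  have e : (fun s => deriv (cell R) s * cell R s + cell R s * deriv (cell R) s) =
      fun s => 2 * (cell R s * deriv (cell R) s) := by ext s; ring
  rw [e, integral_const_mul] at h
  linarith

/-- Averaging over translations in the direction `x₁`. -/
theorem integral_average {k : ℝ → ℝ} (hk : Continuous k) (hc : HasCompactSupport k)
    {h : ℝ × ℝ → ℝ} (hh : Integrable h) :
    (Integrable fun t => ∫ x : ℝ × ℝ, k (x.1 - t) * h x) ∧
      ∫ t, ∫ x : ℝ × ℝ, k (x.1 - t) * h x = (∫ s, k s) * ∫ x, h x := by
  have hki : Integrable k := hk.integrable_of_hasCompactSupport hc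
  have hF : Integrable (fun p : ℝ × (ℝ × ℝ) => k (p.2.1 - p.1) * h p.2)
      (volume.prod volume) := by
    rw [integrable_prod_iff']
    · refine ⟨.of_forall fun x => (hki.comp_sub_left x.1).mul_const (h x), ?_⟩
      have e (x : ℝ × ℝ) : ∫ t, ‖k (x.1 - t) * h x‖ = (∫ s, ‖k s‖) * ‖h x‖ := by
        simp only [norm_mul]
        rw [integral_mul_const, integral_sub_left_eq_self (fun s => ‖k s‖)]
      simp only [e]
      exact hh.norm.const_mul _
    · exact (Continuous.aestronglyMeasurable (by fun_prop)).mul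
        (hh.1.comp_quasiMeasurePreserving Measure.quasiMeasurePreserving_snd)
  refine ⟨hF.integral_prod_left, ?_⟩
  rw [integral_integral_swap hF]
  have e (x : ℝ × ℝ) : ∫ t, k (x.1 - t) * h x = (∫ s, k s) * h x := by
    rw [integral_mul_const, integral_sub_left_eq_self k]
  simp only [e]
  rw [integral_const_mul]

end StepGL

end

/-! ### Comparison of the energies on a long and a short strip by averaging -/

noncomputable section

namespace StepGL

variable {a b R M L : ℝ} {u v₁ v₂ : ℝ × ℝ → ℂ}

theorem groundEnergy_le (hbd : BddBelow (energyValues a b R)) (h : Adm a R u v₁ v₂) :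
    groundEnergy a b R ≤ glE b u v₁ v₂ :=
  csInf_le hbd (mem_energyValues_iff.2 ⟨u, v₁, v₂, h, rfl⟩)

theorem groundEnergy_nonpos (hbd : BddBelow (energyValues a b R)) : groundEnergy a b R ≤ 0 :=
  csInf_le hbd (zero_mem_energyValues a b R)

/-- The integrand of the energy of a configuration cut off in the direction `x₁`. -/
theorem normSq_cell (c d : ℝ) (z w : ℂ) :
    ‖c • z + d • w‖ ^ 2 =
      c ^ 2 * ‖z‖ ^ 2 + c * d * (2 * (z * (starRingEnd ℂ) w).re) + d ^ 2 * ‖w‖ ^ 2 := by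
  simp only [Complex.sq_norm, Complex.normSq_apply]
  simp
  ring

theorem integral_add_four {α : Type*} [MeasurableSpace α] {μ : Measure α} {f g h k : α → ℝ}
    (hf : Integrable f μ) (hg : Integrable g μ) (hh : Integrable h μ) (hk : Integrable k μ) :
    ∫ x, (f x + g x + h x + k x) ∂μ =
      (∫ x, f x ∂μ) + (∫ x, g x ∂μ) + (∫ x, h x ∂μ) + ∫ x, k x ∂μ := by
  have i : Integrable (fun x => f x + g x) μ := hf.add hg
  have j : Integrable (fun x => f x + g x + h x) μ := i.add hh
  rw [integral_add j hk, integral_add i hh, integral_add hf hg]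

/-- The energy of configurations on a long strip, compared with the one on a shorter strip. -/
theorem Adm.average (h : Adm a M u v₁ v₂) (hb : 0 ≤ b) (hbd : BddBelow (energyValues a b R))
    (hR : 0 < R) (hM : 0 < M) :
    (M + R) * groundEnergy a b R ≤
      (∫ s, cell R s ^ 2) * glE b u v₁ v₂ + 8 * transC ^ 2 * (b * ∫ x, ‖u x‖ ^ 2) := by
  have hcc := (contDiff_cell R).continuous
  have hcd := continuous_deriv_cell R
  have hcs := hasCompactSupport_cell R
  let U : ℝ → ℝ × ℝ → ℂ := fun t x => cell R (x.1 - t) • u x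
  let V₁ : ℝ → ℝ × ℝ → ℂ := fun t x => cell R (x.1 - t) • v₁ x + deriv (cell R) (x.1 - t) • u x
  let V₂ : ℝ → ℝ × ℝ → ℂ := fun t x => cell R (x.1 - t) • v₂ x
  have hUz (t : ℝ) (x : ℝ × ℝ) (hx : ¬ (-R / 2 < x.1 - t ∧ x.1 - t < R / 2)) :
      U t x = 0 ∧ V₁ t x = 0 ∧ V₂ t x = 0 := by
    have h0 := cell_eq_zero hx
    simp [U, V₁, V₂, h0, deriv_cell_eq_zero_of_eq_zero h0]
  have hmag (t : ℝ) : MagH1 a (U t) (V₁ t) (V₂ t) := by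
    have hd (s : ℝ) : deriv (fun s => cell R (s - t)) s = deriv (cell R) (s - t) :=
      deriv_comp_sub_const (f := cell R) ..
    have := h.mag.smul_fst (k := fun s => cell R (s - t)) (C := 2 * transC)
      ((contDiff_cell R).comp (by fun_prop)) (fun s => by
        rw [abs_of_nonneg (cell_nonneg _ _)]
        linarith [cell_le_one R (s - t), one_le_transC])
      (fun s => by rw [hd]; exact abs_deriv_cell_le R _)
    simpa only [hd] using this
  have hq (t : ℝ) : Integrable fun x => ‖U t x‖ ^ 4 := by
    have e (x : ℝ × ℝ) : ‖U t x‖ ^ 4 = cell R (x.1 - t) ^ 4 * ‖u x‖ ^ 4 := by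
      simp only [U]
      rw [norm_smul, mul_pow, Real.norm_eq_abs, abs_of_nonneg (cell_nonneg _ _)]
    simp only [e]
    refine h.quartic.bdd_mul (c := 1) ?_ (.of_forall fun x => ?_)
    · exact Continuous.aestronglyMeasurable (by fun_prop)
    · rw [Real.norm_eq_abs, abs_of_nonneg (pow_nonneg (cell_nonneg _ _) _)]
      exact pow_le_one₀ (cell_nonneg _ _) (cell_le_one _ _)
  -- Translated back by t, the piece cut out around x₁ = t is admissible on the strip of length R.
  have hge (t : ℝ) : groundEnergy a b R ≤ glE b (U t) (V₁ t) (V₂ t) := by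
    rw [← glE_translate b t]
    refine groundEnergy_le hbd ⟨(hmag t).translate t, fun x hx => hUz t _ ?_,
      (hq t).comp_add_right _⟩
    rw [mem_strip] at hx
    simpa using hx
  -- Outside this interval, of length M + R, the cut-off misses the strip of u. The integral over t
  -- of the lower bound therefore carries the factor M + R.
  have hzero (t : ℝ) (ht : t ∉ Icc (-(M + R) / 2) ((M + R) / 2)) :
      glE b (U t) (V₁ t) (V₂ t) = 0 := by
    have hz (x : ℝ × ℝ) : U t x = 0 ∧ V₁ t x = 0 ∧ V₂ t x = 0 := by
      by_cases hx : x ∈ strip M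
      · rw [mem_strip] at hx
        refine hUz t x fun hx' => ht ⟨?_, ?_⟩ <;> linarith [hx.1, hx.2, hx'.1, hx'.2]
      · obtain ⟨e0, e1, e2⟩ := h.eq_zero x hx
        simp [U, V₁, V₂, e0, e1, e2]
    simp [glE, hz]
  set m := ∫ x, ‖u x‖ ^ 2 with hm
  have i0 := integrable_sq h.mag.memLp
  have hquad : Integrable fun x => b * (‖v₁ x‖ ^ 2 + ‖v₂ x‖ ^ 2) - ‖u x‖ ^ 2 :=
    h.mag.integrable_quadratic b
  have hcross : Integrable fun x => b * (2 * (v₁ x * (starRingEnd ℂ) (u x)).re) := by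
    have : Integrable fun x => v₁ x * (starRingEnd ℂ) (u x) := by
      simpa [mul_comm] using integrable_conj_mul h.mag.memLp h.mag.memLp₁
    exact (this.re.const_mul 2).const_mul b
  obtain ⟨a1, f1⟩ := integral_average (k := fun s => cell R s ^ 2) (by fun_prop)
    (hasCompactSupport_cell_pow R two_ne_zero) hquad
  obtain ⟨a2, f2⟩ := integral_average (k := fun s => cell R s * deriv (cell R) s) (by fun_prop)
    (HasCompactSupport.mul_right hcs) hcross
  obtain ⟨a3, f3⟩ := integral_average (k := fun s => deriv (cell R) s ^ 2) (by fun_prop)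
    (HasCompactSupport.intro hcs fun s hs => by
      rw [deriv_cell_eq_zero_of_eq_zero (image_eq_zero_of_notMem_tsupport hs)]; simp)
    (i0.const_mul b)
  obtain ⟨a4, f4⟩ := integral_average (k := fun s => cell R s ^ 4) (by fun_prop)
    (hasCompactSupport_cell_pow R four_ne_zero) (h.quartic.const_mul (1 / 2))
  have hbdd {k : ℝ → ℝ} (hk : Continuous k) {C : ℝ} (hC : ∀ s, |k s| ≤ C) (t : ℝ)
      {g : ℝ × ℝ → ℝ} (hg : Integrable g) : Integrable fun x : ℝ × ℝ => k (x.1 - t) * g x :=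
    hg.bdd_mul (c := C) (Continuous.aestronglyMeasurable (by fun_prop)) (.of_forall fun x => hC _)
  have hc1 (s : ℝ) : |cell R s| ≤ 1 := by
    rw [abs_of_nonneg (cell_nonneg _ _)]; exact cell_le_one R s
  have hsplit (t : ℝ) : glE b (U t) (V₁ t) (V₂ t) =
      (∫ x : ℝ × ℝ, cell R (x.1 - t) ^ 2 * (b * (‖v₁ x‖ ^ 2 + ‖v₂ x‖ ^ 2) - ‖u x‖ ^ 2)) +
      (∫ x : ℝ × ℝ, cell R (x.1 - t) * deriv (cell R) (x.1 - t) *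
        (b * (2 * (v₁ x * (starRingEnd ℂ) (u x)).re))) +
      (∫ x : ℝ × ℝ, deriv (cell R) (x.1 - t) ^ 2 * (b * ‖u x‖ ^ 2)) +
      ∫ x : ℝ × ℝ, cell R (x.1 - t) ^ 4 * (1 / 2 * ‖u x‖ ^ 4) := by
    have j1 := hbdd (k := fun s => cell R s ^ 2) (by fun_prop) (C := 1) (fun s => by
      rw [abs_pow]; exact pow_le_one₀ (abs_nonneg _) (hc1 s)) t hquad
    have j2 := hbdd (k := fun s => cell R s * deriv (cell R) s) (by fun_prop) (C := 2 * transC)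
      (fun s => by
        rw [abs_mul]
        have := abs_deriv_cell_le R s
        nlinarith [hc1 s, abs_nonneg (deriv (cell R) s)]) t hcross
    have j3 := hbdd (k := fun s => deriv (cell R) s ^ 2) (by fun_prop) (C := (2 * transC) ^ 2)
      (fun s => by
        rw [abs_pow]
        have := abs_deriv_cell_le R s
        gcongr) t (i0.const_mul b)
    have j4 := hbdd (k := fun s => cell R s ^ 4) (by fun_prop) (C := 1) (fun s => by
      rw [abs_pow]; exact pow_le_one₀ (abs_nonneg _) (hc1 s)) t (h.quartic.const_mul (1 / 2))
    rw [← (hmag t).integral_energy (hq t), ← integral_add_four j1 j2 j3 j4]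
    congr 1; ext x
    simp only [U, V₁, V₂]
    rw [normSq_cell, normSq_smul, normSq_smul, norm_smul, mul_pow (‖cell R (x.1 - t)‖),
      Real.norm_eq_abs, abs_of_nonneg (cell_nonneg _ _)]
    ring
  have hint : Integrable fun t => glE b (U t) (V₁ t) (V₂ t) := by
    simp only [hsplit]
    exact ((a1.add a2).add a3).add a4
  have htot : ∫ t, glE b (U t) (V₁ t) (V₂ t) =
      (∫ s, cell R s ^ 2) * (∫ x, (b * (‖v₁ x‖ ^ 2 + ‖v₂ x‖ ^ 2) - ‖u x‖ ^ 2)) +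
      (∫ s, deriv (cell R) s ^ 2) * (b * m) +
      (∫ s, cell R s ^ 4) * (1 / 2 * ∫ x, ‖u x‖ ^ 4) := by
    simp only [hsplit]
    have e3 : ∫ x, b * ‖u x‖ ^ 2 = b * m := integral_const_mul ..
    have e4 : ∫ x, 1 / 2 * ‖u x‖ ^ 4 = 1 / 2 * ∫ x, ‖u x‖ ^ 4 := integral_const_mul ..
    rw [integral_add_four a1 a2 a3 a4, f1, f2, f3, f4, integral_cell_mul_deriv, e3, e4]
    ring
  have hglE : glE b u v₁ v₂ = (∫ x, (b * (‖v₁ x‖ ^ 2 + ‖v₂ x‖ ^ 2) - ‖u x‖ ^ 2)) +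
      1 / 2 * ∫ x, ‖u x‖ ^ 4 := by
    rw [← h.mag.integral_energy h.quartic, integral_add hquad (h.quartic.const_mul _),
      integral_const_mul]
  -- The quartic term is averaged with the fourth power of the cut-off; being non-negative, it may
  -- be given the larger factor of the quadratic terms, which reconstitutes the energy of u.
  have h4 : ∫ s, cell R s ^ 4 ≤ ∫ s, cell R s ^ 2 := by
    refine integral_mono ((hcc.pow 4).integrable_of_hasCompactSupport
      (hasCompactSupport_cell_pow R four_ne_zero)) ((hcc.pow 2).integrable_of_hasCompactSupport
      (hasCompactSupport_cell_pow R two_ne_zero)) fun s => ?_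
    exact pow_le_pow_of_le_one (cell_nonneg _ _) (cell_le_one _ _) (by norm_num)
  have hlow : (M + R) * groundEnergy a b R ≤ ∫ t, glE b (U t) (V₁ t) (V₂ t) := by
    rw [← setIntegral_eq_integral_of_forall_compl_eq_zero hzero]
    calc (M + R) * groundEnergy a b R
        = ∫ t in Icc (-(M + R) / 2) ((M + R) / 2), groundEnergy a b R := by
          simp only [integral_const, MeasurableSet.univ, measureReal_restrict_apply, univ_inter,
            Real.volume_real_Icc, smul_eq_mul]
          rw [max_eq_left (by linarith)]; ring
      _ ≤ _ := setIntegral_mono_on continuous_const.integrableOn_Icc hint.integrableOn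
          measurableSet_Icc fun t _ => hge t
  have hq0 : 0 ≤ 1 / 2 * ∫ x, ‖u x‖ ^ 4 := by positivity
  have h5 := mul_le_mul_of_nonneg_right h4 hq0
  have h6 := mul_le_mul_of_nonneg_right (integral_deriv_cell_sq_le R)
    (show 0 ≤ b * m by positivity)
  rw [htot] at hlow
  rw [hglE]
  linarith

end StepGL

end

/-! ### Subadditivity, the limit energy and the rate of convergence -/

noncomputable section

namespace StepGL

variable {a b R M L : ℝ} {u v₁ v₂ : ℝ × ℝ → ℂ}

theorem le_groundEnergy {c : ℝ} (h : ∀ u v₁ v₂, Adm a R u v₁ v₂ → c ≤ glE b u v₁ v₂) :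
    c ≤ groundEnergy a b R := by
  refine le_csInf ⟨0, zero_mem_energyValues a b R⟩ fun E hE => ?_
  obtain ⟨u, v₁, v₂, hu, rfl⟩ := mem_energyValues_iff.1 hE
  exact h u v₁ v₂ hu

theorem bddBelow_energyValues (ha : a < 0) (ha1 : -1 ≤ a) (hb : 1 / |a| ≤ b) (hR : 0 < R) :
    BddBelow (energyValues a b R) :=
  ⟨_, energyValues_bddBelow_of_neg ha ha1 hb hR⟩

theorem groundEnergy_add_le (ha : a < 0) (ha1 : -1 ≤ a) (hb : 1 / |a| ≤ b) (hR : 0 < R)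
    (hM : 0 < M) : groundEnergy a b (R + M) ≤ groundEnergy a b R + groundEnergy a b M := by
  have hbd := bddBelow_energyValues ha ha1 hb (add_pos hR hM)
  rw [← sub_le_iff_le_add]
  refine le_groundEnergy fun u v₁ v₂ h => ?_
  rw [sub_le_comm]
  refine le_groundEnergy fun u' v₁' v₂' h' => ?_
  obtain ⟨w, w₁, w₂, hw, he⟩ := h.exists_glue (b := b) h' hR hM
  have := groundEnergy_le hbd hw
  linarith

theorem groundEnergy_natCast_mul_le (ha : a < 0) (ha1 : -1 ≤ a) (hb : 1 / |a| ≤ b) (hM : 0 < M)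
    (n : ℕ) : groundEnergy a b ((n + 1) * M) ≤ (n + 1) * groundEnergy a b M := by
  induction n with
  | zero => simp
  | succ n ih =>
    have h := groundEnergy_add_le ha ha1 hb (R := (n + 1) * M) (by positivity) hM
    push_cast
    rw [show ((n : ℝ) + 1 + 1) * M = (n + 1) * M + M by ring]
    linarith

theorem Adm.inner (h : Adm a R u v₁ v₂) (hL : 0 < L) :
    Adm a R (fun x => cIn L x.2 • u x) (fun x => cIn L x.2 • v₁ x)
      (fun x => cIn L x.2 • v₂ x + (-cOut L x.2 * angleSlope L x.2) • u x) where
  mag := h.mag.inner hL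
  eq_zero x hx := by
    obtain ⟨e0, e1, e2⟩ := h.eq_zero x hx
    simp [e0, e1, e2]
  quartic := by
    have hc := (contDiff_cIn L).continuous
    have e (x : ℝ × ℝ) : ‖cIn L x.2 • u x‖ ^ 4 = |cIn L x.2| ^ 4 * ‖u x‖ ^ 4 := by
      rw [norm_smul, mul_pow, Real.norm_eq_abs]
    simp only [e]
    refine h.quartic.bdd_mul (c := 1) (Continuous.aestronglyMeasurable (by fun_prop))
      (.of_forall fun x => ?_)
    rw [Real.norm_eq_abs, abs_of_nonneg (by positivity)]
    exact pow_le_one₀ (abs_nonneg _) (abs_cIn_le L _)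

theorem Adm.glE_inner_le (h : Adm a R u v₁ v₂) (ha : a < 0) (ha1 : -1 ≤ a) (hb : 1 / |a| ≤ b)
    (hL : 0 < L) :
    glE b (fun x => cIn L x.2 • u x) (fun x => cIn L x.2 • v₁ x)
      (fun x => cIn L x.2 • v₂ x + (-cOut L x.2 * angleSlope L x.2) • u x) ≤
    glE b u v₁ v₂ + b * ((angleC / L) ^ 2 * ∫ x in box R L, ‖u x‖ ^ 2) := by
  have hb0 : 0 ≤ b := (by positivity : 0 ≤ 1 / |a|).trans hb
  have h1 := h.mag.inner_quadratic_le ha ha1 hb hL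
  have h2 := mul_le_mul_of_nonneg_left (h.slope_le_box hL) hb0
  have h3 : ∫ x, ‖cIn L x.2 • u x‖ ^ 4 ≤ ∫ x, ‖u x‖ ^ 4 := by
    refine integral_mono (h.inner hL).quartic h.quartic fun x => ?_
    simp only [norm_smul, Real.norm_eq_abs]
    gcongr
    exact mul_le_of_le_one_left (norm_nonneg _) (abs_cIn_le L _)
  unfold glE
  linarith

/-- The constant in the comparison of the energies on two strips. -/
def longC : ℝ := (angleC ^ 2 + 8 * transC ^ 2) * (4 * lowerC + 1)

theorem longC_nonneg : 0 ≤ longC := by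
  have := lowerC_ge
  unfold longC; positivity

theorem Adm.long (h : Adm a M u v₁ v₂) (ha : a < 0) (ha1 : -1 ≤ a) (hb : 1 / |a| ≤ b)
    (hM : 0 < M) (hR : 4 ≤ R) (hE : glE b u v₁ v₂ ≤ 0) :
    (M + R) * groundEnergy a b R ≤ (R - 2) * glE b u v₁ v₂ + longC * b ^ 2 * M * √R := by
  have hb1 : 1 ≤ b := one_le_of_inv_abs_le ha.ne (abs_le_one_of_neg ha ha1) hb
  have hb0 : 0 < b := by linarith
  have hR0 : 0 < R := by linarith
  have hL1 : 1 ≤ √R := Real.one_le_sqrt.2 (by linarith)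
  have hL : 0 < √R := by linarith
  -- At localization scale L the mass B is of order bML. Localization in x₂ costs about RbB/L² and
  -- the cut-off in x₁ about bB, in all b²M(R/L + L), which L = √R balances.
  set B := ∫ x in box M (√R), ‖u x‖ ^ 2
  have hB : B ≤ (4 * lowerC + 1) * b * M * √R := by
    -- As ∫|u|⁴ is at most of order b²M when the energy is non-positive, s = 1/b makes both terms
    -- linear in b.
    have h1 := integral_box_sq_le h.mag.memLp h.quartic hM hL (one_div_pos.2 hb0)
    have h2 : ∫ x, ‖u x‖ ^ 4 ≤ 4 * (lowerC * b ^ 2 * M) := by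
      linarith [h.lower_bound ha ha1 hb hM]
    have h3 : 1 / b * (∫ x, ‖u x‖ ^ 4) ≤ 1 / b * (4 * (lowerC * b ^ 2 * M)) := by gcongr
    have h4 : 1 / b * (4 * (lowerC * b ^ 2 * M)) = 4 * lowerC * b * M := by field_simp
    have h5 : 4 * lowerC * b * M ≤ 4 * lowerC * b * M * √R := by
      have := lowerC_ge
      exact le_mul_of_one_le_right (by positivity) hL1
    have h6 : 1 / (1 / b) * (M * √R) = b * M * √R := by rw [one_div_one_div]; ring
    linarith
  have hw := (h.inner hL).average hb0.le (bddBelow_energyValues ha ha1 hb hR0) hR0 hM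
  have hg := h.glE_inner_le ha ha1 hb hL
  have hs := h.inner_sq_le_box hL
  have hB0 : 0 ≤ B := by positivity
  have hsq : (angleC / √R) ^ 2 * R = angleC ^ 2 := by
    rw [div_pow, Real.sq_sqrt hR0.le]; field_simp
  set K := ∫ s, cell R s ^ 2
  have hK : K ≤ R := integral_cell_sq_le hR0
  have hK' : R - 2 ≤ K := le_integral_cell_sq (by linarith)
  have t1 := mul_le_mul_of_nonneg_left hg (show 0 ≤ K by linarith)
  have t2 : K * glE b u v₁ v₂ ≤ (R - 2) * glE b u v₁ v₂ := mul_le_mul_of_nonpos_right hK' hE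
  have t3 : K * (b * ((angleC / √R) ^ 2 * B)) ≤ b * angleC ^ 2 * B := by
    calc _ ≤ R * (b * ((angleC / √R) ^ 2 * B)) := by gcongr
      _ = b * ((angleC / √R) ^ 2 * R) * B := by ring
      _ = _ := by rw [hsq]
  have t4 : 8 * transC ^ 2 * (b * ∫ x, ‖cIn (√R) x.2 • u x‖ ^ 2) ≤ 8 * transC ^ 2 * (b * B) := by
    gcongr
  have t5 : (angleC ^ 2 + 8 * transC ^ 2) * b * B ≤
      (angleC ^ 2 + 8 * transC ^ 2) * b * ((4 * lowerC + 1) * b * M * √R) := by gcongr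
  unfold longC
  linarith

theorem groundEnergy_long (ha : a < 0) (ha1 : -1 ≤ a) (hb : 1 / |a| ≤ b) (hM : 0 < M)
    (hR : 4 ≤ R) :
    (M + R) * groundEnergy a b R - longC * b ^ 2 * M * √R ≤ (R - 2) * groundEnergy a b M := by
  have hR2 : 0 < R - 2 := by linarith
  rw [mul_comm (R - 2), ← div_le_iff₀ hR2]
  refine le_groundEnergy fun u v₁ v₂ h => ?_
  rw [div_le_iff₀ hR2]
  -- Configurations of positive energy are irrelevant: the left-hand side is non-positive because
  -- g(R) ≤ 0.
  rcases le_or_gt (glE b u v₁ v₂) 0 with hE | hE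
  · linarith [h.long ha ha1 hb hM hR hE]
  · have hR0 : 0 < R := by linarith
    have h1 := groundEnergy_nonpos (bddBelow_energyValues ha ha1 hb hR0)
    have h2 : (M + R) * groundEnergy a b R ≤ 0 := mul_nonpos_of_nonneg_of_nonpos (by linarith) h1
    have h3 : 0 ≤ longC * b ^ 2 * M * √R := by
      have := longC_nonneg
      positivity
    have h4 := mul_pos hE hR2
    linarith

/-- The energy per unit length, in the limit of a long strip. -/
def limitEnergy (a b : ℝ) : ℝ := sInf ((fun R => groundEnergy a b R / R) '' Ioi 0)

theorem neg_le_groundEnergy_div (ha : a < 0) (ha1 : -1 ≤ a) (hb : 1 / |a| ≤ b) (hR : 0 < R) :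
    -(lowerC * b ^ 2) ≤ groundEnergy a b R / R := by
  rw [le_div_iff₀ hR]
  refine (le_csInf ⟨0, zero_mem_energyValues a b R⟩ ?_ : _ ≤ groundEnergy a b R)
  intro E hE
  linarith [energyValues_bddBelow_of_neg ha ha1 hb hR hE]

theorem limitEnergy_le (ha : a < 0) (ha1 : -1 ≤ a) (hb : 1 / |a| ≤ b) (hR : 0 < R) :
    limitEnergy a b ≤ groundEnergy a b R / R := by
  refine csInf_le ⟨-(lowerC * b ^ 2), ?_⟩ ⟨R, hR, rfl⟩
  rintro _ ⟨R, hR, rfl⟩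
  exact neg_le_groundEnergy_div ha ha1 hb hR

theorem le_limitEnergy {c : ℝ} (h : ∀ R, 0 < R → c ≤ groundEnergy a b R / R) :
    c ≤ limitEnergy a b := by
  refine le_csInf ⟨_, 1, mem_Ioi.2 one_pos, rfl⟩ ?_
  rintro _ ⟨R, hR, rfl⟩
  exact h R hR

theorem limitEnergy_nonpos (ha : a < 0) (ha1 : -1 ≤ a) (hb : 1 / |a| ≤ b) :
    limitEnergy a b ≤ 0 := by
  have h1 := limitEnergy_le ha ha1 hb one_pos
  have h2 := groundEnergy_nonpos (bddBelow_energyValues ha ha1 hb one_pos)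
  rw [div_one] at h1
  linarith

theorem neg_le_limitEnergy (ha : a < 0) (ha1 : -1 ≤ a) (hb : 1 / |a| ≤ b) :
    -(lowerC * b ^ 2) ≤ limitEnergy a b :=
  le_limitEnergy fun _ hR => neg_le_groundEnergy_div ha ha1 hb hR

/-- Divide `groundEnergy_long` by the length of the long strip and let that length tend to infinity.
-/
theorem groundEnergy_le_mul_limitEnergy (ha : a < 0) (ha1 : -1 ≤ a) (hb : 1 / |a| ≤ b)
    (hR : 4 ≤ R) :
    groundEnergy a b R - longC * b ^ 2 * √R ≤ (R - 2) * limitEnergy a b := by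
  have hR2 : 0 < R - 2 := by linarith
  rw [mul_comm (R - 2), ← div_le_iff₀ hR2]
  refine le_limitEnergy fun M hM => ?_
  rw [div_le_iff₀ hR2]
  -- The long strip is n + 1 copies of one of length M, so subadditivity bounds its energy per unit
  -- length by g(M)/M, while the term R g(R) is divided by (n + 1)M.
  have hn (n : ℕ) : groundEnergy a b R + R * groundEnergy a b R / M * (1 / ((n : ℝ) + 1)) -
      longC * b ^ 2 * √R ≤ groundEnergy a b M / M * (R - 2) := by
    have hn0 : (0 : ℝ) < n + 1 := by positivity
    have h1 := groundEnergy_long ha ha1 hb (M := (n + 1) * M) (by positivity) hR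
    have h2 := mul_le_mul_of_nonneg_left (groundEnergy_natCast_mul_le ha ha1 hb hM n) hR2.le
    have hp : 0 < ((n : ℝ) + 1) * M := by positivity
    refine le_of_mul_le_mul_left ?_ hp
    calc _ = ((n + 1) * M + R) * groundEnergy a b R - longC * b ^ 2 * ((n + 1) * M) * √R := by
          field_simp
      _ ≤ (R - 2) * ((n + 1) * groundEnergy a b M) := h1.trans h2
      _ = _ := by field_simp
  refine le_of_tendsto' (f := fun n : ℕ => groundEnergy a b R +
    R * groundEnergy a b R / M * (1 / ((n : ℝ) + 1)) - longC * b ^ 2 * √R) (x := atTop) ?_ hn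
  have := ((tendsto_one_div_add_atTop_nhds_zero_nat (𝕜 := ℝ)).const_mul
    (R * groundEnergy a b R / M)).const_add (groundEnergy a b R)
  simpa using this.sub_const (longC * b ^ 2 * √R)

/-- The constant in the estimate of the rate of convergence. -/
def rateC : ℝ := 2 * lowerC + longC

theorem rateC_pos : 0 < rateC := by
  have := lowerC_ge
  have := longC_nonneg
  unfold rateC; linarith

/-- Two errors remain, -2e ≤ 2 `lowerC` b² and `longC` b² √R. Both are at most a constant times b²
R^(2/3), since R ≥ 1. -/
theorem groundEnergy_div_le (ha : a < 0) (ha1 : -1 ≤ a) (hb : 1 / |a| ≤ b) (hR : 4 ≤ R) :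
    groundEnergy a b R / R ≤ limitEnergy a b + rateC * (b ^ 2 / R ^ ((1 : ℝ) / 3)) := by
  have hR0 : 0 < R := by linarith
  have h1 := groundEnergy_le_mul_limitEnergy ha ha1 hb hR
  have h2 := neg_le_limitEnergy ha ha1 hb
  have hp : 0 < R ^ ((1 : ℝ) / 3) := Real.rpow_pos_of_pos hR0 _
  have e1 : R ^ ((1 : ℝ) / 3) ≤ R := by
    calc R ^ ((1 : ℝ) / 3) ≤ R ^ (1 : ℝ) :=
          Real.rpow_le_rpow_of_exponent_le (by linarith) (by norm_num)
      _ = R := Real.rpow_one R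
  have e2 : R ^ ((1 : ℝ) / 3) * √R ≤ R := by
    rw [Real.sqrt_eq_rpow, ← Real.rpow_add hR0]
    calc _ ≤ R ^ (1 : ℝ) := Real.rpow_le_rpow_of_exponent_le (by linarith) (by norm_num)
      _ = R := Real.rpow_one R
  have f1 : 1 ≤ R / R ^ ((1 : ℝ) / 3) := (one_le_div hp).2 e1
  have f2 : √R ≤ R / R ^ ((1 : ℝ) / 3) := (le_div_iff₀ hp).2 (by linarith)
  have g1 : lowerC * b ^ 2 * 1 ≤ lowerC * b ^ 2 * (R / R ^ ((1 : ℝ) / 3)) := by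
    have := lowerC_ge
    gcongr
  have g2 : longC * b ^ 2 * √R ≤ longC * b ^ 2 * (R / R ^ ((1 : ℝ) / 3)) := by
    have := longC_nonneg
    gcongr
  rw [div_le_iff₀ hR0]
  have : (limitEnergy a b + rateC * (b ^ 2 / R ^ ((1 : ℝ) / 3))) * R =
      R * limitEnergy a b + 2 * (lowerC * b ^ 2 * (R / R ^ ((1 : ℝ) / 3))) +
        longC * b ^ 2 * (R / R ^ ((1 : ℝ) / 3)) := by
    unfold rateC; ring
  linarith

theorem tendsto_groundEnergy_div (ha : a < 0) (ha1 : -1 ≤ a) (hb : 1 / |a| ≤ b) :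
    Tendsto (fun R => groundEnergy a b R / R) atTop (𝓝 (limitEnergy a b)) := by
  have h1 : Tendsto (fun R : ℝ => limitEnergy a b + rateC * (b ^ 2 / R ^ ((1 : ℝ) / 3))) atTop
      (𝓝 (limitEnergy a b)) := by
    have := (((tendsto_rpow_atTop (by norm_num : (0 : ℝ) < 1 / 3)).const_div_atTop
      (b ^ 2)).const_mul rateC).const_add (limitEnergy a b)
    simpa using this
  refine tendsto_of_tendsto_of_tendsto_of_le_of_le' tendsto_const_nhds h1 ?_ ?_
  · filter_upwards [eventually_gt_atTop 0] with R hR using limitEnergy_le ha ha1 hb hR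
  · filter_upwards [eventually_ge_atTop 4] with R hR using groundEnergy_div_le ha ha1 hb hR

end StepGL

end

/-! ### Dependence on b, and the threshold b = 1/β -/

noncomputable section

namespace StepGL

variable {a b b' R M L : ℝ} {u v₁ v₂ : ℝ × ℝ → ℂ}

theorem glE_mono (hb : b ≤ b') : glE b u v₁ v₂ ≤ glE b' u v₁ v₂ := by
  have : 0 ≤ (∫ x, ‖v₁ x‖ ^ 2) + ∫ x, ‖v₂ x‖ ^ 2 := by positivity
  unfold glE
  gcongr

theorem monotoneOn_limitEnergy (ha : a < 0) (ha1 : -1 ≤ a) :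
    MonotoneOn (limitEnergy a) (Ici (1 / |a|)) := by
  intro b hb b' hb' hbb
  refine le_limitEnergy fun R hR => (limitEnergy_le ha ha1 hb hR).trans ?_
  gcongr
  exact le_groundEnergy fun u v₁ v₂ h =>
    (groundEnergy_le (bddBelow_energyValues ha ha1 hb hR) h).trans (glE_mono hbb)

/-- For each configuration the energy is affine in b, and infima of affine functions are concave. -/
theorem concaveOn_limitEnergy (ha : a < 0) (ha1 : -1 ≤ a) :
    ConcaveOn ℝ (Ici (1 / |a|)) (limitEnergy a) := by
  refine ⟨convex_Ici _, fun b hb b' hb' s t hs ht hst => le_limitEnergy fun R hR => ?_⟩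
  simp only [smul_eq_mul]
  have h1 := mul_le_mul_of_nonneg_left (limitEnergy_le ha ha1 hb hR) hs
  have h2 := mul_le_mul_of_nonneg_left (limitEnergy_le ha ha1 hb' hR) ht
  refine (add_le_add h1 h2).trans ?_
  rw [mul_div_assoc', mul_div_assoc', ← add_div]
  gcongr
  refine le_groundEnergy fun u v₁ v₂ h => ?_
  have k1 := mul_le_mul_of_nonneg_left
    (groundEnergy_le (bddBelow_energyValues ha ha1 hb hR) h) hs
  have k2 := mul_le_mul_of_nonneg_left
    (groundEnergy_le (bddBelow_energyValues ha ha1 hb' hR) h) ht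
  refine (add_le_add k1 k2).trans_eq ?_
  obtain rfl : s = 1 - t := by linarith
  unfold glE
  ring

/-- Concavity says nothing about continuity at the endpoint. There monotonicity bounds e from below,
and e is upper semicontinuous as an infimum of functions continuous in b. -/
theorem continuousWithinAt_limitEnergy_left (ha : a < 0) (ha1 : -1 ≤ a) :
    ContinuousWithinAt (limitEnergy a) (Ici (1 / |a|)) (1 / |a|) := by
  refine tendsto_order.2 ⟨fun c hc => ?_, fun c hc => ?_⟩
  · filter_upwards [self_mem_nhdsWithin] with b hb
    exact hc.trans_le (monotoneOn_limitEnergy ha ha1 self_mem_Ici hb hb)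
  · obtain ⟨_, ⟨R, hR, rfl⟩, hlt⟩ := exists_lt_of_csInf_lt (nonempty_Ioi.image _) hc
    rw [mem_Ioi] at hR
    simp only [div_lt_iff₀ hR] at hlt
    obtain ⟨E, hE, hlt⟩ := exists_lt_of_csInf_lt ⟨0, zero_mem_energyValues a _ R⟩ hlt
    obtain ⟨u, v₁, v₂, h, rfl⟩ := mem_energyValues_iff.1 hE
    have hc : Continuous fun b => glE b u v₁ v₂ := by unfold glE; fun_prop
    filter_upwards [self_mem_nhdsWithin,
      mem_nhdsWithin_of_mem_nhds (hc.continuousAt.eventually_lt_const hlt)] with b hb hb'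
    refine (limitEnergy_le ha ha1 hb hR).trans_lt ?_
    rw [div_lt_iff₀ hR]
    exact (groundEnergy_le (bddBelow_energyValues ha ha1 hb hR) h).trans_lt hb'

theorem continuousOn_limitEnergy (ha : a < 0) (ha1 : -1 ≤ a) :
    ContinuousOn (limitEnergy a) (Ici (1 / |a|)) := by
  intro b hb
  rcases (mem_Ici.1 hb).eq_or_lt with rfl | hb
  · exact continuousWithinAt_limitEnergy_left ha ha1
  · have h := (concaveOn_limitEnergy ha ha1).continuousOn_interior
    rw [interior_Ici] at h
    exact (h.continuousAt (Ioi_mem_nhds hb)).continuousWithinAt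

theorem limitEnergy_eq_zero (ha : a < 0) (ha1 : -1 ≤ a) (hb : 1 / |a| ≤ b)
    (h : 1 / beta a ≤ b) : limitEnergy a b = 0 := by
  refine (limitEnergy_nonpos ha ha1 hb).antisymm (le_limitEnergy fun R hR => ?_)
  have hβ := beta_pos ha ha1
  have hb0 : 0 ≤ b := (by positivity : 0 ≤ 1 / |a|).trans hb
  refine div_nonneg (le_groundEnergy fun u v₁ v₂ hu => ?_) hR.le
  exact glE_nonneg_of_form hb0 ((div_le_iff₀ hβ).1 h) hu.mag.beta_mul_le

theorem glE_const_mul (t : ℝ) :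
    glE b (fun x => (t : ℂ) * u x) (fun x => (t : ℂ) * v₁ x) (fun x => (t : ℂ) * v₂ x) =
      t ^ 2 * (b * ((∫ x, ‖v₁ x‖ ^ 2) + ∫ x, ‖v₂ x‖ ^ 2) - ∫ x, ‖u x‖ ^ 2) +
        t ^ 4 * (1 / 2 * ∫ x, ‖u x‖ ^ 4) := by
  have h4 : |t| ^ 4 = t ^ 4 := by rw [show 4 = 2 * 2 by rfl, pow_mul, pow_mul, sq_abs]
  simp only [glE, norm_mul, Complex.norm_real, Real.norm_eq_abs, mul_pow, integral_const_mul,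
    sq_abs, h4]
  ring

theorem exists_glE_neg (h : b * ((∫ x, ‖v₁ x‖ ^ 2) + ∫ x, ‖v₂ x‖ ^ 2) < ∫ x, ‖u x‖ ^ 2) :
    ∃ t : ℝ,
      glE b (fun x => (t : ℂ) * u x) (fun x => (t : ℂ) * v₁ x) (fun x => (t : ℂ) * v₂ x) < 0 := by
  set p := b * ((∫ x, ‖v₁ x‖ ^ 2) + ∫ x, ‖v₂ x‖ ^ 2) - ∫ x, ‖u x‖ ^ 2 with hp
  set q := 1 / 2 * ∫ x, ‖u x‖ ^ 4 with hq
  have hp0 : p < 0 := by linarith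
  have hq0 : 0 ≤ q := by positivity
  have hs : 0 < -p / (q + 1) := div_pos (by linarith) (by linarith)
  -- The energy of tu is t²(p + t²q), and with t² = -p/(q + 1) the bracket equals p/(q + 1) < 0.
  refine ⟨√(-p / (q + 1)), ?_⟩
  rw [glE_const_mul, show (4 : ℕ) = 2 * 2 by rfl, pow_mul, Real.sq_sqrt hs.le, ← hp]
  have h1 : -p / (q + 1) * (q + 1) = -p := div_mul_cancel₀ _ (by linarith)
  have h2 : p + -p / (q + 1) * q < 0 := by linarith
  nlinarith

theorem IsCTest.exists_adm {ϕ : ℝ × ℝ → ℂ} (h : IsCTest ϕ) (a : ℝ) :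
    ∃ R > 0, Adm a R ϕ (mag1 a ϕ) (mag2 ϕ) := by
  obtain ⟨r, hr, hs⟩ := h.2.isCompact.isBounded.subset_closedBall_lt 0 0
  refine ⟨4 * r, by positivity, h.magH1 a, fun x hx => ?_, ?_⟩
  · have hx' : x ∉ tsupport ϕ := by
      intro hx'
      have h1 := hs hx'
      rw [mem_closedBall_zero_iff] at h1
      have h2 := abs_le.1 ((norm_fst_le x).trans h1)
      rw [mem_strip] at hx
      exact hx ⟨by linarith [h2.1], by linarith [h2.2]⟩
    have h0 : ϕ x = 0 := image_eq_zero_of_notMem_tsupport hx'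
    have h1 : fderiv ℝ ϕ x = 0 :=
      image_eq_zero_of_notMem_tsupport fun h => hx' (tsupport_fderiv_subset ℝ h)
    simp [mag1, mag2, h0, h1]
  · have hc : Continuous fun x => ‖ϕ x‖ ^ 4 := h.continuous.norm.pow 4
    exact hc.integrable_of_hasCompactSupport (h.2.comp_left (g := fun z : ℂ => ‖z‖ ^ 4) (by simp))

/-- A test function with quotient below 1/b is supported in some strip of finite length R, and since
e is an infimum, negative energy on one strip is enough. -/
theorem limitEnergy_neg (ha : a < 0) (ha1 : -1 ≤ a) (hb : 1 / |a| ≤ b) (h : b < 1 / beta a) :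
    limitEnergy a b < 0 := by
  have hb0 : 0 < b := (one_div_pos.2 (abs_pos.2 ha.ne)).trans_le hb
  obtain ⟨ϕ, hϕ, hlt⟩ := exists_test_lt ((lt_one_div hb0 (beta_pos ha ha1)).1 h)
  obtain ⟨R, hR, hA⟩ := hϕ.exists_adm a
  rw [one_div, inv_mul_eq_div, lt_div_iff₀' hb0] at hlt
  obtain ⟨t, ht⟩ := exists_glE_neg hlt
  have hAt : Adm a R (fun x => (t : ℂ) * ϕ x) (fun x => (t : ℂ) * mag1 a ϕ x)
      (fun x => (t : ℂ) * mag2 ϕ x) := by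
    refine ⟨hA.mag.const_mul t, fun x hx => ?_, ?_⟩
    · obtain ⟨e0, e1, e2⟩ := hA.eq_zero x hx
      simp [e0, e1, e2]
    · simpa only [norm_mul, mul_pow] using hA.quartic.const_mul (‖(t : ℂ)‖ ^ 4)
  refine (limitEnergy_le ha ha1 hb hR).trans_lt (div_neg_of_neg_of_pos ?_ hR)
  exact (groundEnergy_le (bddBelow_energyValues ha ha1 hb hR) hAt).trans_lt ht

theorem limitEnergy_eq_zero_iff (ha : a < 0) (ha1 : -1 ≤ a) (hb : 1 / |a| ≤ b) :
    limitEnergy a b = 0 ↔ 1 / beta a ≤ b := by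
  refine ⟨fun h => ?_, limitEnergy_eq_zero ha ha1 hb⟩
  by_contra! hlt
  exact (limitEnergy_neg ha ha1 hb hlt).ne h

theorem groundEnergy_eq_zero_of_pos (ha : 0 < a) (ha1 : a < 1) (hb : 1 / |a| ≤ b) :
    groundEnergy a b R = 0 :=
  IsLeast.csInf_eq ⟨zero_mem_energyValues a b R, energyValues_nonneg_of_pos ha ha1 hb⟩

end StepGL

end

/-- Finiteness of the infimum is the clause `BddBelow`, which is needed because the real `sInf` of a
set unbounded below is 0. Quantifying C before a, b and R expresses its universality. -/
theorem theorem3p1 :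
    ∃ (e : ℝ → ℝ → ℝ) (C : ℝ), 0 < C ∧
      ∀ a : ℝ, -1 ≤ a → a < 1 → a ≠ 0 →
        (∀ b : ℝ, 1 / |a| ≤ b → ∀ R : ℝ, 0 < R →
          BddBelow (StepGL.energyValues a b R) ∧
          StepGL.groundEnergy a b R ≤ 0 ∧
          (0 < a → StepGL.groundEnergy a b R = 0)) ∧
        (a < 0 →
          (∀ b : ℝ, 1 / |a| ≤ b →
            e a b ≤ 0 ∧
            Tendsto (fun R : ℝ => StepGL.groundEnergy a b R / R) atTop (𝓝 (e a b)) ∧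
            (e a b = 0 ↔ 1 / StepGL.beta a ≤ b)) ∧
          MonotoneOn (e a) (Ici (1 / |a|)) ∧
          ContinuousOn (e a) (Ici (1 / |a|)) ∧
          (∀ b : ℝ, 1 / |a| ≤ b → ∀ R : ℝ, 4 ≤ R →
            e a b ≤ StepGL.groundEnergy a b R / R ∧
            StepGL.groundEnergy a b R / R ≤ e a b + C * (b ^ 2 / R ^ ((1 : ℝ) / 3)))) := by
  refine ⟨StepGL.limitEnergy, StepGL.rateC, StepGL.rateC_pos, fun a ha1 ha2 ha0 =>
    ⟨fun b hb R hR => ?_, fun ha => ⟨fun b hb => ?_, ?_, ?_, fun b hb R hR => ?_⟩⟩⟩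
  · rcases lt_or_gt_of_ne ha0 with ha | ha
    · have hbd := StepGL.bddBelow_energyValues ha ha1 hb hR
      exact ⟨hbd, StepGL.groundEnergy_nonpos hbd, fun h => absurd h ha.not_gt⟩
    · have h0 := StepGL.groundEnergy_eq_zero_of_pos (R := R) ha ha2 hb
      exact ⟨⟨0, StepGL.energyValues_nonneg_of_pos ha ha2 hb⟩, h0.le, fun _ => h0⟩
  · exact ⟨StepGL.limitEnergy_nonpos ha ha1 hb, StepGL.tendsto_groundEnergy_div ha ha1 hb,
      StepGL.limitEnergy_eq_zero_iff ha ha1 hb⟩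
  · exact StepGL.monotoneOn_limitEnergy ha ha1
  · exact StepGL.continuousOn_limitEnergy ha ha1
  · exact ⟨StepGL.limitEnergy_le ha ha1 hb (by linarith), StepGL.groundEnergy_div_le ha ha1 hb hR⟩
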